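/- Let $a>0$, $\alpha_0\ge 0$, $\alpha>0$, $\beta_0,\beta\in\mathbb C$, let $q\in L^2(0,a)$ be complex-valued, and for a choice of sign let $L(q,\alpha_0,\beta_0,\pm\alpha,\beta)$ be the eigenvalue problem $$-y''+q(x)y=\lambda^2y\ \text{ on }(0,a),\qquad y'(0)-(i\alpha_0\lambda+\beta_0)y(0)=0,\qquad y'(a)+(\pm i\alpha\lambda+\beta)y(a)=0 .$$ Its eigenvalues are the $\lambda\in\mathbb C$ for which a nontrivial solution exists. They are the zeros of the entire characteristic function $\Delta_\pm(\lambda)=y'(\lambda,a)+(\pm i\alpha\lambda+\beta)y(\lambda,a)$, where $y(\lambda,\cdot)$ is the solution of the equation with $y(\lambda,0)=1$, $y'(\lambda,0)=i\alpha_0\lambda+\beta_0$, and they are counted with their multiplicities as zeros of $\Delta_\pm$. When $(\alpha_0-1)(1-\alpha)\neq 0$, put $$P_0^\pm=\ln\frac{|\alpha_0\pm\alpha+1\pm\alpha\alpha_0|}{|\alpha_0\pm\alpha-(1\pm\alpha\alpha_0)|},\qquad P=\frac{\beta_0}{\pi(1-\alpha_0^2)}+\frac{\beta}{\pi(1-\alpha^2)}+\frac1{2\pi}\int_0^a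 q(t)\,dt .$$ (1) If $(\alpha_0-1)(1-\alpha)>0$, then for each sign the eigenvalues of $L(q,\alpha_0,\beta_0,\pm\alpha,\beta)$ can be numbered as $\{\lambda_k^\pm\}_{k\in\mathbb Z}$ so that, for $k\ne0$, $$\lambda_k^\pm=\frac{\pi}{a}\Big(|k|-\frac12\Big)\operatorname{sgn}k+\frac{iP_0^\pm}{2a}+\frac Pk+\frac{\beta_k^\pm}{k},\qquad \{\beta_k^\pm\}_{k\neq0}\in\ell^2 .$$ (2) If $(\alpha_0-1)(1-\alpha)<0$, then for each sign the eigenvalues of $L(q,\alpha_0,\beta_0,\pm\alpha,\beta)$ can be numbered as $\{\lambda_k^\pm\}_{k\in\mathbb Z\setminus\{0\}}$ so that $$\lambda_k^\pm=\frac{\pi}{a}(|k|-1)\operatorname{sgn}k+\frac{iP_0^\pm}{2a}+\frac Pk+\frac{\beta_k^\pm}{k},\qquad \{\beta_k^\pm\}_{k\neq0}\in\ell^2 .$$ (3) If $(\alpha_0-1)(1-\alpha)=0$, then the problems $L(q,\alpha_0,\beta_0,\pm\alpha,\beta)$ may have only finitely many eigenvalues: for all such $a,\alpha_0,\alpha$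 there are $q\in L^2(0,a)$ and $\beta_0,\beta\in\mathbb C$ for which both problems have only finitely many. If, for some $q\in L^2(0,a)$ and $\beta_0,\beta\in\mathbb C$, the problem $L(q,\alpha_0,\beta_0,\alpha,\beta)$ has infinitely many eigenvalues, then, counted with multiplicity, they can be numbered as $\{\lambda_k^+\}_{k\in\mathbb Z}$, and for every such numbering $\operatorname{Im}\lambda_k^+\to+\infty$ as $|k|\to\infty$. -/

import Mathlib

open MeasureTheory Set Filter

/-- The data of the generalized Regge problem `L(q, α₀, β₀, α, β)` on the interval `(0, a)`:
`-y'' + q y = λ² y`, `y'(0) - (i α₀ λ + β₀) y(0) = 0`, `y'(a) + (i α λ + β) y(a) = 0`.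
Only the values of `q` on `(0, a)` matter. -/
structure ReggeProblem where
  /-- length of the interval -/
  a : ℝ
  /-- complex-valued potential -/
  q : ℝ → ℂ
  /-- coefficient of `i λ` in the condition at `0` -/
  α₀ : ℝ
  /-- constant coefficient in the condition at `0` -/
  β₀ : ℂ
  /-- coefficient of `i λ` in the condition at `a` -/
  α : ℝ
  /-- constant coefficient in the condition at `a` -/
  β : ℂ

namespace ReggeProblem

/-- `y` is a solution on `[0, a]` of `-y'' + q y = z² y`, with derivative `y'`: the function `y` is
differentiable on `[0, a]` (one-sidedly at the end points), its derivative `y'` is absolutely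
continuous, and the equation holds almost everywhere on `(0, a)`. -/
structure IsSolution (L : ReggeProblem) (z : ℂ) (y y' : ℝ → ℂ) : Prop where
  hasDeriv : ∀ x ∈ Icc 0 L.a, HasDerivWithinAt y (y' x) (Icc 0 L.a) x
  absCont : AbsolutelyContinuousOnInterval y' 0 L.a
  equation : ∀ᵐ x ∂(volume.restrict (Ioo 0 L.a)),
    ∃ y'' : ℂ, HasDerivAt y' y'' x ∧ -y'' + L.q x * y x = z ^ 2 * y x

/-- `z` is an eigenvalue: there is a nontrivial solution that satisfies both boundary conditions. -/
def IsEigenvalue (L : ReggeProblem) (z : ℂ) : Prop :=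
  ∃ y y' : ℝ → ℂ, L.IsSolution z y y' ∧ (∃ x ∈ Icc 0 L.a, y x ≠ 0) ∧
    y' 0 - (Complex.I * L.α₀ * z + L.β₀) * y 0 = 0 ∧
    y' L.a + (Complex.I * L.α * z + L.β) * y L.a = 0

/-- The spectrum: the set of all eigenvalues. -/
def spectrum (L : ReggeProblem) : Set ℂ := {z | L.IsEigenvalue z}

/-- `Δ` is the characteristic function of the problem: `Δ(z) = y'(z, a) + (i α z + β) y(z, a)`, where
`y(z, ·)` solves the equation with `y(z, 0) = 1` and `y'(z, 0) = i α₀ z + β₀`. -/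
def IsCharFun (L : ReggeProblem) (Δ : ℂ → ℂ) : Prop :=
  ∀ z : ℂ, ∃ y y' : ℝ → ℂ, L.IsSolution z y y' ∧
    y 0 = 1 ∧ y' 0 = Complex.I * L.α₀ * z + L.β₀ ∧
    Δ z = y' L.a + (Complex.I * L.α * z + L.β) * y L.a

/-- The family `ev` lists exactly the eigenvalues of the problem, each as often as its algebraic
multiplicity, i.e. its order as a zero of the entire characteristic function. -/
def IsEigenvalueEnumeration (L : ReggeProblem) {ι : Type} (ev : ι → ℂ) : Prop :=
  range ev = L.spectrum ∧
  ∃ Δ : ℂ → ℂ, L.IsCharFun Δ ∧ Differentiable ℂ Δ ∧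
    ∀ z : ℂ, {k : ι | ev k = z}.encard = analyticOrderAt Δ z

/-- `P₀ = ln (|α₀ + α + 1 + α α₀| / |α₀ + α - (1 + α α₀)|)`; the versions with the signs `±` are
`P₀ α₀ α` and `P₀ α₀ (-α)`. -/
noncomputable def P₀ (α₀ α : ℝ) : ℝ :=
  Real.log (|α₀ + α + 1 + α * α₀| / |α₀ + α - (1 + α * α₀)|)

/-- `P = β₀ / (π (1 - α₀²)) + β / (π (1 - α²)) + (1 / π) (1/2) ∫₀ᵃ q`. -/
noncomputable def P (L : ReggeProblem) : ℂ :=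
  L.β₀ / (Real.pi * (1 - L.α₀ ^ 2)) + L.β / (Real.pi * (1 - L.α ^ 2)) +
    ((1 / 2) * ∫ x in (0 : ℝ)..L.a, L.q x) / Real.pi

end ReggeProblem

/-! Variation of constants for `y' ± i z y` writes the solution as a combination of e^{izx} and
e^{-izx} plus Duhamel integrals. The weighted maximum of `y` is thereby bounded, and reinserting the
bound gives, up to O(e^{|Im z|a}/|z|), Δ(z) = (iz/2)(A e^{iza} + B e^{-iza}) + m₊ e^{iza} + m₋
e^{-iza} + Fourier transforms of `q`, with A = (1+α₀)(1+α) and B = (α₀-1)(1-α)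
(`IsCharFun.asymptotics`).

If A and B are nonzero, the two leading exponentials have equal modulus on the line Im z = c =
P₀/(2a). In the variable w = a(z - ic) the normalised Δ is w sin(w - eπ/2) + O(e^{|Im w|}), where e
is 0 or 1 according to the sign of AB. A lower bound for the sine and Rouché's theorem give one
simple zero near every large node nπ + eπ/2 and the exact number of zeros in a large disc
(`IsSinePerturbation.exists_enumeration`). The factor w adds one zero at the origin. For e = 1 the
total matches numbering by ℤ; for e = 0 the origin is a double zero of the model and the index 0 is
left out.

At a zero with w = node + δ the expansion reads zδ = πP + Fourier terms + O(1/k), and az = kπ +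
O(1), hence δ/a = P/k + b_k/k (`exists_remainder_bound`). The frequencies lie within O(1/k) of a
shifted lattice, so Bessel's inequality makes b_k square summable.

If B = 0, then e^{iza} dominates in every half plane Im z ≤ T, where the zeros are therefore bounded
(`IsCharFun.exists_norm_le_of_im_le`). The finite examples have `q = 0`, and their Δ is an
exponential times a polynomial of degree at most one. -/

/-! ### Absolutely continuous complex functions. -/

theorem intervalIntegrable_re_im {f : ℝ → ℂ} {a b : ℝ} (hf : IntervalIntegrable f volume a b) :
    IntervalIntegrable (fun x => (f x).re) volume a b ∧
      IntervalIntegrable (fun x => (f x).im) volume a b :=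
  ⟨⟨hf.1.re, hf.2.re⟩, ⟨hf.1.im, hf.2.im⟩⟩

/-- The indefinite integral of an integrable complex function is absolutely continuous. -/
theorem absolutelyContinuousOnInterval_integral {f : ℝ → ℂ} {a b : ℝ}
    (hf : IntervalIntegrable f volume a b) :
    AbsolutelyContinuousOnInterval (fun x => ∫ t in a..x, f t) a b := by
  obtain ⟨hre, him⟩ := intervalIntegrable_re_im hf
  have const (c : ℂ) : AbsolutelyContinuousOnInterval (fun _ : ℝ => c) a b :=
    ((LipschitzWith.const c).lipschitzOnWith (s := uIcc a b)).absolutelyContinuousOnInterval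
  have h1 := (hre.absolutelyContinuousOnInterval_intervalIntegral (c := a) (by simp)).fun_smul
    (const 1)
  have h2 := (him.absolutelyContinuousOnInterval_intervalIntegral (c := a) (by simp)).fun_smul
    (const Complex.I)
  have h3 := h1.fun_add h2
  have key : ∀ x ∈ uIcc a b, ∫ t in a..x, f t =
      (∫ t in a..x, (f t).re) • (1 : ℂ) + (∫ t in a..x, (f t).im) • Complex.I := by
    intro x hx
    have hfx : IntervalIntegrable f volume a x := hf.mono_set (uIcc_subset_uIcc_left hx)
    obtain ⟨hr, hi⟩ := intervalIntegrable_re_im hfx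
    have hr' : IntervalIntegrable (fun t => ((f t).re : ℂ)) volume a x := ⟨hr.1.ofReal, hr.2.ofReal⟩
    have hi' : IntervalIntegrable (fun t => ((f t).im : ℂ)) volume a x := ⟨hi.1.ofReal, hi.2.ofReal⟩
    have : ∀ t, f t = (((f t).re : ℝ) : ℂ) + (((f t).im : ℝ) : ℂ) * Complex.I :=
      fun t => (Complex.re_add_im _).symm
    conv_lhs => enter [1, t]; rw [this t]
    rw [intervalIntegral.integral_add hr' (hi'.mul_const _),
      intervalIntegral.integral_mul_const, intervalIntegral.integral_ofReal,
      intervalIntegral.integral_ofReal]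
    simp
  rw [absolutelyContinuousOnInterval_iff] at h3 ⊢
  intro ε hε
  obtain ⟨δ, hδ, h⟩ := h3 ε hε
  refine ⟨δ, hδ, fun E hE hs => ?_⟩
  refine lt_of_eq_of_lt (Finset.sum_congr rfl fun i hi => ?_) (h E hE hs)
  rw [key _ (hE.1 i hi).1, key _ (hE.1 i hi).2]

/-- The fundamental theorem of calculus for absolutely continuous complex functions. -/
theorem AbsolutelyContinuousOnInterval.eq_add_integral {f g : ℝ → ℂ} {a : ℝ} (ha : 0 < a)
    (hf : AbsolutelyContinuousOnInterval f 0 a) (hg : IntervalIntegrable g volume 0 a)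
    (hd : ∀ᵐ x ∂(volume.restrict (Ioo 0 a)), HasDerivAt f (g x) x) :
    ∀ x ∈ Icc 0 a, f x = f 0 + ∫ t in (0 : ℝ)..x, g t := by
  have hac := hf.fun_sub (absolutelyContinuousOnInterval_integral hg)
  have hIoo : ∀ᵐ x : ℝ, x ≠ 0 ∧ x ≠ a :=
    (Measure.ae_ne volume 0).and (Measure.ae_ne volume a)
  -- An absolutely continuous function whose derivative vanishes almost everywhere is constant.
  have hzero : ∀ᵐ x, x ∈ uIcc 0 a →
      HasDerivAt (fun x => f x - ∫ t in (0 : ℝ)..x, g t) 0 x := by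
    rw [ae_restrict_iff' measurableSet_Ioo] at hd
    filter_upwards [hd, hg.ae_hasDerivAt_integral, hIoo] with x h1 h2 h3 hx
    rw [uIcc_of_le ha.le] at hx
    have hx' : x ∈ Ioo 0 a := ⟨lt_of_le_of_ne hx.1 (Ne.symm h3.1), lt_of_le_of_ne hx.2 h3.2⟩
    have := (h1 hx').sub (h2 (by rwa [uIcc_of_le ha.le]) 0 (by simp))
    rwa [sub_self] at this
  obtain ⟨C, hC⟩ := hac.const_of_ae_hasDerivAt_zero hzero
  intro x hx
  have h0 := hC 0 (by simp)
  have h1 := hC x (by rwa [uIcc_of_le ha.le])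
  simp only [intervalIntegral.integral_same, sub_zero] at h0
  rw [h0, ← h1]; ring

/-! ### Integral identities for solutions. -/

theorem ReggeProblem.IsSolution.continuousOn {L : ReggeProblem} {z : ℂ} {y y' : ℝ → ℂ}
    (h : L.IsSolution z y y') : ContinuousOn y (Icc 0 L.a) :=
  fun x hx => (h.hasDeriv x hx).continuousWithinAt

theorem ReggeProblem.IsSolution.intervalIntegrable_mul {L : ReggeProblem} {z : ℂ} {y y' : ℝ → ℂ}
    (h : L.IsSolution z y y') (ha : 0 < L.a) (hq : IntervalIntegrable L.q volume 0 L.a)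
    {g : ℝ → ℂ} (hg : Continuous g) :
    IntervalIntegrable (fun t => g t * (L.q t * y t)) volume 0 L.a := by
  refine (hq.mul_continuousOn ?_).continuousOn_mul hg.continuousOn
  rw [uIcc_of_le ha.le]; exact h.continuousOn

theorem ReggeProblem.IsSolution.deriv_eq {L : ReggeProblem} {z : ℂ} {y y' : ℝ → ℂ}
    (h : L.IsSolution z y y') (ha : 0 < L.a) (hq : IntervalIntegrable L.q volume 0 L.a) :
    ∀ x ∈ Icc 0 L.a, y' x = y' 0 + ∫ t in (0 : ℝ)..x, (L.q t - z ^ 2) * y t := by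
  have hy : ContinuousOn y (uIcc 0 L.a) := by rw [uIcc_of_le ha.le]; exact h.continuousOn
  refine h.absCont.eq_add_integral ha ((hq.sub intervalIntegrable_const).mul_continuousOn hy) ?_
  filter_upwards [h.equation] with x ⟨y'', h1, h2⟩
  convert h1 using 1
  linear_combination h2

theorem ReggeProblem.IsSolution.eq_add_integral {L : ReggeProblem} {z : ℂ} {y y' : ℝ → ℂ}
    (h : L.IsSolution z y y') (ha : 0 < L.a) :
    ∀ x ∈ Icc 0 L.a, y x = y 0 + ∫ t in (0 : ℝ)..x, y' t := by
  intro x hx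
  have hsub : Icc 0 x ⊆ Icc 0 L.a := Icc_subset_Icc_right hx.2
  have hc : ContinuousOn y' (Icc 0 L.a) := by
    have := h.absCont.continuousOn
    rwa [uIcc_of_le ha.le] at this
  rw [intervalIntegral.integral_eq_sub_of_hasDeriv_right_of_le hx.1 (h.continuousOn.mono hsub)
    (fun t ht => ((h.hasDeriv t ⟨ht.1.le, ht.2.le.trans hx.2⟩).hasDerivAt
      (Icc_mem_nhds ht.1 (ht.2.trans_le hx.2))).hasDerivWithinAt)]
  · ring
  · apply ContinuousOn.intervalIntegrable
    rw [uIcc_of_le hx.1]; exact hc.mono hsub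

/-- Variation of constants for the factors `y' + μ y`, `μ = ± i z`. -/
theorem ReggeProblem.IsSolution.variation {L : ReggeProblem} {z : ℂ} {y y' : ℝ → ℂ}
    (h : L.IsSolution z y y') (ha : 0 < L.a) (hq : IntervalIntegrable L.q volume 0 L.a)
    {μ : ℂ} (hμ : μ ^ 2 = -z ^ 2) :
    ∀ x ∈ Icc 0 L.a, y' x + μ * y x = Complex.exp (μ * x) * (y' 0 + μ * y 0) +
      ∫ t in (0 : ℝ)..x, Complex.exp (μ * (x - t)) * (L.q t * y t) := by
  have hexp (x : ℝ) : HasDerivAt (fun t : ℝ => Complex.exp (-μ * t))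
      (Complex.exp (-μ * x) * (-μ)) x := by
    have h1 : HasDerivAt (fun t : ℝ => -μ * (t : ℂ)) (-μ) x := by
      simpa using (Complex.ofRealCLM.hasDerivAt (x := x)).const_mul (-μ)
    exact h1.cexp
  have hcd : ContDiff ℝ 1 (fun t : ℝ => Complex.exp (-μ * t)) :=
    (contDiff_const.mul Complex.ofRealCLM.contDiff).cexp
  have hyAC : AbsolutelyContinuousOnInterval y 0 L.a := by
    have hc : IntervalIntegrable y' volume 0 L.a := h.absCont.continuousOn.intervalIntegrable
    have := absolutelyContinuousOnInterval_integral hc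
    rw [absolutelyContinuousOnInterval_iff] at this ⊢
    intro ε hε
    obtain ⟨δ, hδ, h'⟩ := this ε hε
    refine ⟨δ, hδ, fun E hE hs => lt_of_eq_of_lt (Finset.sum_congr rfl fun i hi => ?_) (h' E hE hs)⟩
    have m1 := (hE.1 i hi).1
    have m2 := (hE.1 i hi).2
    rw [uIcc_of_le ha.le] at m1 m2
    rw [h.eq_add_integral ha _ m1, h.eq_add_integral ha _ m2, dist_add_left]
  -- Integrating factor: since y'' = (q - z²) y and μ² = -z², the derivative of e^{-μt}(y' + μy) is
  -- e^{-μt} q y.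
  have hac : AbsolutelyContinuousOnInterval
      (fun t : ℝ => Complex.exp (-μ * t) * (y' t + μ * y t)) 0 L.a :=
    (hcd.contDiffOn.absolutelyContinuousOnInterval).fun_smul
      (h.absCont.fun_add (hyAC.const_smul μ))
  have hint := h.intervalIntegrable_mul ha hq (g := fun t : ℝ => Complex.exp (-μ * t))
    (by fun_prop)
  intro x hx
  have key := hac.eq_add_integral ha hint (by
    rw [ae_restrict_iff' measurableSet_Ioo]
    have := (ae_restrict_iff' measurableSet_Ioo).1 h.equation
    filter_upwards [this] with x hx hxm
    obtain ⟨y'', h1, h2⟩ := hx hxm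
    have h3 := (h.hasDeriv x ⟨hxm.1.le, hxm.2.le⟩).hasDerivAt (Icc_mem_nhds hxm.1 hxm.2)
    have h4 := (hexp x).fun_mul (h1.fun_add (h3.const_mul μ))
    refine h4.congr_deriv ?_
    linear_combination -Complex.exp (-μ * x) * h2 - Complex.exp (-μ * x) * y x * hμ) x hx
  have e1 : Complex.exp (μ * x) * Complex.exp (-μ * x) = 1 := by
    rw [← Complex.exp_add]; simp
  have e2 : ∫ t in (0 : ℝ)..x, Complex.exp (μ * (x - t)) * (L.q t * y t) =
      Complex.exp (μ * x) * ∫ t in (0 : ℝ)..x, Complex.exp (-μ * t) * (L.q t * y t) := by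
    rw [← intervalIntegral.integral_const_mul]
    congr 1; ext t
    rw [← mul_assoc (Complex.exp (μ * x)), ← Complex.exp_add]; congr 2; ring
  rw [e2]
  simp only [Complex.ofReal_zero, mul_zero, Complex.exp_zero, one_mul] at key
  linear_combination Complex.exp (μ * x) * key - (y' x + μ * y x) * e1

theorem AbsolutelyContinuousOnInterval.congr_on {f g : ℝ → ℂ} {a b : ℝ}
    (hf : AbsolutelyContinuousOnInterval f a b) (h : ∀ x ∈ uIcc a b, g x = f x) :
    AbsolutelyContinuousOnInterval g a b := by
  rw [absolutelyContinuousOnInterval_iff] at hf ⊢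
  intro ε hε
  obtain ⟨δ, hδ, h'⟩ := hf ε hε
  refine ⟨δ, hδ, fun E hE hs => lt_of_eq_of_lt (Finset.sum_congr rfl fun i hi => ?_) (h' E hE hs)⟩
  rw [h _ (hE.1 i hi).1, h _ (hE.1 i hi).2]

/-! ### Volterra operators and the Cauchy problem. -/

theorem intervalIntegrable_mul_IccExtend {a : ℝ} (ha : 0 ≤ a) {p : ℝ → ℂ}
    (hp : IntervalIntegrable p volume 0 a) (f : C(Icc (0 : ℝ) a, ℂ)) {x : ℝ} (hx : x ∈ Icc 0 a) :
    IntervalIntegrable (fun t => p t * IccExtend ha f t) volume 0 x := by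
  refine IntervalIntegrable.mul_continuousOn ?_ f.continuous.Icc_extend'.continuousOn
  refine hp.mono_set ?_
  rw [uIcc_of_le ha, uIcc_of_le hx.1]; exact Icc_subset_Icc_right hx.2

theorem norm_integral_mul_le {p g : ℝ → ℂ} {x : ℝ} (hx : 0 ≤ x) {C : ℝ}
    (hp : IntervalIntegrable p volume 0 x) (hg : ∀ t ∈ Icc 0 x, ‖g t‖ ≤ C) :
    ‖∫ t in (0 : ℝ)..x, p t * g t‖ ≤ (∫ t in (0 : ℝ)..x, ‖p t‖) * C := by
  rw [← intervalIntegral.integral_mul_const]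
  refine intervalIntegral.norm_integral_le_of_norm_le hx ?_ (hp.norm.mul_const C)
  refine Eventually.of_forall fun t ht => ?_
  rw [norm_mul]
  exact mul_le_mul_of_nonneg_left (hg t ⟨ht.1.le, ht.2⟩) (norm_nonneg _)

theorem integral_norm_mono {p : ℝ → ℂ} {a x : ℝ} (hp : IntervalIntegrable p volume 0 a)
    (hx : x ∈ Icc 0 a) : ∫ t in (0 : ℝ)..x, ‖p t‖ ≤ ∫ t in (0 : ℝ)..a, ‖p t‖ :=
  intervalIntegral.integral_mono_interval le_rfl hx.1 hx.2
    (Eventually.of_forall fun _ => norm_nonneg _) hp.norm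

theorem continuous_integral_IccExtend {a : ℝ} (ha : 0 ≤ a) {p : ℝ → ℂ}
    (hp : IntervalIntegrable p volume 0 a) (f : C(Icc (0 : ℝ) a, ℂ)) :
    Continuous fun x : Icc (0 : ℝ) a => ∫ t in (0 : ℝ)..x, p t * IccExtend ha f t := by
  have h := intervalIntegral.continuousOn_primitive_interval'
    (intervalIntegrable_mul_IccExtend ha hp f (right_mem_Icc.2 ha)) left_mem_uIcc
  rw [uIcc_of_le ha] at h
  exact h.domRestrict

/-- The operator `f ↦ ∫₀ˣ p f` on `C([0, a])`. -/
noncomputable def volterra (a : ℝ) (ha : 0 ≤ a) (p : ℝ → ℂ)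
    (hp : IntervalIntegrable p volume 0 a) :
    C(Icc (0 : ℝ) a, ℂ) →L[ℂ] C(Icc (0 : ℝ) a, ℂ) :=
  LinearMap.mkContinuous
    { toFun := fun f => ⟨fun x => ∫ t in (0 : ℝ)..x, p t * IccExtend ha f t,
        continuous_integral_IccExtend ha hp f⟩
      map_add' := fun f g => by
        ext x
        simp only [ContinuousMap.coe_mk, ContinuousMap.add_apply]
        rw [← intervalIntegral.integral_add (intervalIntegrable_mul_IccExtend ha hp f x.2)
          (intervalIntegrable_mul_IccExtend ha hp g x.2)]
        congr 1; ext t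
        simp [IccExtend, mul_add]
      map_smul' := fun c f => by
        ext x
        simp only [ContinuousMap.coe_mk, ContinuousMap.smul_apply, RingHom.id_apply, smul_eq_mul]
        rw [← intervalIntegral.integral_const_mul]
        congr 1; ext t
        simp [IccExtend, mul_left_comm] }
    (∫ t in (0 : ℝ)..a, ‖p t‖) fun f => by
      have hQ : 0 ≤ ∫ t in (0 : ℝ)..a, ‖p t‖ :=
        intervalIntegral.integral_nonneg ha fun _ _ => norm_nonneg _
      rw [ContinuousMap.norm_le _ (by positivity)]
      intro x
      refine (norm_integral_mul_le x.2.1 (hp.mono_set ?_) (C := ‖f‖) fun t ht => ?_).trans ?_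
      · rw [uIcc_of_le ha, uIcc_of_le x.2.1]; exact Icc_subset_Icc_right x.2.2
      · exact f.norm_coe_le_norm _
      · exact mul_le_mul_of_nonneg_right (integral_norm_mono hp x.2) (norm_nonneg _)

theorem volterra_apply {a : ℝ} (ha : 0 ≤ a) {p : ℝ → ℂ} (hp : IntervalIntegrable p volume 0 a)
    (f : C(Icc (0 : ℝ) a, ℂ)) (x : Icc (0 : ℝ) a) :
    volterra a ha p hp f x = ∫ t in (0 : ℝ)..x, p t * IccExtend ha f t := rfl

theorem norm_volterra_le {a : ℝ} (ha : 0 ≤ a) {p : ℝ → ℂ} (hp : IntervalIntegrable p volume 0 a)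
    {K M : ℝ} (hK : 0 ≤ K) (hM : 0 ≤ M) (f : C(Icc (0 : ℝ) a, ℂ))
    (hf : ∀ x, ‖f x‖ ≤ M * Real.exp (K * x)) (x : Icc (0 : ℝ) a) :
    ‖volterra a ha p hp f x‖ ≤ (∫ t in (0 : ℝ)..a, ‖p t‖) * (M * Real.exp (K * x)) := by
  rw [volterra_apply]
  refine (norm_integral_mul_le x.2.1 (hp.mono_set ?_) (C := M * Real.exp (K * x))
    fun t ht => ?_).trans ?_
  · rw [uIcc_of_le ha, uIcc_of_le x.2.1]; exact Icc_subset_Icc_right x.2.2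
  · rw [IccExtend_of_mem _ _ ⟨ht.1, ht.2.trans x.2.2⟩]
    refine (hf _).trans ?_
    have := ht.2
    gcongr
  · exact mul_le_mul_of_nonneg_right (integral_norm_mono hp x.2) (by positivity)

/-- Integrating the weight e^{Kt} itself gains the factor 1/K, which `norm_volterra_le` does not
have. -/
theorem norm_volterra_one_le {a : ℝ} (ha : 0 ≤ a)
    {K M : ℝ} (hK : 0 < K) (hM : 0 ≤ M) (f : C(Icc (0 : ℝ) a, ℂ))
    (hf : ∀ x, ‖f x‖ ≤ M * Real.exp (K * x)) (x : Icc (0 : ℝ) a) :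
    ‖volterra a ha (fun _ => 1) intervalIntegrable_const f x‖ ≤ M / K * Real.exp (K * x) := by
  rw [volterra_apply]
  have h1 : ‖∫ t in (0 : ℝ)..x, 1 * IccExtend ha f t‖ ≤
      ∫ t in (0 : ℝ)..x, M * Real.exp (K * t) := by
    refine intervalIntegral.norm_integral_le_of_norm_le x.2.1 ?_
      (Continuous.intervalIntegrable (by fun_prop) _ _)
    refine Eventually.of_forall fun t ht => ?_
    rw [one_mul, IccExtend_of_mem _ _ ⟨ht.1.le, ht.2.trans x.2.2⟩]
    exact hf _
  refine h1.trans ?_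
  have h2 : ∫ t in (0 : ℝ)..x, M * Real.exp (K * t) =
      M / K * Real.exp (K * x) - M / K * Real.exp (K * 0) := by
    refine intervalIntegral.integral_eq_sub_of_hasDerivAt (f := fun t => M / K * Real.exp (K * t))
      (fun t _ => ?_) (Continuous.intervalIntegrable (by fun_prop) _ _)
    have := (((hasDerivAt_id t).const_mul K).exp).const_mul (M / K)
    refine this.congr_deriv ?_
    simp only [id, mul_one]
    field_simp
  rw [h2]
  have : 0 ≤ M / K * Real.exp (K * 0) := by positivity
  linarith

namespace ReggeProblem

variable (L : ReggeProblem)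

/-- The operator `f ↦ ∫₀ˣ (q - z²) f`. -/
noncomputable def potentialOp (ha : 0 ≤ L.a) (hq : IntervalIntegrable L.q volume 0 L.a) (z : ℂ) :
    C(Icc (0 : ℝ) L.a, ℂ) →L[ℂ] C(Icc (0 : ℝ) L.a, ℂ) :=
  volterra L.a ha L.q hq - z ^ 2 • volterra L.a ha (fun _ => 1) intervalIntegrable_const

/-- The operator of the integral equation `y = y(0) + x y'(0) + ∫₀ˣ ∫₀ˢ (q - z²) y`. -/
noncomputable def picardOp (ha : 0 ≤ L.a) (hq : IntervalIntegrable L.q volume 0 L.a) (z : ℂ) :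
    C(Icc (0 : ℝ) L.a, ℂ) →L[ℂ] C(Icc (0 : ℝ) L.a, ℂ) :=
  volterra L.a ha (fun _ => 1) intervalIntegrable_const ∘L L.potentialOp ha hq z

theorem potentialOp_apply (ha : 0 ≤ L.a) (hq : IntervalIntegrable L.q volume 0 L.a) (z : ℂ)
    (f : C(Icc (0 : ℝ) L.a, ℂ)) (x : Icc (0 : ℝ) L.a) :
    L.potentialOp ha hq z f x = ∫ t in (0 : ℝ)..x, (L.q t - z ^ 2) * IccExtend ha f t := by
  have h1 := intervalIntegrable_mul_IccExtend ha hq f x.2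
  have h2 := intervalIntegrable_mul_IccExtend ha
    (intervalIntegrable_const (c := (1 : ℂ)) (μ := volume)) f x.2
  simp only [potentialOp, sub_apply, smul_apply,
    ContinuousMap.sub_apply, ContinuousMap.smul_apply, volterra_apply, smul_eq_mul]
  rw [← intervalIntegral.integral_const_mul, ← intervalIntegral.integral_sub h1 (h2.const_mul _)]
  congr 1; ext t; ring

/-- Multiplication by `exp (K x)` on `C([0, a])`. -/
noncomputable def expMul (a K : ℝ) : C(Icc (0 : ℝ) a, ℂ) →L[ℂ] C(Icc (0 : ℝ) a, ℂ) :=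
  ContinuousLinearMap.mul ℂ _ ⟨fun x => ((Real.exp (K * x) : ℝ) : ℂ), by fun_prop⟩

theorem expMul_apply (a K : ℝ) (f : C(Icc (0 : ℝ) a, ℂ)) (x : Icc (0 : ℝ) a) :
    expMul a K f x = (Real.exp (K * x) : ℝ) * f x := rfl

theorem expMul_mul_neg (a K : ℝ) : expMul a K * expMul a (-K) = 1 := by
  ext f x
  change ((Real.exp (K * x) : ℝ) : ℂ) * ((Real.exp (-K * x) : ℝ) * f x) = f x
  rw [← mul_assoc, ← Complex.ofReal_mul, ← Real.exp_add]
  simp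

theorem one_sub_eq_conj {R : Type*} [Ring R] {A B : R} (h : A * B = 1) (W : R) :
    1 - W = A * (1 - B * W * A) * B := by
  have e : A * (B * W * A) * B = A * B * W * (A * B) := by simp only [mul_assoc]
  rw [mul_sub, sub_mul, e, h, mul_one, h, one_mul, mul_one]

/-- After conjugation by the weight e^{Kx} (a Bielecki norm) the inner operator costs at most Q and
the outer integration gains 1/K. With K = Q + 1 the result is a contraction for every z, and the
Neumann series applies without any smallness condition. -/
theorem isUnit_one_sub_picardOp (ha : 0 ≤ L.a) (hq : IntervalIntegrable L.q volume 0 L.a)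
    (z : ℂ) : IsUnit (1 - L.picardOp ha hq z) := by
  set Q : ℝ := (∫ t in (0 : ℝ)..L.a, ‖L.q t‖) + ‖z‖ ^ 2 * ∫ t in (0 : ℝ)..L.a, ‖(1 : ℂ)‖ with hQ
  have hQ0 : 0 ≤ Q := by
    have h1 : 0 ≤ ∫ t in (0 : ℝ)..L.a, ‖L.q t‖ :=
      intervalIntegral.integral_nonneg ha fun _ _ => norm_nonneg _
    have h2 : 0 ≤ ∫ t in (0 : ℝ)..L.a, ‖(1 : ℂ)‖ :=
      intervalIntegral.integral_nonneg ha fun _ _ => norm_nonneg _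
    positivity
  set K : ℝ := Q + 1 with hK
  have hK0 : 0 < K := by linarith
  set T := expMul L.a (-K) * L.picardOp ha hq z * expMul L.a K with hT
  have h1 : expMul L.a K * expMul L.a (-K) = 1 := expMul_mul_neg _ _
  have h2 : expMul L.a (-K) * expMul L.a K = 1 := by simpa using expMul_mul_neg L.a (-K)
  have hnorm : ‖T‖ ≤ Q / K := by
    refine ContinuousLinearMap.opNorm_le_bound _ (by positivity) fun f => ?_
    rw [ContinuousMap.norm_le _ (by positivity)]
    intro x
    have b1 : ∀ x, ‖expMul L.a K f x‖ ≤ ‖f‖ * Real.exp (K * x) := fun x => by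
      rw [expMul_apply, norm_mul, Complex.norm_real, Real.norm_of_nonneg (Real.exp_pos _).le,
        mul_comm]
      exact mul_le_mul_of_nonneg_right (f.norm_coe_le_norm _) (Real.exp_pos _).le
    have b2 : ∀ x, ‖L.potentialOp ha hq z (expMul L.a K f) x‖ ≤ Q * ‖f‖ * Real.exp (K * x) := by
      intro x
      have c1 := norm_volterra_le ha hq hK0.le (norm_nonneg f) _ b1 x
      have c2 := norm_volterra_le ha (p := fun _ => 1) intervalIntegrable_const hK0.le
        (norm_nonneg f) _ b1 x
      simp only [potentialOp, sub_apply, smul_apply,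
        ContinuousMap.sub_apply, ContinuousMap.smul_apply, smul_eq_mul]
      refine (norm_sub_le _ _).trans ?_
      rw [norm_mul, norm_pow]
      calc _ ≤ _ := add_le_add c1 (mul_le_mul_of_nonneg_left c2 (by positivity))
        _ = _ := by rw [hQ]; ring
    have b3 := norm_volterra_one_le ha hK0 (by positivity) _ b2 x
    change ‖((Real.exp (-K * x) : ℝ) : ℂ) * volterra L.a ha (fun _ => 1) intervalIntegrable_const
      (L.potentialOp ha hq z (expMul L.a K f)) x‖ ≤ _
    rw [norm_mul, Complex.norm_real, Real.norm_of_nonneg (Real.exp_pos _).le]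
    calc _ ≤ Real.exp (-K * x) * (Q * ‖f‖ / K * Real.exp (K * x)) :=
          mul_le_mul_of_nonneg_left b3 (Real.exp_pos _).le
      _ = Q / K * ‖f‖ * Real.exp (-K * x + K * x) := by rw [Real.exp_add]; ring
      _ = Q / K * ‖f‖ := by simp
  have hu : IsUnit (1 - T) := (Units.oneSub T
    (hnorm.trans_lt ((div_lt_one hK0).2 (by linarith)))).isUnit
  have hEK : IsUnit (expMul L.a K) := ⟨⟨_, _, h1, h2⟩, rfl⟩
  have hEK' : IsUnit (expMul L.a (-K)) := ⟨⟨_, _, h2, h1⟩, rfl⟩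
  have : 1 - L.picardOp ha hq z = expMul L.a K * (1 - T) * expMul L.a (-K) :=
    one_sub_eq_conj (A := expMul L.a K) (B := expMul L.a (-K)) h1 (L.picardOp ha hq z)
  rw [this]
  exact (hEK.mul hu).mul hEK'

/-- The function `c + m x` on `[0, a]`. -/
noncomputable def affineMap (a : ℝ) (c m : ℂ) : C(Icc (0 : ℝ) a, ℂ) :=
  ⟨fun x => c + m * (x : ℝ), by fun_prop⟩

variable {L}

/-- A continuous function on `[0, a]` as an element of `C([0, a])`. -/
noncomputable def restrictIcc {a : ℝ} {y : ℝ → ℂ} (h : ContinuousOn y (Icc 0 a)) :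
    C(Icc (0 : ℝ) a, ℂ) := ⟨fun x => y x, h.domRestrict⟩

theorem IsSolution.integral_equation {z : ℂ} {y y' : ℝ → ℂ}
    (h : L.IsSolution z y y') (ha : 0 < L.a) (hq : IntervalIntegrable L.q volume 0 L.a) :
    (1 - L.picardOp ha.le hq z) (restrictIcc h.continuousOn) =
      affineMap L.a (y 0) (y' 0) := by
  ext x
  set f := restrictIcc h.continuousOn with hf
  have hpot : ∀ s : Icc (0 : ℝ) L.a, L.potentialOp ha.le hq z f s = y' s - y' 0 := by
    intro s
    rw [potentialOp_apply, h.deriv_eq ha hq s s.2, add_sub_cancel_left]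
    refine intervalIntegral.integral_congr fun t ht => ?_
    rw [uIcc_of_le s.2.1] at ht
    rw [IccExtend_of_mem _ _ ⟨ht.1, ht.2.trans s.2.2⟩]; rfl
  have hc : ContinuousOn y' (uIcc 0 (x : ℝ)) :=
    h.absCont.continuousOn.mono (by
      rw [uIcc_of_le ha.le, uIcc_of_le x.2.1]; exact Icc_subset_Icc_right x.2.2)
  have hW : L.picardOp ha.le hq z f x = y x - y 0 - x * y' 0 := by
    simp only [picardOp, ContinuousLinearMap.comp_apply, volterra_apply]
    have : ∫ t in (0 : ℝ)..x, 1 * IccExtend ha.le (L.potentialOp ha.le hq z f) t =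
        ∫ t in (0 : ℝ)..x, (y' t - y' 0) := by
      refine intervalIntegral.integral_congr fun t ht => ?_
      rw [uIcc_of_le x.2.1] at ht
      simp only [one_mul]
      rw [IccExtend_of_mem _ _ ⟨ht.1, ht.2.trans x.2.2⟩, hpot]
    rw [this, intervalIntegral.integral_sub hc.intervalIntegrable intervalIntegrable_const,
      h.eq_add_integral ha x x.2]
    simp
  simp only [sub_apply, one_apply_eq_self,
    ContinuousMap.sub_apply, hW]
  change y x - (y x - y 0 - x * y' 0) = y 0 + y' 0 * x
  ring

/-- Solutions with the same Cauchy data have the same image under the invertible operator 1 -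
`picardOp`; the derivatives then agree by `IsSolution.deriv_eq`. -/
theorem IsSolution.unique {z : ℂ} {y y' w w' : ℝ → ℂ} (h : L.IsSolution z y y')
    (hw : L.IsSolution z w w') (ha : 0 < L.a) (hq : IntervalIntegrable L.q volume 0 L.a)
    (h0 : y 0 = w 0) (h0' : y' 0 = w' 0) : ∀ x ∈ Icc 0 L.a, y x = w x ∧ y' x = w' x := by
  have hu := L.isUnit_one_sub_picardOp ha.le hq z
  have e := (h.integral_equation ha hq).trans
    ((congrArg₂ (affineMap L.a) h0 h0').trans (hw.integral_equation ha hq).symm)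
  obtain ⟨u, hu⟩ := hu
  have e2 := congrArg (fun f => (↑u⁻¹ : C(Icc (0 : ℝ) L.a, ℂ) →L[ℂ] C(Icc (0 : ℝ) L.a, ℂ)) f) e
  have hinv : ∀ f, (↑u⁻¹ : C(Icc (0 : ℝ) L.a, ℂ) →L[ℂ] C(Icc (0 : ℝ) L.a, ℂ))
      ((1 - L.picardOp ha.le hq z) f) = f := fun f => by
    rw [← hu]; exact DFunLike.congr_fun u.inv_mul f
  simp only [hinv] at e2
  have hyw : ∀ x ∈ Icc 0 L.a, y x = w x := fun x hx => by
    exact DFunLike.congr_fun e2 ⟨x, hx⟩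
  refine fun x hx => ⟨hyw x hx, ?_⟩
  rw [h.deriv_eq ha hq x hx, hw.deriv_eq ha hq x hx, h0']
  congr 1
  refine intervalIntegral.integral_congr fun t ht => ?_
  rw [uIcc_of_le hx.1] at ht
  simp only [hyw t ⟨ht.1, ht.2.trans hx.2⟩]

theorem differentiable_sub_sq_smul {F : Type*} [NormedAddCommGroup F] [NormedSpace ℂ F]
    (A V : F →L[ℂ] F) : Differentiable ℂ (fun z : ℂ => A - z ^ 2 • V) := by
  have h2 : Differentiable ℂ (fun z : ℂ => z ^ 2) := by fun_prop
  exact (differentiable_const _).sub (h2.smul_const V)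

/-- A family of solutions with `y(z, 0) = 1` and `y'(z, 0) = m z`, entire in `z`. -/
theorem exists_entire_solutions (ha : 0 < L.a) (hq : IntervalIntegrable L.q volume 0 L.a)
    {m : ℂ → ℂ} (hm : Differentiable ℂ m) :
    ∃ Y Y' : ℂ → ℝ → ℂ, (∀ z, L.IsSolution z (Y z) (Y' z) ∧ Y z 0 = 1 ∧ Y' z 0 = m z) ∧
      Differentiable ℂ (fun z => Y z L.a) ∧ Differentiable ℂ (fun z => Y' z L.a) := by
  -- Inversion is holomorphic on units, and z enters only through z² and the entire function `m`.
  -- Hence u, the solution, and v, its derivative, are entire with values in C([0, a]).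
  set u : ℂ → C(Icc (0 : ℝ) L.a, ℂ) := fun z => Ring.inverse (1 - L.picardOp ha.le hq z) (affineMap L.a 1 (m z))
    with hu
  set v : ℂ → C(Icc (0 : ℝ) L.a, ℂ) := fun z => affineMap L.a (m z) 0 + L.potentialOp ha.le hq z (u z) with hv
  have hpot : Differentiable ℂ (fun z => L.potentialOp ha.le hq z) := by
    unfold potentialOp
    exact differentiable_sub_sq_smul _ _
  have hW : Differentiable ℂ (fun z => L.picardOp ha.le hq z) := by
    unfold picardOp
    exact (differentiable_const _).clm_comp hpot
  have haff (c : ℂ → ℂ) (d : ℂ → ℂ) (hc : Differentiable ℂ c) (hd : Differentiable ℂ d) :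
      Differentiable ℂ (fun z => affineMap L.a (c z) (d z)) := by
    have : (fun z => affineMap L.a (c z) (d z)) =
        fun z => c z • affineMap L.a 1 0 + d z • affineMap L.a 0 1 := by
      ext z x; simp [affineMap]
    rw [this]
    fun_prop
  have hud : Differentiable ℂ u := by
    intro z
    refine DifferentiableAt.clm_apply ?_ (haff _ _ (differentiable_const _) hm z)
    exact DifferentiableAt.comp z (g := Ring.inverse)
      (differentiableAt_inverse (L.isUnit_one_sub_picardOp ha.le hq z))
      ((differentiable_const _).sub hW z)
  have hvd : Differentiable ℂ v :=
    (haff _ _ hm (differentiable_const _)).add (hpot.clm_apply hud)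
  have hueq : ∀ z, u z = affineMap L.a 1 (m z) + L.picardOp ha.le hq z (u z) := by
    intro z
    have := Ring.mul_inverse_cancel _ (L.isUnit_one_sub_picardOp ha.le hq z)
    have h2 : u z - L.picardOp ha.le hq z (u z) = affineMap L.a 1 (m z) :=
      DFunLike.congr_fun this (affineMap L.a 1 (m z))
    rw [← h2, sub_add_cancel]
  have hvc : ∀ z, Continuous (IccExtend ha.le (v z)) := fun z => (v z).continuous.Icc_extend'
  have hvx : ∀ z, ∀ x : Icc (0 : ℝ) L.a, v z x = m z + L.potentialOp ha.le hq z (u z) x :=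
    fun z x => by
      change m z + 0 * _ + L.potentialOp ha.le hq z (u z) x = _
      rw [zero_mul, add_zero]
  have hYu : ∀ z, ∀ x : Icc (0 : ℝ) L.a,
      1 + ∫ t in (0 : ℝ)..x, IccExtend ha.le (v z) t = u z x := by
    intro z x
    have : ∫ t in (0 : ℝ)..x, IccExtend ha.le (v z) t = m z * x +
        ∫ t in (0 : ℝ)..x, 1 * IccExtend ha.le (L.potentialOp ha.le hq z (u z)) t := by
      have : ∀ t, IccExtend ha.le (v z) t =
          m z + 1 * IccExtend ha.le (L.potentialOp ha.le hq z (u z)) t := fun t => by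
        simp only [IccExtend, Function.comp_apply, one_mul]
        exact hvx z _
      simp_rw [this]
      rw [intervalIntegral.integral_add intervalIntegrable_const
        (intervalIntegrable_mul_IccExtend ha.le intervalIntegrable_const _ x.2)]
      simp [mul_comm]
    rw [this, ← add_assoc]
    exact (DFunLike.congr_fun (hueq z) x).symm
  -- `IccExtend` makes v continuous on the whole line, so its primitive is differentiable at the end
  -- points too.
  refine ⟨fun z x => 1 + ∫ t in (0 : ℝ)..x, IccExtend ha.le (v z) t,
    fun z => IccExtend ha.le (v z), fun z => ⟨⟨fun x _ => ?_, ?_, ?_⟩, by simp, ?_⟩, ?_, ?_⟩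
  · exact ((intervalIntegral.integral_hasDerivAt_right ((hvc z).intervalIntegrable _ _)
      ((hvc z).stronglyMeasurableAtFilter _ _) (hvc z).continuousAt).const_add 1).hasDerivWithinAt
  · have h1 := absolutelyContinuousOnInterval_integral
      (intervalIntegrable_mul_IccExtend ha.le (hq.sub (intervalIntegrable_const (c := z ^ 2)))
        (u z) (right_mem_Icc.2 ha.le))
    have h2 : AbsolutelyContinuousOnInterval (fun _ : ℝ => m z) 0 L.a :=
      ((LipschitzWith.const (m z)).lipschitzOnWith (s := uIcc 0 L.a)).absolutelyContinuousOnInterval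
    refine (h2.fun_add h1).congr_on fun x hx => ?_
    rw [uIcc_of_le ha.le] at hx
    change IccExtend ha.le (v z) x = _
    rw [IccExtend_of_mem _ _ hx, hvx, potentialOp_apply]
  · have h1 := (intervalIntegrable_mul_IccExtend ha.le
      (hq.sub (intervalIntegrable_const (c := z ^ 2)))
        (u z) (right_mem_Icc.2 ha.le)).ae_hasDerivAt_integral
    rw [ae_restrict_iff' measurableSet_Ioo]
    filter_upwards [h1] with x hx hxm
    have hxI : x ∈ Icc 0 L.a := ⟨hxm.1.le, hxm.2.le⟩
    have h2 := (hx (by rwa [uIcc_of_le ha.le]) 0 (by simp)).const_add (m z)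
    refine ⟨_, h2.congr_of_eventuallyEq ?_, ?_⟩
    · filter_upwards [Icc_mem_nhds hxm.1 hxm.2] with t ht
      rw [IccExtend_of_mem _ _ ht, hvx, potentialOp_apply]
    · rw [hYu z ⟨x, hxI⟩, IccExtend_of_mem _ _ hxI]
      ring
  · change IccExtend ha.le (v z) 0 = _
    rw [IccExtend_of_mem _ _ (left_mem_Icc.2 ha.le), hvx, potentialOp_apply]
    simp
  · have : (fun z => 1 + ∫ t in (0 : ℝ)..L.a, IccExtend ha.le (v z) t) =
        fun z => ContinuousMap.evalCLM ℂ (⟨L.a, right_mem_Icc.2 ha.le⟩ : Icc (0 : ℝ) L.a) (u z) := by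
      ext z; exact hYu z ⟨L.a, right_mem_Icc.2 ha.le⟩
    rw [this]
    exact (ContinuousLinearMap.differentiable _).comp hud
  · have : (fun z => IccExtend ha.le (v z) L.a) =
        fun z => ContinuousMap.evalCLM ℂ (⟨L.a, right_mem_Icc.2 ha.le⟩ : Icc (0 : ℝ) L.a) (v z) := by
      ext z; exact IccExtend_of_mem _ _ (right_mem_Icc.2 ha.le)
    rw [this]
    exact (ContinuousLinearMap.differentiable _).comp hvd

end ReggeProblem

/-! ### The characteristic function and the spectrum. -/

namespace ReggeProblem

variable {L : ReggeProblem}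

theorem exists_charFun (ha : 0 < L.a) (hq : IntervalIntegrable L.q volume 0 L.a) :
    ∃ Δ : ℂ → ℂ, L.IsCharFun Δ ∧ Differentiable ℂ Δ := by
  obtain ⟨Y, Y', h, h1, h2⟩ := exists_entire_solutions ha hq
    (m := fun z => Complex.I * L.α₀ * z + L.β₀) (by fun_prop)
  refine ⟨fun z => Y' z L.a + (Complex.I * L.α * z + L.β) * Y z L.a,
    fun z => ⟨Y z, Y' z, (h z).1, (h z).2.1, (h z).2.2, rfl⟩, ?_⟩
  fun_prop

theorem IsCharFun.unique {Δ Δ' : ℂ → ℂ} (h : L.IsCharFun Δ) (h' : L.IsCharFun Δ') (ha : 0 < L.a)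
    (hq : IntervalIntegrable L.q volume 0 L.a) : Δ = Δ' := by
  ext z
  obtain ⟨y, y', hs, h0, h0', hd⟩ := h z
  obtain ⟨w, w', ws, w0, w0', wd⟩ := h' z
  obtain ⟨e1, e2⟩ := hs.unique ws ha hq (h0.trans w0.symm) (h0'.trans w0'.symm) L.a
    (right_mem_Icc.2 ha.le)
  rw [hd, wd, e1, e2]

theorem IsSolution.const_mul {z : ℂ} {y y' : ℝ → ℂ} (h : L.IsSolution z y y') (c : ℂ) :
    L.IsSolution z (fun x => c * y x) (fun x => c * y' x) where
  hasDeriv x hx := (h.hasDeriv x hx).const_mul c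
  absCont := h.absCont.const_smul c
  equation := by
    filter_upwards [h.equation] with x ⟨y'', h1, h2⟩
    exact ⟨c * y'', h1.const_mul c, by linear_combination c * h2⟩

/-- By uniqueness an eigenfunction is y(0) times the normalised solution. Hence y(0) ≠ 0, and its
condition at `a` reads y(0) Δ(z) = 0. -/
theorem IsCharFun.spectrum_eq {Δ : ℂ → ℂ} (h : L.IsCharFun Δ) (ha : 0 < L.a)
    (hq : IntervalIntegrable L.q volume 0 L.a) : L.spectrum = {z | Δ z = 0} := by
  ext z
  obtain ⟨w, w', ws, w0, w0', wd⟩ := h z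
  constructor
  · rintro ⟨y, y', hs, ⟨x, hx, hyx⟩, b0, ba⟩
    have hcw := ws.const_mul (y 0)
    have hu := hs.unique hcw ha hq (by simp [w0])
      (by rw [w0']; linear_combination b0)
    have hy0 : y 0 ≠ 0 := fun h0 => hyx (by rw [(hu x hx).1, h0, zero_mul])
    obtain ⟨e1, e2⟩ := hu L.a (right_mem_Icc.2 ha.le)
    rw [e1, e2] at ba
    refine (mul_eq_zero.1 (?_ : y 0 * Δ z = 0)).resolve_left hy0
    rw [wd]; linear_combination ba
  · intro hz
    refine ⟨w, w', ws, ⟨0, left_mem_Icc.2 ha.le, by simp [w0]⟩, ?_, ?_⟩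
    · rw [w0, w0']; ring
    · rw [← wd]; exact hz

end ReggeProblem

/-! ### Solutions for large spectral parameter. -/

theorem Complex.norm_exp_mul_ofReal_le {μ : ℂ} {τ x : ℝ} (hμ : |μ.re| ≤ τ) (hx : 0 ≤ x) :
    ‖Complex.exp (μ * x)‖ ≤ Real.exp (τ * x) := by
  rw [Complex.norm_exp, Real.exp_le_exp]
  have : (μ * x).re = μ.re * x := by simp
  rw [this]
  exact mul_le_mul_of_nonneg_right ((le_abs_self _).trans hμ) hx

theorem Complex.abs_re_I_mul (z : ℂ) : |(Complex.I * z).re| ≤ |z.im| := by simp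

theorem Complex.abs_re_neg_I_mul (z : ℂ) : |(-(Complex.I * z)).re| ≤ |z.im| := by simp

/-- The bound for the Duhamel integral of a function with exponential growth. -/
theorem norm_duhamel_le {q y : ℝ → ℂ} {a x τ m : ℝ} {μ : ℂ}
    (hq : IntervalIntegrable q volume 0 a) (hx : x ∈ Icc 0 a) (hμ : |μ.re| ≤ τ)
    (hm : 0 ≤ m) (hy : ∀ t ∈ Icc 0 a, ‖y t‖ ≤ m * Real.exp (τ * t)) :
    ‖∫ t in (0 : ℝ)..x, Complex.exp (μ * (x - t)) * (q t * y t)‖ ≤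
      (∫ t in (0 : ℝ)..a, ‖q t‖) * m * Real.exp (τ * x) := by
  have e : ∫ t in (0 : ℝ)..x, Complex.exp (μ * (x - t)) * (q t * y t) =
      ∫ t in (0 : ℝ)..x, q t * (Complex.exp (μ * (x - t : ℝ)) * y t) := by
    congr 1; ext t; push_cast; ring
  rw [e]
  have hsub : uIcc 0 x ⊆ uIcc 0 a := by
    rw [uIcc_of_le hx.1, uIcc_of_le (hx.1.trans hx.2)]; exact Icc_subset_Icc_right hx.2
  refine (norm_integral_mul_le hx.1 (hq.mono_set hsub) (C := m * Real.exp (τ * x))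
    fun t ht => ?_).trans ?_
  · rw [norm_mul]
    calc _ ≤ Real.exp (τ * (x - t)) * (m * Real.exp (τ * t)) :=
          mul_le_mul (Complex.norm_exp_mul_ofReal_le hμ (sub_nonneg.2 ht.2))
            (hy t ⟨ht.1, ht.2.trans hx.2⟩) (norm_nonneg _) (Real.exp_pos _).le
      _ = m * Real.exp (τ * (x - t) + τ * t) := by rw [Real.exp_add]; ring
      _ = _ := by ring_nf
  · rw [mul_assoc]
    exact mul_le_mul_of_nonneg_right (integral_norm_mono hq hx) (by positivity)

namespace ReggeProblem

/-- The leading term of the solution with `y(0) = 1`, `y'(0) = i α₀ z + β₀`. -/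
noncomputable def leading (L : ReggeProblem) (z : ℂ) (x : ℝ) : ℂ :=
  (1 + L.α₀) / 2 * Complex.exp (Complex.I * z * x) +
    (1 - L.α₀) / 2 * Complex.exp (-(Complex.I * z) * x)

variable {L : ReggeProblem}

theorem norm_leading_le (L : ReggeProblem) (z : ℂ) {x : ℝ} (hx : 0 ≤ x) :
    ‖L.leading z x‖ ≤ (1 + |L.α₀|) * Real.exp (|z.im| * x) := by
  have h1 := Complex.norm_exp_mul_ofReal_le (Complex.abs_re_I_mul z) hx
  have h2 := Complex.norm_exp_mul_ofReal_le (Complex.abs_re_neg_I_mul z) hx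
  have c1 : ‖((1 : ℂ) + L.α₀) / 2‖ ≤ (1 + |L.α₀|) / 2 := by
    rw [norm_div]
    have := norm_add_le (1 : ℂ) (L.α₀ : ℂ)
    simp only [norm_one, Complex.norm_real, Real.norm_eq_abs, Complex.norm_ofNat] at this ⊢
    linarith
  have c2 : ‖((1 : ℂ) - L.α₀) / 2‖ ≤ (1 + |L.α₀|) / 2 := by
    rw [norm_div]
    have := norm_sub_le (1 : ℂ) (L.α₀ : ℂ)
    simp only [norm_one, Complex.norm_real, Real.norm_eq_abs, Complex.norm_ofNat] at this ⊢
    linarith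
  unfold leading
  refine (norm_add_le _ _).trans ?_
  rw [norm_mul, norm_mul]
  have k1 := mul_le_mul c1 h1 (norm_nonneg _) (by positivity)
  have k2 := mul_le_mul c2 h2 (norm_nonneg _) (by positivity)
  linarith

/-- Subtracting the variation formulas for μ = iz and μ = -iz eliminates y' and leaves 2iz y. Its
free part is 2iz times `leading` up to terms in β₀, so division by z gains 1/|z|. -/
theorem IsSolution.norm_sub_leading_le {z : ℂ} {y y' : ℝ → ℂ} (h : L.IsSolution z y y')
    (ha : 0 < L.a) (hq : IntervalIntegrable L.q volume 0 L.a) (h0 : y 0 = 1)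
    (h0' : y' 0 = Complex.I * L.α₀ * z + L.β₀) (hz : z ≠ 0) {m : ℝ} (hm : 0 ≤ m)
    (hy : ∀ t ∈ Icc 0 L.a, ‖y t‖ ≤ m * Real.exp (|z.im| * t)) :
    ∀ x ∈ Icc 0 L.a, ‖y x - L.leading z x‖ ≤
      (‖L.β₀‖ + (∫ t in (0 : ℝ)..L.a, ‖L.q t‖) * m) / ‖z‖ * Real.exp (|z.im| * x) := by
  intro x hx
  have v1 := h.variation ha hq (μ := Complex.I * z) (by rw [mul_pow, Complex.I_sq]; ring) x hx
  have v2 := h.variation ha hq (μ := -(Complex.I * z))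
    (by rw [neg_sq, mul_pow, Complex.I_sq]; ring) x hx
  have d1 := norm_duhamel_le hq hx (Complex.abs_re_I_mul z) hm hy
  have d2 := norm_duhamel_le hq hx (Complex.abs_re_neg_I_mul z) hm hy
  have e1 := Complex.norm_exp_mul_ofReal_le (Complex.abs_re_I_mul z) hx.1
  have e2 := Complex.norm_exp_mul_ofReal_le (Complex.abs_re_neg_I_mul z) hx.1
  rw [h0, h0'] at v1 v2
  set E1 := Complex.exp (Complex.I * z * x)
  set E2 := Complex.exp (-(Complex.I * z) * x)
  set J1 := ∫ t in (0 : ℝ)..x, Complex.exp (Complex.I * z * (x - t)) * (L.q t * y t)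
  set J2 := ∫ t in (0 : ℝ)..x, Complex.exp (-(Complex.I * z) * (x - t)) * (L.q t * y t)
  set Q := ∫ t in (0 : ℝ)..L.a, ‖L.q t‖
  have key : 2 * Complex.I * z * (y x - L.leading z x) = L.β₀ * E1 - L.β₀ * E2 + J1 - J2 := by
    unfold leading
    linear_combination v1 - v2
  have hn : ‖2 * Complex.I * z * (y x - L.leading z x)‖ = 2 * ‖z‖ * ‖y x - L.leading z x‖ := by
    simp
  have hb : ‖L.β₀ * E1 - L.β₀ * E2 + J1 - J2‖ ≤ ‖L.β₀‖ * ‖E1‖ + ‖L.β₀‖ * ‖E2‖ + ‖J1‖ + ‖J2‖ := by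
    refine (norm_sub_le _ _).trans (add_le_add ((norm_add_le _ _).trans (add_le_add
      ((norm_sub_le _ _).trans ?_) le_rfl)) le_rfl)
    rw [norm_mul, norm_mul]
  have hz' : 0 < ‖z‖ := norm_pos_iff.2 hz
  rw [← key, hn] at hb
  rw [div_mul_eq_mul_div, le_div_iff₀ hz']
  have b1 := mul_le_mul_of_nonneg_left e1 (norm_nonneg L.β₀)
  have b2 := mul_le_mul_of_nonneg_left e2 (norm_nonneg L.β₀)
  linarith

/-- Uniform exponential bounds for the solution of large spectral parameter. -/
theorem exists_solution_bound (ha : 0 < L.a) (hq : IntervalIntegrable L.q volume 0 L.a) :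
    ∃ M R : ℝ, 0 < M ∧ 1 ≤ R ∧ ∀ z : ℂ, R ≤ ‖z‖ → ∀ y y' : ℝ → ℂ, L.IsSolution z y y' → y 0 = 1 →
      y' 0 = Complex.I * L.α₀ * z + L.β₀ → ∀ x ∈ Icc 0 L.a,
        ‖y x - L.leading z x‖ ≤ M / ‖z‖ * Real.exp (|z.im| * x) := by
  set Q := ∫ t in (0 : ℝ)..L.a, ‖L.q t‖ with hQ
  have hQ0 : 0 ≤ Q := intervalIntegral.integral_nonneg ha.le fun _ _ => norm_nonneg _
  -- For |z| ≥ 2Q + 1 the term Qm/|z| is at most m/2 and is absorbed, so m ≤ 2(1 + |α₀| + ‖β₀‖). The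
  -- first constant is ‖β₀‖ + Qm with this bound inserted; the extra 1 keeps it positive.
  refine ⟨‖L.β₀‖ + Q * (2 * (1 + |L.α₀| + ‖L.β₀‖)) + 1, 2 * Q + 1, by positivity, by linarith,
    fun z hz y y' h h0 h0' => ?_⟩
  have hz' : 0 < ‖z‖ := by linarith
  -- m is the norm of y with weight e^{-|Im z|x}; the estimate at a maximum point bounds m in terms
  -- of m/|z|.
  obtain ⟨x₀, hx₀, hmax⟩ := (isCompact_Icc (a := (0 : ℝ)) (b := L.a)).exists_isMaxOn
    ⟨0, left_mem_Icc.2 ha.le⟩ (f := fun x => ‖y x‖ * Real.exp (-(|z.im| * x)))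
    (h.continuousOn.norm.mul (by fun_prop))
  set m := ‖y x₀‖ * Real.exp (-(|z.im| * x₀)) with hm
  have hm0 : 0 ≤ m := by positivity
  have hexp : ∀ x : ℝ, Real.exp (-(|z.im| * x)) * Real.exp (|z.im| * x) = 1 := fun x => by
    rw [← Real.exp_add]; simp
  have hy : ∀ t ∈ Icc 0 L.a, ‖y t‖ ≤ m * Real.exp (|z.im| * t) := by
    intro t ht
    have := mul_le_mul_of_nonneg_right (hmax ht) (Real.exp_pos (|z.im| * t)).le
    simp only [mul_assoc, hexp, mul_one] at this
    rw [hm]; simpa [mul_assoc] using this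
  have hsub := h.norm_sub_leading_le ha hq h0 h0' (norm_pos_iff.1 hz') hm0 hy
  have hmle : m ≤ 2 * (1 + |L.α₀| + ‖L.β₀‖) := by
    have h1 := hsub x₀ hx₀
    have h2 := L.norm_leading_le z hx₀.1
    have h3 : ‖y x₀‖ ≤ (1 + |L.α₀| + (‖L.β₀‖ + Q * m) / ‖z‖) * Real.exp (|z.im| * x₀) := by
      have := norm_add_le (y x₀ - L.leading z x₀) (L.leading z x₀)
      rw [sub_add_cancel] at this
      linarith
    have h4 : m ≤ 1 + |L.α₀| + (‖L.β₀‖ + Q * m) / ‖z‖ := by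
      have := mul_le_mul_of_nonneg_right h3 (Real.exp_pos (-(|z.im| * x₀))).le
      rwa [mul_assoc, mul_comm (Real.exp _), hexp, mul_one] at this
    have h5 : (‖L.β₀‖ + Q * m) / ‖z‖ ≤ ‖L.β₀‖ + m / 2 := by
      rw [div_le_iff₀ hz']
      nlinarith [norm_nonneg L.β₀, mul_le_mul_of_nonneg_left hz (norm_nonneg L.β₀),
        mul_le_mul_of_nonneg_left hz hm0]
    linarith
  intro x hx
  refine (hsub x hx).trans (mul_le_mul_of_nonneg_right (div_le_div_of_nonneg_right ?_ hz'.le)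
    (Real.exp_pos _).le)
  have := mul_le_mul_of_nonneg_left hmle hQ0
  linarith

end ReggeProblem

/-! ### Two-term asymptotics of the characteristic function. -/

namespace ReggeProblem

/-- The leading part of the characteristic function. -/
noncomputable def charLeading (L : ReggeProblem) (z : ℂ) : ℂ :=
  Complex.I * z / 2 * ((1 + L.α₀) * (1 + L.α) * Complex.exp (Complex.I * z * L.a) +
    (L.α₀ - 1) * (1 - L.α) * Complex.exp (-(Complex.I * z) * L.a))

/-- The coefficient of `exp (i z a)` in the second term of the characteristic function. -/
noncomputable def charCoeffPos (L : ReggeProblem) : ℂ :=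
  (L.β₀ * (1 + L.α) + L.β * (1 + L.α₀)) / 2 +
    (1 + L.α) * (1 + L.α₀) / 4 * ∫ t in (0 : ℝ)..L.a, L.q t

/-- The coefficient of `exp (-i z a)` in the second term of the characteristic function. -/
noncomputable def charCoeffNeg (L : ReggeProblem) : ℂ :=
  (L.β₀ * (1 - L.α) + L.β * (1 - L.α₀)) / 2 +
    (1 - L.α) * (1 - L.α₀) / 4 * ∫ t in (0 : ℝ)..L.a, L.q t

/-- The finite Fourier transform `∫₀ᵃ exp (μ t) q(t) dt`. -/
noncomputable def expTransform (L : ReggeProblem) (μ : ℂ) : ℂ :=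
  ∫ t in (0 : ℝ)..L.a, Complex.exp (μ * t) * L.q t

/-- The second term of the characteristic function. -/
noncomputable def charSecond (L : ReggeProblem) (z : ℂ) : ℂ :=
  L.charCoeffPos * Complex.exp (Complex.I * z * L.a) +
    L.charCoeffNeg * Complex.exp (-(Complex.I * z) * L.a) +
    ((1 + L.α) * (1 - L.α₀) / 4 * Complex.exp (Complex.I * z * L.a) *
        L.expTransform (-(2 * (Complex.I * z))) +
      (1 - L.α) * (1 + L.α₀) / 4 * Complex.exp (-(Complex.I * z) * L.a) *
        L.expTransform (2 * (Complex.I * z)))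

variable {L : ReggeProblem}

theorem intervalIntegrable_exp_mul (hq : IntervalIntegrable L.q volume 0 L.a) (μ : ℂ) :
    IntervalIntegrable (fun t => Complex.exp (μ * t) * L.q t) volume 0 L.a :=
  hq.continuousOn_mul (by fun_prop)

/-- Used for μ = ±iz: one of the two frequencies is then 0 and yields ∫ q, the other is ∓2iz. -/
theorem integral_exp_mul_leading (hq : IntervalIntegrable L.q volume 0 L.a) (z μ : ℂ) :
    ∫ t in (0 : ℝ)..L.a, Complex.exp (μ * (L.a - t)) * (L.q t * L.leading z t) =
      (1 + L.α₀) / 2 * Complex.exp (μ * L.a) * L.expTransform (Complex.I * z - μ) +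
      (1 - L.α₀) / 2 * Complex.exp (μ * L.a) * L.expTransform (-(Complex.I * z) - μ) := by
  unfold expTransform
  rw [← intervalIntegral.integral_const_mul, ← intervalIntegral.integral_const_mul,
    ← intervalIntegral.integral_add ((intervalIntegrable_exp_mul hq _).const_mul _)
      ((intervalIntegrable_exp_mul hq _).const_mul _)]
  congr 1; ext t
  unfold leading
  have e1 : Complex.exp (μ * L.a) * Complex.exp ((Complex.I * z - μ) * t) =
      Complex.exp (μ * (L.a - t)) * Complex.exp (Complex.I * z * t) := by
    rw [← Complex.exp_add, ← Complex.exp_add]; congr 1; ring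
  have e2 : Complex.exp (μ * L.a) * Complex.exp ((-(Complex.I * z) - μ) * t) =
      Complex.exp (μ * (L.a - t)) * Complex.exp (-(Complex.I * z) * t) := by
    rw [← Complex.exp_add, ← Complex.exp_add]; congr 1; ring
  linear_combination -((1 + L.α₀) / 2 * L.q t) * e1 - ((1 - L.α₀) / 2 * L.q t) * e2

theorem integral_exp_mul_solution (ha : 0 < L.a) (hq : IntervalIntegrable L.q volume 0 L.a)
    {z : ℂ} {y y' : ℝ → ℂ} (h : L.IsSolution z y y') (μ : ℂ) :
    ∫ t in (0 : ℝ)..L.a, Complex.exp (μ * (L.a - t)) * (L.q t * y t) =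
      (∫ t in (0 : ℝ)..L.a, Complex.exp (μ * (L.a - t)) * (L.q t * L.leading z t)) +
      ∫ t in (0 : ℝ)..L.a, Complex.exp (μ * (L.a - t)) * (L.q t * (y t - L.leading z t)) := by
  have hl : ContinuousOn (L.leading z) (uIcc 0 L.a) := by unfold leading; fun_prop
  have hy : ContinuousOn y (uIcc 0 L.a) := by rw [uIcc_of_le ha.le]; exact h.continuousOn
  have hg : ContinuousOn (fun t : ℝ => Complex.exp (μ * (L.a - t))) (uIcc 0 L.a) := by fun_prop
  have hs : ContinuousOn (fun t => y t - L.leading z t) (uIcc 0 L.a) := hy.sub hl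
  rw [← intervalIntegral.integral_add ((hq.mul_continuousOn hl).continuousOn_mul hg)
    ((hq.mul_continuousOn hs).continuousOn_mul hg)]
  congr 1; ext t; ring

/-- Asymptotics of the characteristic function. -/
theorem IsCharFun.asymptotics {Δ : ℂ → ℂ} (hΔ : L.IsCharFun Δ) (ha : 0 < L.a)
    (hq : IntervalIntegrable L.q volume 0 L.a) :
    ∃ C R : ℝ, 0 < C ∧ 1 ≤ R ∧ ∀ z : ℂ, R ≤ ‖z‖ →
      ‖Δ z - (L.charLeading z + L.charSecond z)‖ ≤ C / ‖z‖ * Real.exp (|z.im| * L.a) := by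
  obtain ⟨M, R, hM, hR, hb⟩ := exists_solution_bound ha hq
  set Q := ∫ t in (0 : ℝ)..L.a, ‖L.q t‖ with hQ
  have hQ0 : 0 ≤ Q := intervalIntegral.integral_nonneg ha.le fun _ _ => norm_nonneg _
  refine ⟨‖((1 : ℂ) + L.α) / 2‖ * (Q * M) + ‖((1 : ℂ) - L.α) / 2‖ * (Q * M) + ‖L.β‖ * M + 1, R,
    by positivity, hR, fun z hz => ?_⟩
  have hz' : 0 < ‖z‖ := by linarith
  obtain ⟨y, y', h, h0, h0', hd⟩ := hΔ z
  have hsub := hb z hz y y' h h0 h0'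
  have haI := right_mem_Icc.2 ha.le
  have v1 := h.variation ha hq (μ := Complex.I * z) (by rw [mul_pow, Complex.I_sq]; ring) _ haI
  have v2 := h.variation ha hq (μ := -(Complex.I * z))
    (by rw [neg_sq, mul_pow, Complex.I_sq]; ring) _ haI
  rw [integral_exp_mul_solution ha hq h, integral_exp_mul_leading hq, h0, h0'] at v1 v2
  have d1 := norm_duhamel_le hq haI (Complex.abs_re_I_mul z) (by positivity) hsub
  have d2 := norm_duhamel_le hq haI (Complex.abs_re_neg_I_mul z) (by positivity) hsub
  have ha' := hsub _ haI
  set D1 := ∫ t in (0 : ℝ)..L.a,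
    Complex.exp (Complex.I * z * (L.a - t)) * (L.q t * (y t - L.leading z t))
  set D2 := ∫ t in (0 : ℝ)..L.a,
    Complex.exp (-(Complex.I * z) * (L.a - t)) * (L.q t * (y t - L.leading z t))
  have t0 : L.expTransform 0 = ∫ t in (0 : ℝ)..L.a, L.q t := by simp [expTransform]
  have s1 : Complex.I * z - Complex.I * z = 0 := by ring
  have s2 : -(Complex.I * z) - Complex.I * z = -(2 * (Complex.I * z)) := by ring
  have s3 : Complex.I * z - -(Complex.I * z) = 2 * (Complex.I * z) := by ring
  have s4 : -(Complex.I * z) - -(Complex.I * z) = 0 := by ring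
  rw [s1, s2, t0] at v1
  rw [s3, s4, t0] at v2
  -- Here y' + iαz y = (1+α)/2 (y' + iz y) + (1-α)/2 (y' - iz y), and y(a) in the β term is split
  -- into its leading part and the rest.
  have key : Δ z - (L.charLeading z + L.charSecond z) = (1 + L.α) / 2 * D1 + (1 - L.α) / 2 * D2 +
      L.β * (y L.a - L.leading z L.a) := by
    rw [hd]
    unfold charLeading charSecond charCoeffPos charCoeffNeg leading
    linear_combination (1 + L.α) / 2 * v1 + (1 - L.α) / 2 * v2
  rw [key]
  refine (norm_add_le _ _).trans ((add_le_add (norm_add_le _ _) le_rfl).trans ?_)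
  rw [norm_mul, norm_mul, norm_mul]
  have b1 := mul_le_mul_of_nonneg_left d1 (norm_nonneg (((1 : ℂ) + L.α) / 2))
  have b2 := mul_le_mul_of_nonneg_left d2 (norm_nonneg (((1 : ℂ) - L.α) / 2))
  have b3 := mul_le_mul_of_nonneg_left ha' (norm_nonneg L.β)
  refine (add_le_add (add_le_add b1 b2) b3).trans ?_
  have : 0 ≤ 1 / ‖z‖ * Real.exp (|z.im| * L.a) := by positivity
  have e : (‖((1 : ℂ) + L.α) / 2‖ * (Q * M) + ‖((1 : ℂ) - L.α) / 2‖ * (Q * M) + ‖L.β‖ * M + 1) /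
      ‖z‖ * Real.exp (|z.im| * L.a) = ‖((1 : ℂ) + L.α) / 2‖ * (Q * (M / ‖z‖) * Real.exp (|z.im| * L.a)) +
      ‖((1 : ℂ) - L.α) / 2‖ * (Q * (M / ‖z‖) * Real.exp (|z.im| * L.a)) +
      ‖L.β‖ * (M / ‖z‖ * Real.exp (|z.im| * L.a)) + 1 / ‖z‖ * Real.exp (|z.im| * L.a) := by ring
  rw [e]
  linarith

/-- Prefactor and transform are estimated together: e^{μa} e^{-2μt} = e^{μ(a-2t)} with |a - 2t| ≤ a.
Separate bounds would only give e^{3|Im z|a}. -/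
theorem norm_charSecond_le (ha : 0 < L.a) (hq : IntervalIntegrable L.q volume 0 L.a) :
    ∃ C : ℝ, 0 < C ∧ ∀ z : ℂ, ‖L.charSecond z‖ ≤ C * Real.exp (|z.im| * L.a) := by
  set Q := ∫ t in (0 : ℝ)..L.a, ‖L.q t‖ with hQ
  have hQ0 : 0 ≤ Q := intervalIntegral.integral_nonneg ha.le fun _ _ => norm_nonneg _
  refine ⟨‖L.charCoeffPos‖ + ‖L.charCoeffNeg‖ + ‖((1 : ℂ) + L.α) * (1 - L.α₀) / 4‖ * Q +
    ‖((1 : ℂ) - L.α) * (1 + L.α₀) / 4‖ * Q + 1, by positivity, fun z => ?_⟩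
  have aux : ∀ μ : ℂ, |μ.re| ≤ |z.im| →
      ‖Complex.exp (μ * L.a) * L.expTransform (-(2 * μ))‖ ≤ Q * Real.exp (|z.im| * L.a) := by
    intro μ hμ
    unfold expTransform
    rw [← intervalIntegral.integral_const_mul]
    have e : ∫ t in (0 : ℝ)..L.a, Complex.exp (μ * L.a) *
        (Complex.exp (-(2 * μ) * t) * L.q t) =
        ∫ t in (0 : ℝ)..L.a, L.q t * Complex.exp (μ * (L.a - 2 * t)) := by
      congr 1; ext t
      rw [← mul_assoc, ← Complex.exp_add, mul_comm]
      congr 2; ring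
    rw [e]
    refine norm_integral_mul_le ha.le hq fun t ht => ?_
    rw [Complex.norm_exp, Real.exp_le_exp]
    have h1 : (μ * (L.a - 2 * t)).re = μ.re * (L.a - 2 * t) := by
      have : (μ * (L.a - 2 * t)) = μ * ((L.a - 2 * t : ℝ) : ℂ) := by push_cast; ring
      rw [this, Complex.re_mul_ofReal]
    rw [h1]
    refine (le_abs_self _).trans ?_
    rw [abs_mul]
    refine mul_le_mul hμ ?_ (abs_nonneg _) (abs_nonneg _)
    rw [abs_le]; constructor <;> linarith [ht.1, ht.2]
  have a1 := aux _ (Complex.abs_re_I_mul z)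
  have a2 := aux _ (Complex.abs_re_neg_I_mul z)
  rw [mul_neg, neg_neg] at a2
  have e1 := Complex.norm_exp_mul_ofReal_le (Complex.abs_re_I_mul z) ha.le
  have e2 := Complex.norm_exp_mul_ofReal_le (Complex.abs_re_neg_I_mul z) ha.le
  have b1 := mul_le_mul_of_nonneg_left e1 (norm_nonneg L.charCoeffPos)
  have b2 := mul_le_mul_of_nonneg_left e2 (norm_nonneg L.charCoeffNeg)
  have b3 := mul_le_mul_of_nonneg_left a1 (norm_nonneg (((1 : ℂ) + L.α) * (1 - L.α₀) / 4))
  have b4 := mul_le_mul_of_nonneg_left a2 (norm_nonneg (((1 : ℂ) - L.α) * (1 + L.α₀) / 4))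
  rw [← norm_mul] at b1 b2 b3 b4
  unfold charSecond
  have n := (norm_add_le (L.charCoeffPos * Complex.exp (Complex.I * z * L.a) +
    L.charCoeffNeg * Complex.exp (-(Complex.I * z) * L.a)) _).trans
      (add_le_add (norm_add_le _ _) (norm_add_le ((1 + L.α) * (1 - L.α₀) / 4 *
        (Complex.exp (Complex.I * z * L.a) * L.expTransform (-(2 * (Complex.I * z)))))
      ((1 - L.α) * (1 + L.α₀) / 4 * (Complex.exp (-(Complex.I * z) * L.a) *
        L.expTransform (2 * (Complex.I * z))))))
  rw [mul_assoc _ (Complex.exp (Complex.I * z * L.a)),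
    mul_assoc _ (Complex.exp (-(Complex.I * z) * L.a))]
  have := Real.exp_pos (|z.im| * L.a)
  linarith

/-- The characteristic function is its leading part up to `O(exp (|Im z| a))`. -/
theorem IsCharFun.norm_sub_charLeading_le {Δ : ℂ → ℂ} (hΔ : L.IsCharFun Δ) (ha : 0 < L.a)
    (hq : IntervalIntegrable L.q volume 0 L.a) :
    ∃ C R : ℝ, 0 < C ∧ 1 ≤ R ∧ ∀ z : ℂ, R ≤ ‖z‖ →
      ‖Δ z - L.charLeading z‖ ≤ C * Real.exp (|z.im| * L.a) := by
  obtain ⟨C, R, hC, hR, h⟩ := hΔ.asymptotics ha hq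
  obtain ⟨C', hC', h'⟩ := norm_charSecond_le ha hq
  refine ⟨C + C', R, by positivity, hR, fun z hz => ?_⟩
  have e : Δ z - L.charLeading z = (Δ z - (L.charLeading z + L.charSecond z)) + L.charSecond z := by
    ring
  rw [e]
  refine (norm_add_le _ _).trans ((add_le_add (h z hz) (h' z)).trans ?_)
  have : C / ‖z‖ ≤ C := div_le_self hC.le (hR.trans hz)
  have := mul_le_mul_of_nonneg_right this (Real.exp_pos (|z.im| * L.a)).le
  linarith

end ReggeProblem

/-! ### Zeros of entire functions: argument principle and Rouché's theorem. -/

theorem exists_finset_zeros {f : ℂ → ℂ} (hf : Differentiable ℂ f) (hne : ∃ w, f w ≠ 0) (c : ℂ)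
    (R : ℝ) : ∃ S : Finset ℂ, ∀ z, z ∈ S ↔ z ∈ Metric.closedBall c R ∧ f z = 0 := by
  have hfin : {z | z ∈ Metric.closedBall c R ∧ f z = 0}.Finite := by
    by_contra hinf
    obtain ⟨x, -, hx⟩ := Set.Infinite.exists_accPt_of_subset_isCompact hinf
      (isCompact_closedBall c R) (fun z hz => hz.1)
    obtain ⟨w, hw⟩ := hne
    have hfr : ∃ᶠ z in nhdsWithin x {x}ᶜ, f z = 0 := by
      rw [accPt_iff_frequently_nhdsNE] at hx
      exact hx.mono fun z hz => hz.2
    have := AnalyticOnNhd.eqOn_zero_of_preconnected_of_frequently_eq_zero (f := f) (U := univ)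
      (fun z _ => hf.analyticAt z) isPreconnected_univ (mem_univ x) hfr
    exact hw (this (mem_univ w))
  exact ⟨hfin.toFinset, fun z => by simp⟩

theorem analyticOrderAt_ne_top_of_entire {f : ℂ → ℂ} (hf : Differentiable ℂ f)
    (hne : ∃ w, f w ≠ 0) (z : ℂ) : analyticOrderAt f z ≠ ⊤ := by
  intro h
  obtain ⟨w, hw⟩ := hne
  rw [analyticOrderAt_eq_top] at h
  have := AnalyticOnNhd.eqOn_zero_of_preconnected_of_eventuallyEq_zero (f := f) (U := univ)
    (fun z _ => hf.analyticAt z) isPreconnected_univ (mem_univ z) h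
  exact hw (this (mem_univ w))

/-- Division of an entire function by the full power of `z - a`. -/
theorem exists_entire_factor {f : ℂ → ℂ} (hf : Differentiable ℂ f) (hne : ∃ w, f w ≠ 0) (a : ℂ) :
    ∃ g : ℂ → ℂ, Differentiable ℂ g ∧ g a ≠ 0 ∧
      ∀ z, f z = (z - a) ^ analyticOrderNatAt f a * g z := by
  set n := analyticOrderNatAt f a with hn
  obtain ⟨g, hg, hga, hfg⟩ := ((hf.analyticAt a).analyticOrderAt_ne_top).1
    (analyticOrderAt_ne_top_of_entire hf hne a)
  rw [← hn] at hfg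
  -- The removable singularity of the quotient is filled with the value of the local factor.
  set G : ℂ → ℂ := Function.update (fun z => f z / (z - a) ^ n) a (g a) with hG
  have hGa : G a = g a := by simp [hG]
  have hGne : ∀ z, z ≠ a → G z = f z / (z - a) ^ n := fun z hz => by simp [hG, hz]
  have hev : G =ᶠ[nhds a] g := by
    filter_upwards [hfg] with z hz
    by_cases h : z = a
    · rw [h, hGa]
    · rw [hGne z h, hz, smul_eq_mul, mul_div_cancel_left₀ _ (pow_ne_zero _ (sub_ne_zero.2 h))]
  refine ⟨G, fun z => ?_, by rwa [hGa], fun z => ?_⟩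
  · by_cases h : z = a
    · rw [h]; exact hg.differentiableAt.congr_of_eventuallyEq hev
    · have h1 : DifferentiableAt ℂ (fun z => f z / (z - a) ^ n) z :=
        (hf z).fun_div (by fun_prop) (pow_ne_zero _ (sub_ne_zero.2 h))
      refine h1.congr_of_eventuallyEq ?_
      filter_upwards [isOpen_ne.mem_nhds h] with w hw
      exact hGne w hw
  · by_cases h : z = a
    · have := hfg.self_of_nhds
      rw [h, this, hGa]; rfl
    · rw [hGne z h, mul_div_cancel₀ _ (pow_ne_zero _ (sub_ne_zero.2 h))]

theorem circleIntegrable_logDeriv {f : ℂ → ℂ} (hf : Differentiable ℂ f) {c : ℂ} {R : ℝ}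
    (hR : 0 ≤ R) (h : ∀ z ∈ Metric.sphere c R, f z ≠ 0) : CircleIntegrable (logDeriv f) c R := by
  refine ContinuousOn.circleIntegrable hR ?_
  have hd : Continuous (deriv f) :=
    (hf.contDiff (n := 1)).continuous_deriv le_rfl
  exact hd.continuousOn.div hf.continuous.continuousOn h

/-- The argument principle for an entire function on a disc. -/
theorem circleIntegral_logDeriv {c : ℂ} {R : ℝ} (hR : 0 < R) (S : Finset ℂ) {f : ℂ → ℂ}
    (hf : Differentiable ℂ f) (hS : ∀ z ∈ Metric.closedBall c R, f z = 0 ↔ z ∈ S)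
    (hSb : ∀ z ∈ S, z ∈ Metric.ball c R) :
    (∮ z in C(c, R), logDeriv f z) =
      2 * Real.pi * Complex.I * (∑ z ∈ S, analyticOrderNatAt f z : ℕ) := by
  induction S using Finset.induction_on generalizing f with
  | empty =>
    have hne : ∀ z ∈ Metric.closedBall c R, f z ≠ 0 := fun z hz h => by
      simpa using (hS z hz).1 h
    have hd : Differentiable ℂ (deriv f) :=
      (hf.contDiff (n := 2)).differentiable_deriv_two
    have := Complex.circleIntegral_eq_zero_of_differentiable_on_off_countable hR.le
      (f := logDeriv f) (c := c) countable_empty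
      (hd.continuous.continuousOn.div hf.continuous.continuousOn hne)
      (fun z hz => (hd z).div (hf z) (hne z (Metric.ball_subset_closedBall hz.1)))
    simpa using this
  | insert a S haS ih =>
    have hab := hSb a (Finset.mem_insert_self _ _)
    have hsph : ∀ z ∈ Metric.sphere c R, f z ≠ 0 := fun z hz h => by
      have h1 := hSb z ((hS z (Metric.sphere_subset_closedBall hz)).1 h)
      exact absurd (Metric.mem_sphere.1 hz) (Metric.mem_ball.1 h1).ne
    have hne : ∃ w, f w ≠ 0 :=
      ⟨c + R, hsph _ (by simp [abs_of_pos hR])⟩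
    -- Splitting off (z - a)^n removes the zero a, adds n/(z - a) to the logarithmic derivative, and
    -- leaves the orders of the other zeros unchanged.
    obtain ⟨g, hg, hga, hfg⟩ := exists_entire_factor hf hne a
    set n := analyticOrderNatAt f a with hn
    have hfz : f a = 0 :=
      (hS a (Metric.ball_subset_closedBall hab)).2 (Finset.mem_insert_self _ _)
    have hgS : ∀ z ∈ Metric.closedBall c R, g z = 0 ↔ z ∈ S := by
      intro z hz
      by_cases h : z = a
      · simp [h, hga, haS]
      · have h1 := hS z hz
        rw [hfg z, mul_eq_zero, Finset.mem_insert] at h1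
        simpa [h, pow_ne_zero _ (sub_ne_zero.2 h)] using h1
    have ih' := ih hg hgS fun z hz => hSb z (Finset.mem_insert_of_mem hz)
    have hord : ∀ z ∈ S, analyticOrderNatAt f z = analyticOrderNatAt g z := by
      intro z hz
      have hza : z ≠ a := fun h => haS (h ▸ hz)
      have e : f = (fun w => (w - a) ^ n) * g := by ext w; exact hfg w
      have hA : AnalyticAt ℂ (fun w : ℂ => (w - a) ^ n) z := by fun_prop
      unfold analyticOrderNatAt
      rw [e, analyticOrderAt_mul hA (hg.analyticAt z),
        hA.analyticOrderAt_eq_zero.2 (pow_ne_zero _ (sub_ne_zero.2 hza)), zero_add]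
    have hgsph : ∀ z ∈ Metric.sphere c R, g z ≠ 0 := fun z hz h => hsph z hz (by
      rw [hfg, h, mul_zero])
    have hza : ∀ z ∈ Metric.sphere c R, z ≠ a := fun z hz h => by
      rw [h] at hz; exact absurd (Metric.mem_sphere.1 hz) (Metric.mem_ball.1 hab).ne
    have hcongr : EqOn (logDeriv f) (fun z => n * (z - a)⁻¹ + logDeriv g z)
        (Metric.sphere c R) := by
      intro z hz
      have hz1 := sub_ne_zero.2 (hza z hz)
      have e : f = fun w => (w - a) ^ n * g w := funext hfg
      have hd : DifferentiableAt ℂ (fun w : ℂ => w - a) z := by fun_prop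
      rw [e, logDeriv_mul (f := fun w => (w - a) ^ n) (g := g) z (pow_ne_zero n hz1) (hgsph z hz)
        (by fun_prop) (hg z), logDeriv_fun_pow hd n]
      simp [logDeriv_apply]
    have hci : CircleIntegrable (fun z => (n : ℂ) * (z - a)⁻¹) c R := by
      have h1 : ContinuousOn (fun z : ℂ => z - a) (Metric.sphere c R) := by fun_prop
      exact ((h1.inv₀ fun z hz => sub_ne_zero.2 (hza z hz)).const_mul (n : ℂ)).circleIntegrable hR.le
    rw [circleIntegral.integral_congr hR.le hcongr, circleIntegral.integral_add hci
      (circleIntegrable_logDeriv hg hR.le hgsph), ih', circleIntegral.integral_const_mul,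
      circleIntegral.integral_sub_inv_of_mem_ball hab, Finset.sum_insert haS,
      Finset.sum_congr rfl hord]
    push_cast
    ring

/-- Rouché's theorem in terms of logarithmic integrals. -/
theorem circleIntegral_logDeriv_congr {f g : ℂ → ℂ} (hf : Differentiable ℂ f)
    (hg : Differentiable ℂ g) {c : ℂ} {R : ℝ} (hR : 0 < R)
    (h : ∀ z ∈ Metric.sphere c R, ‖f z - g z‖ < ‖g z‖) :
    (∮ z in C(c, R), logDeriv f z) = ∮ z in C(c, R), logDeriv g z := by
  have hgne : ∀ z ∈ Metric.sphere c R, g z ≠ 0 := fun z hz h0 => by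
    have := h z hz
    rw [h0, norm_zero] at this
    exact absurd this (norm_nonneg _).not_gt
  have hfne : ∀ z ∈ Metric.sphere c R, f z ≠ 0 := fun z hz h0 => by
    have := h z hz
    simp [h0] at this
  rw [← sub_eq_zero, ← circleIntegral.integral_sub (circleIntegrable_logDeriv hf hR.le hfne)
    (circleIntegrable_logDeriv hg hR.le hgne)]
  -- On the circle |f/g - 1| < 1, so f/g avoids the branch cut and log(f/g) is a primitive of the
  -- difference.
  refine circleIntegral.integral_eq_zero_of_hasDerivWithinAt (f := fun z => Complex.log (f z / g z))
    hR.le fun z hz => HasDerivAt.hasDerivWithinAt ?_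
  have hslit : f z / g z ∈ Complex.slitPlane := by
    have e : f z / g z = 1 + (f z - g z) / g z := by field_simp [hgne z hz]; ring
    rw [e]
    refine Complex.mem_slitPlane_of_norm_lt_one ?_
    rw [norm_div]
    exact (div_lt_one (norm_pos_iff.2 (hgne z hz))).2 (h z hz)
  have h1 := ((hf z).hasDerivAt.fun_div (hg z).hasDerivAt (hgne z hz)).clog hslit
  refine h1.congr_deriv ?_
  have := hgne z hz
  have := hfne z hz
  simp only [logDeriv_apply]
  field_simp

/-! ### Lower bound for the complex sine. -/

theorem Complex.norm_sin_sq (w : ℂ) :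
    ‖Complex.sin w‖ ^ 2 = Real.sin w.re ^ 2 + Real.sinh w.im ^ 2 := by
  rw [Complex.sin_eq, ← Complex.normSq_eq_norm_sq, Complex.normSq_apply,
    ← Complex.ofReal_sin, ← Complex.ofReal_cos, ← Complex.ofReal_sinh, ← Complex.ofReal_cosh,
    ← Complex.ofReal_mul, ← Complex.ofReal_mul]
  simp only [Complex.add_re, Complex.ofReal_re, Complex.mul_re, Complex.I_re, Complex.ofReal_im,
    Complex.I_im, Complex.add_im, Complex.mul_im]
  have h1 := Real.sin_sq_add_cos_sq w.re
  have h2 := Real.cosh_sq w.im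
  linear_combination Real.sin w.re ^ 2 * h2 + Real.sinh w.im ^ 2 * h1

theorem Real.abs_le_abs_sinh (y : ℝ) : |y| ≤ |Real.sinh y| := by
  rw [Real.abs_sinh]
  exact Real.self_le_sinh_iff.2 (abs_nonneg y)

theorem Real.exp_abs_le_abs_sinh {y : ℝ} (hy : 1 ≤ |y|) : Real.exp |y| ≤ 5 * |Real.sinh y| := by
  rw [Real.abs_sinh, Real.sinh_eq]
  have h1 : 2 ≤ Real.exp |y| := by linarith [Real.add_one_le_exp |y|]
  have h2 : Real.exp (-|y|) ≤ 1 := Real.exp_le_one_iff.2 (by linarith)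
  linarith

/-- Lower bound for the sine away from its zeros. -/
theorem Complex.exists_le_norm_sin (w : ℂ) :
    ∃ n : ℤ, min 1 ‖w - n * Real.pi‖ * Real.exp |w.im| ≤ 5 * ‖Complex.sin w‖ := by
  -- nπ is a zero nearest to Re w, so |Re v| ≤ π/2 and Jordan's inequality applies.
  set n := round (w.re / Real.pi) with hn
  refine ⟨n, ?_⟩
  set v := w - n * Real.pi with hv
  have hpi := Real.pi_pos
  have hsin : ‖Complex.sin w‖ = ‖Complex.sin v‖ := by
    rw [hv, Complex.sin_antiperiodic.sub_int_mul_eq n]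
    simp
  have him : v.im = w.im := by simp [hv]
  have hre : |v.re| ≤ Real.pi / 2 := by
    have h1 := abs_sub_round (w.re / Real.pi)
    have h2 : v.re = (w.re / Real.pi - n) * Real.pi := by
      simp [hv]; field_simp
    rw [h2, abs_mul, abs_of_pos hpi]
    nlinarith
  rw [hsin, ← him]
  have hsq := Complex.norm_sin_sq v
  -- Near the real axis the sine controls |v|, by Jordan in Re v and |sinh t| ≥ |t| in Im v. Further
  -- away |sinh| alone exceeds e^{|Im v|}/5.
  rcases le_total |v.im| 1 with h | h
  · have h1 : 2 / Real.pi * ‖v‖ ≤ ‖Complex.sin v‖ := by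
      refine abs_le_of_sq_le_sq' ?_ (norm_nonneg _) |>.2
      have a1 := Real.mul_abs_le_abs_sin hre
      have a2 := Real.abs_le_abs_sinh v.im
      have a3 : 2 / Real.pi ≤ 1 := by rw [div_le_one hpi]; linarith [Real.pi_gt_three]
      have b1 := pow_le_pow_left₀ (by positivity) a1 2
      have b2 := pow_le_pow_left₀ (by positivity) a2 2
      rw [sq_abs] at b1 b2
      rw [sq_abs] at b2
      have b3 : (2 / Real.pi) ^ 2 ≤ 1 := pow_le_one₀ (by positivity) a3
      have b4 : ‖v‖ ^ 2 = v.re ^ 2 + v.im ^ 2 := by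
        rw [← Complex.normSq_eq_norm_sq, Complex.normSq_apply]; ring
      rw [hsq, mul_pow, b4]
      rw [mul_pow, sq_abs] at b1
      nlinarith [sq_nonneg v.im]
    have h2 : Real.exp |v.im| ≤ 3 :=
      (Real.exp_le_exp.2 h).trans (by linarith [Real.exp_one_lt_d9])
    have h3 : 3 / 5 ≤ 2 / Real.pi := by
      rw [div_le_div_iff₀ (by norm_num) hpi]; linarith [Real.pi_lt_d2]
    calc _ ≤ ‖v‖ * 3 := mul_le_mul (min_le_right _ _) h2 (Real.exp_pos _).le (norm_nonneg _)
      _ = 5 * (3 / 5 * ‖v‖) := by ring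
      _ ≤ 5 * (2 / Real.pi * ‖v‖) := by gcongr
      _ ≤ _ := by gcongr
  · have h1 : |Real.sinh v.im| ≤ ‖Complex.sin v‖ := by
      refine abs_le_of_sq_le_sq' ?_ (norm_nonneg _) |>.2
      rw [sq_abs, hsq]
      linarith [sq_nonneg (Real.sin v.re)]
    have h2 := Real.exp_abs_le_abs_sinh h
    calc _ ≤ 1 * Real.exp |v.im| := by
          gcongr; exact min_le_left _ _
      _ ≤ _ := by linarith

/-! ### Perturbations of the sine model. -/

/-- The model function with zeros at `0` and at the points `n π + e π / 2`. -/
noncomputable def sineModel (e : ℕ) (w : ℂ) : ℂ := w * Complex.sin (w - (e * Real.pi / 2 : ℝ))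

/-- The zeros of `sin (w - e π / 2)`. -/
noncomputable def sineNode (e : ℕ) (n : ℤ) : ℝ := n * Real.pi + e * Real.pi / 2

/-- `F` is an `O(exp |Im w|)` perturbation of the sine model. -/
def IsSinePerturbation (F : ℂ → ℂ) (e : ℕ) (C R : ℝ) : Prop :=
  0 < C ∧ ∀ w : ℂ, R ≤ ‖w‖ → ‖F w - sineModel e w‖ ≤ C * Real.exp |w.im|

theorem exists_le_norm_sineModel (e : ℕ) (w : ℂ) : ∃ n : ℤ,
    ‖w‖ * (min 1 ‖w - sineNode e n‖ * Real.exp |w.im|) ≤ 5 * ‖sineModel e w‖ := by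
  obtain ⟨n, hn⟩ := Complex.exists_le_norm_sin (w - (e * Real.pi / 2 : ℝ))
  refine ⟨n, ?_⟩
  have e1 : w - (e * Real.pi / 2 : ℝ) - n * Real.pi = w - sineNode e n := by
    unfold sineNode; push_cast; ring
  have e2 : (w - ((e * Real.pi / 2 : ℝ) : ℂ)).im = w.im := by
    rw [Complex.sub_im, Complex.ofReal_im, sub_zero]
  rw [e1, e2] at hn
  unfold sineModel
  rw [norm_mul]
  calc _ ≤ ‖w‖ * (5 * ‖Complex.sin (w - (e * Real.pi / 2 : ℝ))‖) := by gcongr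
    _ = _ := by ring

/-- At a zero of F the model is at most C e^{|Im w|}, and the lower bound for the sine cancels the
exponential. As 5C/|w| < 1, the minimum in that bound cannot be 1. -/
theorem IsSinePerturbation.exists_node {F : ℂ → ℂ} {e : ℕ} {C R : ℝ}
    (hF : IsSinePerturbation F e C R) {w : ℂ} (hw : R ≤ ‖w‖) (hw' : 5 * C < ‖w‖) (h0 : F w = 0) :
    ∃ n : ℤ, ‖w - sineNode e n‖ ≤ 5 * C / ‖w‖ := by
  obtain ⟨n, hn⟩ := exists_le_norm_sineModel e w
  have h1 := hF.2 w hw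
  rw [h0, zero_sub, norm_neg] at h1
  have hwpos : 0 < ‖w‖ := by linarith [hF.1]
  have h2 : ‖w‖ * min 1 ‖w - sineNode e n‖ ≤ 5 * C := by
    refine le_of_mul_le_mul_right ?_ (Real.exp_pos |w.im|)
    linarith
  refine ⟨n, ?_⟩
  rw [mul_comm, ← le_div_iff₀ hwpos] at h2
  have h3 : 5 * C / ‖w‖ < 1 := (div_lt_one hwpos).2 hw'
  rcases min_le_iff.1 h2 with h | h
  · linarith
  · exact h

/-- The Rouché condition for circles that stay at distance at least 1 from the nodes. -/
theorem IsSinePerturbation.norm_sub_lt {F : ℂ → ℂ} {e : ℕ} {C R : ℝ}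
    (hF : IsSinePerturbation F e C R) {w : ℂ} (hw : R ≤ ‖w‖) (hw' : 5 * C < ‖w‖)
    (hd : ∀ n : ℤ, 1 ≤ ‖w - sineNode e n‖) : ‖F w - sineModel e w‖ < ‖sineModel e w‖ := by
  obtain ⟨n, hn⟩ := exists_le_norm_sineModel e w
  rw [min_eq_left (hd n), one_mul] at hn
  have h1 := hF.2 w hw
  have := mul_lt_mul_of_pos_right hw' (Real.exp_pos |w.im|)
  linarith

theorem differentiable_sineModel (e : ℕ) : Differentiable ℂ (sineModel e) := by
  unfold sineModel; fun_prop

theorem sin_sub_eq_zero_iff (e : ℕ) (w : ℂ) :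
    Complex.sin (w - (e * Real.pi / 2 : ℝ)) = 0 ↔ ∃ n : ℤ, w = sineNode e n := by
  rw [Complex.sin_eq_zero_iff]
  refine exists_congr fun n => ?_
  unfold sineNode
  push_cast
  rw [sub_eq_iff_eq_add]

theorem sineNode_injective (e : ℕ) : Function.Injective (sineNode e) := by
  intro m n h
  unfold sineNode at h
  have := Real.pi_pos
  have h2 : (m : ℝ) * Real.pi = n * Real.pi := by linarith
  exact_mod_cast mul_right_cancel₀ this.ne' h2

theorem analyticOrderNatAt_eq_one {f : ℂ → ℂ} {z : ℂ} (hf : AnalyticAt ℂ f z) (h0 : f z = 0)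
    (h1 : deriv f z ≠ 0) : analyticOrderNatAt f z = 1 := by
  simp [analyticOrderNatAt, hf.analyticOrderAt_eq_one_of_zero_deriv_ne_zero h0 h1]

theorem analyticOrderNatAt_sin_sub (e : ℕ) (n : ℤ) :
    analyticOrderNatAt (fun w : ℂ => Complex.sin (w - (e * Real.pi / 2 : ℝ))) (sineNode e n) = 1 := by
  have h0 := (sin_sub_eq_zero_iff e (sineNode e n)).2 ⟨n, rfl⟩
  refine analyticOrderNatAt_eq_one ?_ h0 ?_
  · exact Differentiable.analyticAt (by fun_prop) _
  · have hd : HasDerivAt (fun w : ℂ => Complex.sin (w - (e * Real.pi / 2 : ℝ)))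
        (Complex.cos (sineNode e n - (e * Real.pi / 2 : ℝ)) * 1) (sineNode e n) :=
      ((hasDerivAt_id _).sub_const _).csin
    rw [hd.deriv, mul_one]
    intro hc
    have := Complex.sin_sq_add_cos_sq (sineNode e n - (e * Real.pi / 2 : ℝ))
    rw [h0, hc] at this
    simp at this

/-- Zero count of the sine model in a disc. -/
theorem circleIntegral_logDeriv_sineModel (e : ℕ) {c : ℂ} {R : ℝ} (hR : 0 < R) (T : Finset ℤ)
    (hT : ∀ n, n ∈ T ↔ (sineNode e n : ℂ) ∈ Metric.closedBall c R)
    (hT' : ∀ n ∈ T, (sineNode e n : ℂ) ∈ Metric.ball c R) (k : ℕ)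
    (hk : (k = 0 ∧ (0 : ℂ) ∉ Metric.closedBall c R) ∨ (k = 1 ∧ (0 : ℂ) ∈ Metric.ball c R)) :
    (∮ z in C(c, R), logDeriv (sineModel e) z) = 2 * Real.pi * Complex.I * (k + T.card : ℕ) := by
  set s : ℂ → ℂ := fun w => Complex.sin (w - (e * Real.pi / 2 : ℝ)) with hs
  have hsd : Differentiable ℂ s := by rw [hs]; fun_prop
  have hsne : ∀ z ∈ Metric.sphere c R, s z ≠ 0 := fun z hz h => by
    obtain ⟨n, rfl⟩ := (sin_sub_eq_zero_iff e z).1 h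
    have := hT' n ((hT n).2 (Metric.sphere_subset_closedBall hz))
    exact absurd (Metric.mem_sphere.1 hz) (Metric.mem_ball.1 this).ne
  have hidne : ∀ z ∈ Metric.sphere c R, z ≠ 0 := by
    rintro z hz rfl
    rcases hk with ⟨-, h⟩ | ⟨-, h⟩
    · exact h (Metric.sphere_subset_closedBall hz)
    · exact absurd (Metric.mem_sphere.1 hz) (Metric.mem_ball.1 h).ne
  have hprod : EqOn (logDeriv (sineModel e)) (fun z => logDeriv id z + logDeriv s z)
      (Metric.sphere c R) := fun z hz =>
    logDeriv_mul (f := id) (g := s) z (hidne z hz) (hsne z hz) differentiableAt_id (hsd z)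
  rw [circleIntegral.integral_congr hR.le hprod, circleIntegral.integral_add
    (circleIntegrable_logDeriv differentiable_id hR.le hidne)
    (circleIntegrable_logDeriv hsd hR.le hsne)]
  -- k is the contribution of the factor w. For e = 0 the origin is also a node and becomes a double
  -- zero.
  have h1 : (∮ z in C(c, R), logDeriv id z) = 2 * Real.pi * Complex.I * (k : ℕ) := by
    rcases hk with ⟨rfl, h⟩ | ⟨rfl, h⟩
    · rw [circleIntegral_logDeriv hR ∅ differentiable_id (fun z hz => ?_) (by simp)]
      · simp
      · simp only [id, Finset.notMem_empty, iff_false]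
        rintro rfl; exact h hz
    · rw [circleIntegral_logDeriv hR {0} differentiable_id (by simp) (by simpa using h)]
      have : analyticOrderNatAt (id : ℂ → ℂ) 0 = 1 :=
        analyticOrderNatAt_eq_one analyticAt_id rfl (by simp)
      simp [this]
  have hinj : Function.Injective fun n => (sineNode e n : ℂ) :=
    Complex.ofReal_injective.comp (sineNode_injective e)
  have h2 := circleIntegral_logDeriv hR (T.map ⟨_, hinj⟩) hsd (c := c) (fun z hz => by
      rw [sin_sub_eq_zero_iff, Finset.mem_map]
      constructor
      · rintro ⟨n, rfl⟩; exact ⟨n, (hT n).2 hz, rfl⟩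
      · rintro ⟨n, -, rfl⟩; exact ⟨n, rfl⟩)
    (fun z hz => by
      obtain ⟨n, hn, rfl⟩ := Finset.mem_map.1 hz
      exact hT' n hn)
  have h3 : ∑ n ∈ T, analyticOrderNatAt s (sineNode e n) = T.card := by
    rw [Finset.sum_congr rfl fun n _ => analyticOrderNatAt_sin_sub e n]
    simp
  rw [h1, h2, Finset.sum_map]
  simp only [Function.Embedding.coeFn_mk]
  rw [h3]
  push_cast
  ring

/-- Zero count of a perturbation of the sine model. -/
theorem sum_analyticOrderNatAt_eq {F : ℂ → ℂ} (hF : Differentiable ℂ F) (e : ℕ) {c : ℂ} {R : ℝ}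
    (hR : 0 < R) (h : ∀ z ∈ Metric.sphere c R, ‖F z - sineModel e z‖ < ‖sineModel e z‖)
    (T : Finset ℤ) (hT : ∀ n, n ∈ T ↔ (sineNode e n : ℂ) ∈ Metric.closedBall c R)
    (hT' : ∀ n ∈ T, (sineNode e n : ℂ) ∈ Metric.ball c R) (k : ℕ)
    (hk : (k = 0 ∧ (0 : ℂ) ∉ Metric.closedBall c R) ∨ (k = 1 ∧ (0 : ℂ) ∈ Metric.ball c R)) :
    ∃ S : Finset ℂ, (∀ z, z ∈ S ↔ z ∈ Metric.closedBall c R ∧ F z = 0) ∧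
      (∀ z ∈ S, z ∈ Metric.ball c R) ∧ ∑ z ∈ S, analyticOrderNatAt F z = k + T.card := by
  have hne : ∀ z ∈ Metric.sphere c R, F z ≠ 0 := fun z hz h0 => by
    have := h z hz
    simp [h0] at this
  obtain ⟨S, hS⟩ := exists_finset_zeros hF ⟨c + R, hne _ (by simp [abs_of_pos hR])⟩ c R
  have hSb : ∀ z ∈ S, z ∈ Metric.ball c R := fun z hz => by
    obtain ⟨h1, h2⟩ := (hS z).1 hz
    rcases (Metric.mem_closedBall.1 h1).lt_or_eq with h3 | h3
    · exact h3
    · exact absurd h2 (hne z h3)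
  refine ⟨S, hS, hSb, ?_⟩
  have h1 := circleIntegral_logDeriv hR S hF (c := c)
    (fun z hz => by rw [hS]; exact ⟨fun h => ⟨hz, h⟩, fun h => h.2⟩) hSb
  rw [circleIntegral_logDeriv_congr hF (differentiable_sineModel e) hR h,
    circleIntegral_logDeriv_sineModel e hR T hT hT' k hk] at h1
  have h2 : (2 * Real.pi * Complex.I : ℂ) ≠ 0 := Complex.two_pi_I_ne_zero
  exact_mod_cast (mul_left_cancel₀ h2 h1).symm

/-! ### Numbering the zeros of a perturbed sine model. -/

/-- A finite set can be distributed over finitely many points with prescribed multiplicities. -/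
theorem exists_fun_encard_fiber {ι α : Type*} [Inhabited α] (K : Finset ι) (Z : Finset α)
    (m : α → ℕ) (h : ∑ z ∈ Z, m z = K.card) :
    ∃ f : ι → α, (∀ k ∈ K, f k ∈ Z) ∧ ∀ z ∈ Z, {k | k ∈ K ∧ f k = z}.encard = m z := by
  classical
  have hcard : K.card = (Z.sigma fun z => Finset.range (m z)).card := by
    rw [Finset.card_sigma, ← h]; simp
  -- Any bijection onto the disjoint union of blocks of size `m z`, followed by projection to z, has
  -- the required fibres.
  set E := Finset.equivOfCardEq hcard
  refine ⟨fun k => if hk : k ∈ K then (E ⟨k, hk⟩).1.1 else default, fun k hk => ?_, fun z hz => ?_⟩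
  · simp only [hk, dif_pos]
    exact (Finset.mem_sigma.1 (E ⟨k, hk⟩).2).1
  · have hmem : ∀ j : Fin (m z), (⟨z, j⟩ : (_ : α) × ℕ) ∈ Z.sigma fun z => Finset.range (m z) :=
      fun j => Finset.mem_sigma.2 ⟨hz, Finset.mem_range.2 j.2⟩
    set φ : Fin (m z) → ι := fun j => (E.symm ⟨⟨z, j⟩, hmem j⟩ : ι) with hφ
    have hinj : Function.Injective φ := by
      intro i j hij
      have := E.symm.injective (Subtype.ext hij)
      simpa [Fin.ext_iff] using this
    have hset : {k | k ∈ K ∧ (if hk : k ∈ K then (E ⟨k, hk⟩).1.1 else default) = z} = range φ := by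
      ext k
      constructor
      · rintro ⟨hk, hkz⟩
        rw [dif_pos hk] at hkz
        have h2 := Finset.mem_sigma.1 (E ⟨k, hk⟩).2
        rw [hkz, Finset.mem_range] at h2
        refine ⟨⟨_, h2.2⟩, ?_⟩
        have : (⟨⟨z, (E ⟨k, hk⟩).1.2⟩, hmem ⟨_, h2.2⟩⟩ :
            {x // x ∈ Z.sigma fun z => Finset.range (m z)}) = E ⟨k, hk⟩ := by
          ext
          · exact hkz.symm
          · rfl
        simp only [hφ, this, Equiv.symm_apply_apply]
      · rintro ⟨j, rfl⟩
        have hk : φ j ∈ K := (E.symm ⟨⟨z, j⟩, hmem j⟩).2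
        refine ⟨hk, ?_⟩
        rw [dif_pos hk]
        have : (⟨φ j, hk⟩ : {x // x ∈ K}) = E.symm ⟨⟨z, j⟩, hmem j⟩ := rfl
        rw [this, Equiv.apply_symm_apply]
    rw [hset, ← image_univ, hinj.injOn.encard_image, encard_univ]
    simp

/-- The node that belongs to the index `k` in the numbering by nonzero integers. -/
def nodeIndex (e : ℕ) (k : ℤ) : ℤ := if 0 < k then k - 1 else k + 1 - e

theorem sineNode_eq (e : ℕ) (n : ℤ) : sineNode e n = ((2 * n + e : ℤ) : ℝ) * (Real.pi / 2) := by
  unfold sineNode; push_cast; ring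

theorem abs_sineNode (e : ℕ) (n : ℤ) :
    |sineNode e n| = ((|2 * n + e| : ℤ) : ℝ) * (Real.pi / 2) := by
  rw [sineNode_eq, abs_mul, abs_of_pos (by positivity : 0 < Real.pi / 2), Int.cast_abs]

theorem pi_le_norm_sineNode_sub {e : ℕ} {m n : ℤ} (h : m ≠ n) :
    Real.pi ≤ ‖(sineNode e m : ℂ) - sineNode e n‖ := by
  rw [← Complex.ofReal_sub, Complex.norm_real, Real.norm_eq_abs]
  have e1 : sineNode e m - sineNode e n = ((m - n : ℤ) : ℝ) * Real.pi := by
    unfold sineNode; push_cast; ring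
  rw [e1, abs_mul, abs_of_pos Real.pi_pos, ← Int.cast_abs]
  have : (1 : ℤ) ≤ |m - n| := Int.one_le_abs (sub_ne_zero.2 h)
  have h2 : (1 : ℝ) ≤ ((|m - n| : ℤ) : ℝ) := by exact_mod_cast this
  exact le_mul_of_one_le_left Real.pi_pos.le h2

/-- The zero near a node of large modulus is unique and simple. -/
theorem IsSinePerturbation.exists_zero_near_node {F : ℂ → ℂ} (hFd : Differentiable ℂ F) {e : ℕ}
    {C R : ℝ} (hF : IsSinePerturbation F e C R) {n : ℤ} (hR : R ≤ |sineNode e n| - 1)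
    (hC : 5 * C < |sineNode e n| - 1) :
    ∃ w ∈ Metric.ball (sineNode e n : ℂ) 1, F w = 0 ∧ analyticOrderNatAt F w = 1 ∧
      ∀ z ∈ Metric.closedBall (sineNode e n : ℂ) 1, F z = 0 → z = w := by
  have hpi := Real.pi_gt_three
  have hnorm : ‖(sineNode e n : ℂ)‖ = |sineNode e n| := by
    rw [Complex.norm_real, Real.norm_eq_abs]
  have hCpos := hF.1
  obtain ⟨S, hS, hSb, hsum⟩ := sum_analyticOrderNatAt_eq hFd e one_pos (c := (sineNode e n : ℂ))
    (fun z hz => by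
      have hz1 : ‖z - sineNode e n‖ = 1 := mem_sphere_iff_norm.1 hz
      have h2 : |sineNode e n| - 1 ≤ ‖z‖ := by
        have := norm_sub_norm_le (sineNode e n : ℂ) z
        rw [norm_sub_rev, hz1, hnorm] at this
        linarith
      refine hF.norm_sub_lt (hR.trans h2) (hC.trans_le h2) fun m => ?_
      by_cases h : m = n
      · rw [h, hz1]
      · have h3 := pi_le_norm_sineNode_sub (e := e) h
        have h4 := norm_sub_le_norm_sub_add_norm_sub (sineNode e m : ℂ) z (sineNode e n)
        rw [hz1, norm_sub_rev _ z] at h4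
        linarith)
    {n} (fun m => by
      rw [Finset.mem_singleton, mem_closedBall_iff_norm]
      constructor
      · rintro rfl; simp
      · intro h
        by_contra hmn
        have := pi_le_norm_sineNode_sub (e := e) hmn
        linarith)
    (fun m hm => by rw [Finset.mem_singleton.1 hm]; exact Metric.mem_ball_self one_pos) 0
    (Or.inl ⟨rfl, by
      rw [mem_closedBall_iff_norm, zero_sub, norm_neg, hnorm]; linarith⟩)
  rw [zero_add, Finset.card_singleton] at hsum
  have hne : ∃ w, F w ≠ 0 := by
    by_contra! hall
    have hinf : (Metric.closedBall (sineNode e n : ℂ) 1).Infinite :=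
      infinite_of_mem_nhds _ (Metric.closedBall_mem_nhds _ one_pos)
    exact hinf (S.finite_toSet.subset fun z hz => (hS z).2 ⟨hz, hall z⟩)
  have hpos : ∀ z ∈ S, 1 ≤ analyticOrderNatAt F z := by
    intro z hz
    rw [Nat.one_le_iff_ne_zero]
    intro h0
    have h1 : analyticOrderAt F z = 0 := by
      rw [← Nat.cast_analyticOrderNatAt (analyticOrderAt_ne_top_of_entire hFd hne z), h0]; rfl
    exact (hFd.analyticAt z).analyticOrderAt_eq_zero.1 h1 ((hS z).1 hz).2
  have hcard : S.card = 1 := by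
    have h1 : S.card ≤ 1 := by
      have := Finset.sum_le_sum hpos
      rw [hsum] at this
      simpa using this
    have h2 : S.card ≠ 0 := by
      intro h
      rw [Finset.card_eq_zero.1 h] at hsum
      simp at hsum
    omega
  obtain ⟨w, rfl⟩ := Finset.card_eq_one.1 hcard
  have hw := Finset.mem_singleton_self w
  refine ⟨w, hSb w hw, ((hS w).1 hw).2, by simpa using hsum, fun z hz h0 => ?_⟩
  exact Finset.mem_singleton.1 ((hS z).2 ⟨hz, h0⟩)

/-- This count of indices must equal the number of model zeros in the large disc: 2N - 1 + e nodes
and one more zero at the origin. -/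
theorem card_subtype_Icc (e : ℕ) (he : e ≤ 1) (N : ℕ) :
    ((Finset.Icc (-(N : ℤ)) N).subtype fun k => e = 1 ∨ k ≠ 0).card = 2 * N + e := by
  rw [Finset.card_subtype]
  interval_cases e
  · have : (Finset.Icc (-(N : ℤ)) N).filter (fun k => 0 = 1 ∨ k ≠ 0) =
        (Finset.Icc (-(N : ℤ)) N).erase 0 := by
      ext k; simp; tauto
    rw [this, Finset.card_erase_of_mem (by simp), Int.card_Icc]
    omega
  · simp only [true_or, Finset.filter_true, Int.card_Icc]
    omega

/-- Numbering of the zeros of a perturbation of the sine model, with asymptotics. -/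
theorem IsSinePerturbation.exists_enumeration {F : ℂ → ℂ} (hFd : Differentiable ℂ F) {e : ℕ}
    (he : e ≤ 1) {C R : ℝ} (hF : IsSinePerturbation F e C R) :
    ∃ ev : {k : ℤ // e = 1 ∨ k ≠ 0} → ℂ,
      (∀ z, {k | ev k = z}.encard = analyticOrderAt F z) ∧
      ∃ (D : ℝ) (N : ℕ), ∀ k : {k : ℤ // e = 1 ∨ k ≠ 0}, (N : ℤ) < |(k : ℤ)| →
        ‖ev k - sineNode e (nodeIndex e k)‖ ≤ D / |((k : ℤ) : ℝ)| := by
  have hpi := Real.pi_gt_three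
  have hCpos := hF.1
  obtain ⟨N, hN⟩ := exists_nat_ge (max R (5 * C) + 2)
  have hNR : R + 2 ≤ N := (by linarith [le_max_left R (5 * C)])
  have hNC : 5 * C + 2 ≤ N := (by linarith [le_max_right R (5 * C)])
  have hN2 : (2 : ℝ) ≤ N := by linarith
  have hN2' : 2 ≤ N := by exact_mod_cast hN2
  have he' : (e : ℝ) ≤ 1 := by exact_mod_cast he
  -- The node moduli are |2n + e| π/2, where 2n + e has the parity of e. So r lies midway between
  -- consecutive moduli, at distance at least π/2 from each.
  set r : ℝ := ((2 * N - 1 + e : ℤ) : ℝ) * (Real.pi / 2) with hr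
  have hrN : (N : ℝ) ≤ r := by
    rw [hr]; push_cast
    have : (0 : ℝ) ≤ e := Nat.cast_nonneg e
    nlinarith
  have hrpos : 0 < r := by linarith
  set I : Finset ℤ := Finset.Ico (-N + 1 - e) N with hI
  have hin : ∀ n ∈ I, |sineNode e n| ≤ r - Real.pi / 2 := by
    intro n hn
    rw [hI, Finset.mem_Ico] at hn
    have : |2 * n + (e : ℤ)| ≤ 2 * N - 2 + e := by rw [abs_le]; omega
    have h2 : ((|2 * n + (e : ℤ)| : ℤ) : ℝ) ≤ ((2 * N - 2 + e : ℤ) : ℝ) := by exact_mod_cast this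
    rw [abs_sineNode, hr]
    refine (mul_le_mul_of_nonneg_right h2 (by positivity)).trans (le_of_eq ?_)
    push_cast; ring
  have hout : ∀ n ∉ I, r + Real.pi / 2 ≤ |sineNode e n| := by
    intro n hn
    rw [hI, Finset.mem_Ico] at hn
    have : 2 * N + e ≤ |2 * n + (e : ℤ)| := by rw [le_abs]; omega
    have h2 : ((2 * N + e : ℤ) : ℝ) ≤ ((|2 * n + (e : ℤ)| : ℤ) : ℝ) := by exact_mod_cast this
    rw [abs_sineNode, hr]
    refine (le_of_eq ?_).trans (mul_le_mul_of_nonneg_right h2 (by positivity))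
    push_cast; ring
  have hnorm : ∀ n, ‖(sineNode e n : ℂ)‖ = |sineNode e n| := fun n => by
    rw [Complex.norm_real, Real.norm_eq_abs]
  obtain ⟨S, hS, hSb, hsum⟩ := sum_analyticOrderNatAt_eq hFd e hrpos (c := 0)
    (fun z hz => by
      have hz1 : ‖z‖ = r := by simpa using hz
      refine hF.norm_sub_lt (by linarith) (by linarith) fun n => ?_
      by_cases hn : n ∈ I
      · have h1 := hin n hn
        have h2 := norm_sub_norm_le z (sineNode e n)
        rw [hz1, hnorm] at h2
        linarith
      · have h1 := hout n hn
        have h2 := norm_sub_norm_le (sineNode e n : ℂ) z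
        rw [hz1, hnorm, norm_sub_rev] at h2
        linarith)
    I (fun n => by
      rw [mem_closedBall_zero_iff, hnorm]
      constructor
      · intro h; linarith [hin n h]
      · intro h; by_contra hn; linarith [hout n hn])
    (fun n hn => by rw [mem_ball_zero_iff, hnorm]; linarith [hin n hn]) 1
    (Or.inr ⟨rfl, Metric.mem_ball_self hrpos⟩)
  have hlarge : ∀ n, n ∉ I → ∃ w ∈ Metric.ball (sineNode e n : ℂ) 1, F w = 0 ∧
      analyticOrderNatAt F w = 1 ∧
      ∀ z ∈ Metric.closedBall (sineNode e n : ℂ) 1, F z = 0 → z = w := fun n hn =>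
    hF.exists_zero_near_node hFd (by linarith [hout n hn]) (by linarith [hout n hn])
  choose! w hwb hw0 hword hwu using hlarge
  have hwbn : ∀ n ∉ I, ‖w n - sineNode e n‖ < 1 := fun n hn => mem_ball_iff_norm.1 (hwb n hn)
  have hwnorm : ∀ n ∉ I, |sineNode e n| - 1 < ‖w n‖ := by
    intro n hn
    have h1 := norm_sub_norm_le (sineNode e n : ℂ) (w n)
    rw [hnorm, norm_sub_rev] at h1
    linarith [hwbn n hn]
  have hne : ∃ w, F w ≠ 0 := by
    by_contra! hall
    exact (infinite_of_mem_nhds (0 : ℂ) (Metric.closedBall_mem_nhds _ hrpos))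
      (S.finite_toSet.subset fun z hz => (hS z).2 ⟨hz, hall z⟩)
  set K := (Finset.Icc (-(N : ℤ)) N).subtype fun k => e = 1 ∨ k ≠ 0 with hK
  have hKmem : ∀ k, k ∈ K ↔ |(k : ℤ)| ≤ N := fun k => by
    rw [hK, Finset.mem_subtype, Finset.mem_Icc, abs_le]
  obtain ⟨f, hfS, hfib⟩ := exists_fun_encard_fiber K S (analyticOrderNatAt F) (by
    rw [hsum, hK, card_subtype_Icc e he, hI, Int.card_Ico]; omega)
  have hidx : ∀ k : {k : ℤ // e = 1 ∨ k ≠ 0}, k ∉ K → nodeIndex e k ∉ I := by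
    intro k hk
    rw [hKmem, not_le, lt_abs] at hk
    rw [hI, Finset.mem_Ico, nodeIndex]
    split_ifs <;> omega
  classical
  -- Indices in K are spread over the zeros in the disc in any way that respects multiplicity; every
  -- other index takes the simple zero at its node.
  refine ⟨fun k => if k ∈ K then f k else w (nodeIndex e k), fun z => ?_, 5 * C, N,
    fun k hk => ?_⟩
  · by_cases hz : F z = 0
    · by_cases hzr : ‖z‖ ≤ r
      · have hzS : z ∈ S := (hS z).2 ⟨by simpa using hzr, hz⟩
        rw [← Nat.cast_analyticOrderNatAt (analyticOrderAt_ne_top_of_entire hFd hne z),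
          ← hfib z hzS]
        congr 1
        ext k
        simp only [mem_ofPred_eq]
        by_cases hk : k ∈ K
        · simp [hk]
        · simp only [hk, if_false, false_and, iff_false]
          intro h
          have := hwnorm _ (hidx k hk)
          rw [h] at this
          linarith [hout _ (hidx k hk)]
      · rw [not_le] at hzr
        obtain ⟨n, hn⟩ := hF.exists_node (by linarith) (by linarith) hz
        have hn1 : ‖z - sineNode e n‖ < 1 :=
          hn.trans_lt ((div_lt_one (by linarith)).2 (by linarith))
        have hnI : n ∉ I := by
          intro hnI
          have h1 := norm_sub_norm_le z (sineNode e n)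
          rw [hnorm] at h1
          linarith [hin n hnI]
        have hzw : z = w n := hwu n hnI z (mem_closedBall_iff_norm.2 hn1.le) hz
        have hnI' := hnI
        rw [hI, Finset.mem_Ico] at hnI'
        -- The inverse of `nodeIndex` on outer nodes, which satisfy n ≥ N or n ≤ -N - e.
        set k₀ : ℤ := if (N : ℤ) ≤ n then n + 1 else n - 1 + e with hk₀
        have hk₀N : (N : ℤ) < |k₀| := by
          rw [hk₀, lt_abs]; split_ifs <;> omega
        have hk₀n : nodeIndex e k₀ = n := by
          rw [hk₀, nodeIndex]; split_ifs <;> omega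
        have hk₀0 : k₀ ≠ 0 := by
          intro h; rw [h, abs_zero] at hk₀N; omega
        have hset : {k | (if k ∈ K then f k else w (nodeIndex e k)) = z} = {⟨k₀, Or.inr hk₀0⟩} := by
          ext k
          simp only [mem_ofPred_eq, mem_singleton_iff]
          constructor
          · intro h
            by_cases hk : k ∈ K
            · rw [if_pos hk] at h
              have := ((hS _).1 (hfS k hk)).1
              rw [h, mem_closedBall_zero_iff] at this
              linarith
            · rw [if_neg hk] at h
              have hb := hwbn _ (hidx k hk)
              rw [h] at hb
              have hnn : nodeIndex e k = n := by
                by_contra hne'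
                have h3 := pi_le_norm_sineNode_sub (e := e) hne'
                have h4 := norm_sub_le_norm_sub_add_norm_sub (sineNode e (nodeIndex e k) : ℂ) z
                  (sineNode e n)
                rw [norm_sub_rev _ z] at h4
                linarith
              rw [hKmem, not_le, lt_abs] at hk
              rw [lt_abs] at hk₀N
              ext
              simp only
              unfold nodeIndex at hnn
              rw [hk₀]
              split_ifs at hnn ⊢ <;> omega
          · rintro rfl
            rw [if_neg (by rw [hKmem]; exact not_le.2 hk₀N)]
            simp only
            rw [hk₀n, hzw]
        rw [hset, encard_singleton, ← Nat.cast_analyticOrderNatAt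
          (analyticOrderAt_ne_top_of_entire hFd hne z), hzw, hword n hnI]
        rfl
    · rw [(hFd.analyticAt z).analyticOrderAt_eq_zero.2 hz, encard_eq_zero]
      ext k
      simp only [mem_ofPred_eq, mem_empty_iff_false, iff_false]
      rintro rfl
      refine hz ?_
      split_ifs with hk
      · exact ((hS _).1 (hfS k hk)).2
      · exact hw0 _ (hidx k hk)
  · have hkK : k ∉ K := by rw [hKmem]; exact not_le.2 hk
    have hnI := hidx k hkK
    simp only [hkK, if_false]
    set n := nodeIndex e k with hn
    have hwn := hwnorm n hnI
    have hon := hout n hnI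
    -- Distance below 1 only identifies the node; a second use of `exists_node` sharpens it to 5C/|w
    -- n|.
    obtain ⟨m, hm⟩ := hF.exists_node (w := w n) (by linarith) (by linarith) (hw0 n hnI)
    have hm1 : ‖w n - sineNode e m‖ < 1 :=
      hm.trans_lt ((div_lt_one (by linarith)).2 (by linarith))
    have hmn : m = n := by
      by_contra hne'
      have h3 := pi_le_norm_sineNode_sub (e := e) hne'
      have h4 := norm_sub_le_norm_sub_add_norm_sub (sineNode e m : ℂ) (w n) (sineNode e n)
      rw [norm_sub_rev _ (w n)] at h4
      linarith [hwbn n hnI]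
    rw [hmn] at hm
    refine hm.trans ?_
    have hkpos : (2 : ℝ) < |((k : ℤ) : ℝ)| := by
      have : (2 : ℤ) < |(k : ℤ)| := by omega
      rw [← Int.cast_abs]; exact_mod_cast this
    -- |w n| ≥ (|k| - 1)π - 1 ≥ |k|, because |k| > 2.
    refine div_le_div_of_nonneg_left (by positivity) (by linarith) (le_trans ?_ hwn.le)
    rw [abs_sineNode]
    have h5 : 2 * |(k : ℤ)| - 2 ≤ |2 * n + (e : ℤ)| := by
      rw [hn, nodeIndex]
      split_ifs <;> (rw [le_abs]; rcases abs_cases (k : ℤ) with h | h <;> omega)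
    have h6 : 2 * |((k : ℤ) : ℝ)| - 2 ≤ ((|2 * n + (e : ℤ)| : ℤ) : ℝ) := by
      rw [← Int.cast_abs]; exact_mod_cast h5
    nlinarith

/-! ### Numbering with multiplicity, and the case of a vanishing amplitude. -/

theorem intervalIntegrable_of_memLp {a : ℝ} (ha : 0 < a) {q : ℝ → ℂ}
    (hq : MemLp q 2 (volume.restrict (Ioo 0 a))) : IntervalIntegrable q volume 0 a := by
  rw [intervalIntegrable_iff_integrableOn_Ioo_of_le ha.le]
  exact hq.integrable (by norm_num)

theorem encard_fiber_sigma (m : ℂ → ℕ) {Z : Set ℂ} {ι : Type}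
    (E : ι ≃ Σ z : Z, Fin (m z)) (z : Z) : {k | ((E k).1 : ℂ) = z}.encard = m z := by
  have hset : {k | ((E k).1 : ℂ) = z} = range fun j : Fin (m z) => E.symm ⟨z, j⟩ := by
    ext k
    constructor
    · intro h
      obtain ⟨p, rfl⟩ := E.symm.surjective k
      rw [mem_ofPred_eq, Equiv.apply_symm_apply] at h
      obtain ⟨w, j⟩ := p
      obtain rfl : w = z := Subtype.ext h
      exact ⟨j, rfl⟩
    · rintro ⟨j, rfl⟩
      simp
  have hinj : Function.Injective fun j : Fin (m z) => E.symm ⟨z, j⟩ := by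
    intro i j h
    have := E.symm.injective h
    simpa using this
  rw [hset, ← image_univ, hinj.injOn.encard_image, encard_univ]
  simp

/-- The zeros of an entire function with infinitely many zeros can be numbered by the integers. -/
theorem exists_int_enumeration_zeros {F : ℂ → ℂ} (hF : Differentiable ℂ F) (hne : ∃ w, F w ≠ 0)
    (hinf : {z | F z = 0}.Infinite) :
    ∃ ev : ℤ → ℂ, ∀ z, {k | ev k = z}.encard = analyticOrderAt F z := by
  set Z := {z | F z = 0} with hZ
  have hcount : Z.Countable := by
    have : Z ⊆ ⋃ n : ℕ, {z | z ∈ Metric.closedBall (0 : ℂ) n ∧ F z = 0} := fun z hz => by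
      obtain ⟨n, hn⟩ := exists_nat_ge ‖z‖
      exact mem_iUnion.2 ⟨n, by simpa using hn, hz⟩
    refine (countable_iUnion fun n => ?_).mono this
    obtain ⟨S, hS⟩ := exists_finset_zeros hF hne 0 n
    exact (S.finite_toSet.subset fun z hz => (hS z).2 hz).countable
  have hord : ∀ z, (analyticOrderNatAt F z : ℕ∞) = analyticOrderAt F z := fun z =>
    Nat.cast_analyticOrderNatAt (analyticOrderAt_ne_top_of_entire hF hne z)
  have hpos : ∀ z : Z, 0 < analyticOrderNatAt F z := by
    intro z
    rw [Nat.pos_iff_ne_zero]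
    intro h0
    have h1 := hord z
    rw [h0] at h1
    exact (hF.analyticAt z).analyticOrderAt_eq_zero.1 h1.symm z.2
  have : Countable Z := hcount.to_subtype
  have : Infinite Z := hinf.to_subtype
  have : Infinite (Σ z : Z, Fin (analyticOrderNatAt F z)) :=
    Infinite.of_injective (fun z : Z => ⟨z, ⟨0, hpos z⟩⟩) fun z w h => (Sigma.mk.inj h).1
  obtain ⟨E⟩ := nonempty_equiv_of_countable (α := ℤ) (β := Σ z : Z, Fin (analyticOrderNatAt F z))
  refine ⟨fun k => (E k).1, fun z => ?_⟩
  by_cases hz : F z = 0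
  · rw [encard_fiber_sigma _ E ⟨z, hz⟩, hord]
  · rw [(hF.analyticAt z).analyticOrderAt_eq_zero.2 hz, encard_eq_zero]
    ext k
    simp only [mem_ofPred_eq, mem_empty_iff_false, iff_false]
    rintro rfl
    exact hz (E k).1.2

namespace ReggeProblem
variable {L : ReggeProblem}

theorem IsCharFun.isEigenvalueEnumeration {Δ : ℂ → ℂ} (hΔ : L.IsCharFun Δ)
    (hd : Differentiable ℂ Δ) (ha : 0 < L.a) (hq : IntervalIntegrable L.q volume 0 L.a) {ι : Type}
    {ev : ι → ℂ} (h : ∀ z, {k | ev k = z}.encard = analyticOrderAt Δ z) :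
    L.IsEigenvalueEnumeration ev := by
  refine ⟨?_, Δ, hΔ, hd, h⟩
  rw [hΔ.spectrum_eq ha hq]
  ext z
  have h1 : z ∈ range ev ↔ {k | ev k = z}.encard ≠ 0 := by
    rw [ne_eq, encard_eq_zero, ← ne_eq, ← nonempty_iff_ne_empty]; rfl
  rw [h1, h, ne_eq, (hd.analyticAt z).analyticOrderAt_eq_zero, not_not, mem_ofPred_eq]

/-- If the reflected wave is absent, the zeros in every lower half plane are bounded. -/
theorem IsCharFun.exists_norm_le_of_im_le {Δ : ℂ → ℂ} (hΔ : L.IsCharFun Δ) (ha : 0 < L.a)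
    (hq : IntervalIntegrable L.q volume 0 L.a) (hB : (L.α₀ - 1) * (1 - L.α) = 0)
    (hA : 0 < (1 + L.α₀) * (1 + L.α)) (T : ℝ) :
    ∃ M : ℝ, ∀ z : ℂ, z.im ≤ T → Δ z = 0 → ‖z‖ ≤ M := by
  obtain ⟨C, R, hC, hR, h⟩ := hΔ.norm_sub_charLeading_le ha hq
  set A := (1 + L.α₀) * (1 + L.α) with hAdef
  refine ⟨max R (2 * C * Real.exp (2 * |T| * L.a) / A), fun z hz h0 => ?_⟩
  by_contra! hlt
  obtain ⟨h1, h2⟩ := max_lt_iff.1 hlt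
  have h3 := h z h1.le
  have hBc : ((L.α₀ : ℂ) - 1) * (1 - L.α) = 0 := by exact_mod_cast hB
  have e1 : L.charLeading z = Complex.I * z / 2 * ((A : ℝ) * Complex.exp (Complex.I * z * L.a)) := by
    unfold charLeading
    rw [hBc, zero_mul, add_zero, hAdef]; push_cast; ring
  have e2 : ‖Complex.exp (Complex.I * z * L.a)‖ = Real.exp (-z.im * L.a) := by
    rw [Complex.norm_exp]; simp
  have e3 : ‖L.charLeading z‖ = ‖z‖ / 2 * (A * Real.exp (-z.im * L.a)) := by
    rw [e1, norm_mul, norm_mul, e2, Complex.norm_real, Real.norm_of_nonneg hA.le]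
    simp
  rw [h0, zero_sub, norm_neg, e3] at h3
  -- For Im z ≤ T the surviving |e^{iza}| = e^{-a Im z} dominates e^{|Im z|a} up to a constant,
  -- while the leading part carries an extra factor |z|.
  have h4 : Real.exp (|z.im| * L.a) ≤ Real.exp (2 * |T| * L.a) * Real.exp (-z.im * L.a) := by
    rw [← Real.exp_add, Real.exp_le_exp, ← add_mul]
    refine mul_le_mul_of_nonneg_right ?_ ha.le
    rcases abs_cases z.im with h | h <;> linarith [le_abs_self T, abs_nonneg T]
  have h5 := mul_le_mul_of_nonneg_left h4 hC.le
  rw [div_lt_iff₀ hA] at h2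
  have h6 := mul_lt_mul_of_pos_right h2 (Real.exp_pos (-z.im * L.a))
  linarith

/-- If the reflected wave is absent, the eigenvalues can accumulate only at `Im z = ∞`. -/
theorem enumeration_of_no_reflection (ha : 0 < L.a) (hq : IntervalIntegrable L.q volume 0 L.a)
    (hB : (L.α₀ - 1) * (1 - L.α) = 0) (hA : 0 < (1 + L.α₀) * (1 + L.α))
    (hinf : L.spectrum.Infinite) :
    (∃ ev : ℤ → ℂ, L.IsEigenvalueEnumeration ev) ∧
      ∀ ev : ℤ → ℂ, L.IsEigenvalueEnumeration ev → Tendsto (fun k => (ev k).im) cofinite atTop := by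
  obtain ⟨Δ, hΔ, hd⟩ := exists_charFun ha hq
  -- If Δ vanished identically, its real zeros would be unbounded.
  have hne : ∃ w, Δ w ≠ 0 := by
    by_contra! hall
    obtain ⟨M, hM⟩ := hΔ.exists_norm_le_of_im_le ha hq hB hA 0
    have := hM ((|M| + 1 : ℝ) : ℂ) (by simp) (hall _)
    rw [Complex.norm_real, Real.norm_of_nonneg (by positivity)] at this
    linarith [le_abs_self M]
  constructor
  · rw [hΔ.spectrum_eq ha hq] at hinf
    obtain ⟨ev, hev⟩ := exists_int_enumeration_zeros hd hne hinf
    exact ⟨ev, hΔ.isEigenvalueEnumeration hd ha hq hev⟩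
  · rintro ev ⟨-, Δ', hΔ', -, hev⟩
    obtain rfl := hΔ'.unique hΔ ha hq
    rw [tendsto_atTop]
    intro T
    obtain ⟨M, hM⟩ := hΔ.exists_norm_le_of_im_le ha hq hB hA T
    obtain ⟨S, hS⟩ := exists_finset_zeros hd hne 0 M
    rw [eventually_cofinite]
    -- Only finitely many distinct zeros have Im z < T, and each occurs finitely often.
    refine (S.finite_toSet.biUnion (t := fun z => {k | ev k = z}) fun z _ => ?_).subset fun k hk => ?_
    · rw [← encard_ne_top_iff, hev]
      exact analyticOrderAt_ne_top_of_entire hd hne z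
    · have hk0 : Δ' (ev k) = 0 := by
        by_contra h0
        have h1 := hev (ev k)
        rw [(hd.analyticAt _).analyticOrderAt_eq_zero.2 h0, encard_eq_zero] at h1
        exact (h1 ▸ (rfl : ev k = ev k) : k ∈ (∅ : Set ℤ))
      refine mem_biUnion (x := ev k) ?_ rfl
      exact (hS _).2 ⟨by simpa using hM _ (not_le.1 hk).le hk0, hk0⟩

theorem IsSolution.ne_zero_of_nontrivial {z : ℂ} {y y' : ℝ → ℂ} (h : L.IsSolution z y y')
    (ha : 0 < L.a) (hq : IntervalIntegrable L.q volume 0 L.a) (hnt : ∃ x ∈ Icc 0 L.a, y x ≠ 0)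
    {c : ℂ} (h0 : y' 0 - c * y 0 = 0) : y 0 ≠ 0 := by
  intro hy0
  obtain ⟨x, hx, hyx⟩ := hnt
  have h1 := (h.unique (h.const_mul 0) ha hq (by simp [hy0]) (by
    rw [hy0] at h0; linear_combination h0) x hx).1
  simp at h1
  exact hyx h1

theorem finite_setOf_mul_add_one (c : ℂ) : {z : ℂ | z * c + 1 = 0}.Finite := by
  refine Set.Subsingleton.finite fun z hz w hw => ?_
  have hc : c ≠ 0 := by rintro rfl; simp at hz
  have h1 : z * c + 1 = 0 := hz
  have h2 : w * c + 1 = 0 := hw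
  exact mul_right_cancel₀ hc (by linear_combination h1 - h2)

/-- Free problems with finitely many eigenvalues. -/
theorem exists_finite_spectrum (a α₀ α : ℝ) (ha : 0 < a) (h : (α₀ - 1) * (1 - α) = 0) :
    ∃ (q : ℝ → ℂ) (β₀ β : ℂ), MemLp q 2 (volume.restrict (Ioo 0 a)) ∧
      ∀ ε : ℝ, ε = 1 ∨ ε = -1 → (ReggeProblem.mk a q α₀ β₀ (ε * α) β).spectrum.Finite := by
  have free : ∀ {L : ReggeProblem}, 0 < L.a → L.q = 0 → ∀ {z y y'}, L.IsSolution z y y' →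
      y' L.a + Complex.I * z * y L.a =
        Complex.exp (Complex.I * z * L.a) * (y' 0 + Complex.I * z * y 0) ∧
      y' L.a - Complex.I * z * y L.a =
        Complex.exp (-(Complex.I * z) * L.a) * (y' 0 - Complex.I * z * y 0) := by
    intro L ha hq0 z y y' hs
    have hq : IntervalIntegrable L.q volume 0 L.a := by
      rw [hq0]; exact intervalIntegrable_const (c := (0 : ℂ))
    have v1 := hs.variation ha hq (μ := Complex.I * z) (by rw [mul_pow, Complex.I_sq]; ring)
      _ (right_mem_Icc.2 ha.le)
    have v2 := hs.variation ha hq (μ := -(Complex.I * z))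
      (by rw [neg_sq, mul_pow, Complex.I_sq]; ring) _ (right_mem_Icc.2 ha.le)
    simp only [hq0, Pi.zero_apply, zero_mul, mul_zero, intervalIntegral.integral_zero,
      add_zero] at v1 v2
    exact ⟨v1, by linear_combination v2⟩
  have hq0 : IntervalIntegrable (0 : ℝ → ℂ) volume 0 a := intervalIntegrable_const (c := (0 : ℂ))
  rcases mul_eq_zero.1 h with h1 | h1
  · obtain rfl : α₀ = 1 := by linarith
    -- Here Δ(z) = (iz(1 + εα) + β) e^{iza}. The choice β = 1 matters: with β = 0 and εα = -1 every
    -- z would be an eigenvalue.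
    refine ⟨0, 0, 1, MemLp.zero, fun ε _ => ?_⟩
    refine ((finite_singleton (0 : ℂ)).union
      (finite_setOf_mul_add_one (Complex.I * (1 + (ε * α : ℝ))))).subset ?_
    rintro z ⟨y, y', hs, hnt, b0, ba⟩
    have hy0 := hs.ne_zero_of_nontrivial ha hq0 hnt b0
    obtain ⟨v1, v2⟩ := free ha rfl hs
    simp only at b0 ba v1 v2
    have e1 : y' 0 - Complex.I * z * y 0 = 0 := by
      push_cast at b0; linear_combination b0
    rw [e1, mul_zero] at v2
    have e2 : (z * (Complex.I * (1 + (ε * α : ℝ))) + 1) * y a = 0 := by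
      linear_combination ba - v2
    rcases mul_eq_zero.1 e2 with h2 | h2
    · exact Or.inr h2
    -- y(a) = 0 would force z = 0, which is why 0 was put into the finite set.
    · left
      rw [h2, mul_zero, sub_zero] at v2
      rw [h2, v2, mul_zero, add_zero] at v1
      have e3 := (mul_eq_zero.1 v1.symm).resolve_left (Complex.exp_ne_zero _)
      have e4 : z * (2 * Complex.I * y 0) = 0 := by linear_combination e3 - e1
      exact (mul_eq_zero.1 e4).resolve_right
        (mul_ne_zero (mul_ne_zero two_ne_zero Complex.I_ne_zero) hy0)
  · obtain rfl : α = 1 := by linarith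
    -- Here Δ(z) = (iz(α₀ + ε) + β₀) e^{εiza}, and β₀ = 1 excludes Δ = 0 when α₀ = 1 and ε = -1.
    refine ⟨0, 1, 0, MemLp.zero, fun ε hε => ?_⟩
    refine (finite_setOf_mul_add_one (Complex.I * (α₀ + (ε : ℝ)))).subset ?_
    rintro z ⟨y, y', hs, hnt, b0, ba⟩
    have hy0 := hs.ne_zero_of_nontrivial ha hq0 hnt b0
    obtain ⟨v1, v2⟩ := free ha rfl hs
    simp only at b0 ba v1 v2
    refine (mul_eq_zero.1 (?_ : (z * (Complex.I * (α₀ + (ε : ℝ))) + 1) * y 0 = 0)).resolve_right hy0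
    rcases hε with rfl | rfl
    · have e : y' a + Complex.I * z * y a = 0 := by push_cast at ba; linear_combination ba
      rw [e] at v1
      have e3 := (mul_eq_zero.1 v1.symm).resolve_left (Complex.exp_ne_zero _)
      push_cast
      linear_combination e3 - b0
    · have e : y' a - Complex.I * z * y a = 0 := by push_cast at ba; linear_combination ba
      rw [e] at v2
      have e3 := (mul_eq_zero.1 v2.symm).resolve_left (Complex.exp_ne_zero _)
      push_cast
      linear_combination e3 - b0

end ReggeProblem

/-! ### Fourier transform of the potential near a lattice of frequencies. -/

namespace ReggeProblem
variable {L : ReggeProblem}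

theorem norm_exp_mul_ofReal_le_of_mem {μ : ℂ} {a t : ℝ} (ht : t ∈ Icc 0 a) :
    ‖Complex.exp (μ * t)‖ ≤ Real.exp (|μ.re| * a) :=
  (Complex.norm_exp_mul_ofReal_le le_rfl ht.1).trans
    (Real.exp_le_exp.2 (mul_le_mul_of_nonneg_left ht.2 (abs_nonneg _)))

theorem memLp_exp_mul (hq : MemLp L.q 2 (volume.restrict (Ioo 0 L.a)))
    (μ : ℂ) : MemLp (fun t : ℝ => Complex.exp (μ * t) * L.q t) 2
      (volume.restrict (Ioc 0 L.a)) := by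
  have hq' : MemLp L.q 2 (volume.restrict (Ioc 0 L.a)) := by
    rwa [← restrict_Ioo_eq_restrict_Ioc]
  have hc : Continuous fun t : ℝ => Complex.exp (μ * t) := by fun_prop
  refine MemLp.of_le_mul (c := Real.exp (|μ.re| * L.a)) hq'
    (hc.aestronglyMeasurable.mul hq'.aestronglyMeasurable) ?_
  filter_upwards [ae_restrict_mem measurableSet_Ioc] with t ht
  rw [norm_mul]
  exact mul_le_mul_of_nonneg_right (norm_exp_mul_ofReal_le_of_mem ⟨ht.1.le, ht.2⟩) (norm_nonneg _)

/-- Bessel's inequality for the transform of the potential along a line of frequencies. -/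
theorem summable_expTransform_sq (ha : 0 < L.a)
    (hq : MemLp L.q 2 (volume.restrict (Ioo 0 L.a))) (μ : ℂ) :
    Summable fun n : ℤ => ‖L.expTransform (2 * Real.pi * Complex.I * n / L.a + μ)‖ ^ 2 := by
  have h := (hasSum_sq_fourierCoeffOn ha (memLp_exp_mul hq μ)).summable
  have h2 := ((Equiv.neg ℤ).summable_iff.2 h).mul_left (L.a ^ 2)
  refine h2.congr fun n => ?_
  simp only [Function.comp_apply, Equiv.neg_apply]
  have ha' : (L.a : ℂ) ≠ 0 := by exact_mod_cast ha.ne'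
  -- The coefficient of index -n carries e^{+2πint/a}; hence the reflection of ℤ.
  have e : L.expTransform (2 * Real.pi * Complex.I * n / L.a + μ) =
      L.a * fourierCoeffOn ha (fun t : ℝ => Complex.exp (μ * t) * L.q t) (-n) := by
    rw [fourierCoeffOn_eq_integral, expTransform, neg_neg, Complex.real_smul]
    rw [sub_zero]
    push_cast
    rw [← mul_assoc, mul_one_div_cancel ha', one_mul]
    congr 1; ext t
    rw [fourier_coe_apply, smul_eq_mul, ← mul_assoc, ← Complex.exp_add]
    congr 2
    field_simp
  rw [e, norm_mul, mul_pow, Complex.norm_real, Real.norm_eq_abs, sq_abs]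

/-- Moves a frequency from the shifted lattice, where Bessel's inequality applies, to that of an
actual eigenvalue at cost O(‖η‖). -/
theorem norm_expTransform_add_sub_le (ha : 0 < L.a) (hq : IntervalIntegrable L.q volume 0 L.a)
    (ν : ℂ) {η : ℂ} (hη : ‖η‖ * L.a ≤ 1) :
    ‖L.expTransform (ν + η) - L.expTransform ν‖ ≤
      (∫ t in (0 : ℝ)..L.a, ‖L.q t‖) * (Real.exp (|ν.re| * L.a) * (2 * (‖η‖ * L.a))) := by
  unfold expTransform
  rw [← intervalIntegral.integral_sub (intervalIntegrable_exp_mul hq _)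
    (intervalIntegrable_exp_mul hq _)]
  have e : ∫ t in (0 : ℝ)..L.a, (Complex.exp ((ν + η) * t) * L.q t - Complex.exp (ν * t) * L.q t) =
      ∫ t in (0 : ℝ)..L.a, L.q t * (Complex.exp (ν * t) * (Complex.exp (η * t) - 1)) := by
    congr 1; ext t
    rw [add_mul, Complex.exp_add]; ring
  rw [e]
  refine norm_integral_mul_le ha.le hq fun t ht => ?_
  rw [norm_mul]
  have h1 : ‖η * t‖ ≤ ‖η‖ * L.a := by
    rw [norm_mul, Complex.norm_real, Real.norm_of_nonneg ht.1]
    exact mul_le_mul_of_nonneg_left ht.2 (norm_nonneg _)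
  have h2 := Complex.norm_exp_sub_one_le (h1.trans hη)
  exact mul_le_mul (norm_exp_mul_ofReal_le_of_mem ht)
    (h2.trans (mul_le_mul_of_nonneg_left h1 two_pos.le)) (norm_nonneg _) (Real.exp_pos _).le

end ReggeProblem

/-! ### The perturbed sine equation to first order. -/

theorem Complex.norm_sin_sub_self_le {δ : ℂ} (h : ‖δ‖ ≤ 1) : ‖Complex.sin δ - δ‖ ≤ ‖δ‖ ^ 2 := by
  have h1 := Complex.sin_bound h
  have h2 : Complex.sin δ - δ = (Complex.sin δ - (δ - δ ^ 3 / 6)) + (-(δ ^ 3 / 6)) := by ring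
  rw [h2]
  refine (norm_add_le _ _).trans ?_
  rw [norm_neg, norm_div, norm_pow]
  have h3 : ‖(6 : ℂ)‖ = 6 := by simp
  rw [h3]
  have h4 : ‖δ‖ ^ 3 ≤ ‖δ‖ ^ 2 := pow_le_pow_of_le_one (norm_nonneg _) h (by norm_num)
  have h5 : ‖δ‖ ^ 5 ≤ ‖δ‖ ^ 2 := pow_le_pow_of_le_one (norm_nonneg _) h (by norm_num)
  linarith [sq_nonneg ‖δ‖]

theorem Complex.norm_sin_le_exp_abs_im (w : ℂ) : ‖Complex.sin w‖ ≤ Real.exp |w.im| := by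
  have h1 := Complex.norm_exp_mul_ofReal_le (Complex.abs_re_I_mul w) zero_le_one
  have h2 := Complex.norm_exp_mul_ofReal_le (Complex.abs_re_neg_I_mul w) zero_le_one
  simp only [Complex.ofReal_one, mul_one] at h1 h2
  have e : Complex.sin w =
      (Complex.exp (-(Complex.I * w)) - Complex.exp (Complex.I * w)) * Complex.I / 2 := by
    rw [Complex.sin]; congr 3 <;> ring_nf
  rw [e, norm_div, norm_mul, Complex.norm_I, mul_one]
  have := norm_sub_le (Complex.exp (-(Complex.I * w))) (Complex.exp (Complex.I * w))
  have h3 : ‖(2 : ℂ)‖ = 2 := by simp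
  rw [h3]
  linarith

theorem Complex.norm_exp_I_mul_sub_one_le {δ : ℂ} (h : ‖δ‖ ≤ 1) :
    ‖Complex.exp (Complex.I * δ) - 1‖ ≤ 2 * ‖δ‖ ∧ ‖Complex.exp (-(Complex.I * δ)) - 1‖ ≤ 2 * ‖δ‖ := by
  have e : ‖Complex.I * δ‖ = ‖δ‖ := by simp
  have e' : ‖-(Complex.I * δ)‖ = ‖δ‖ := by simp
  constructor
  · simpa [e] using Complex.norm_exp_sub_one_le (x := Complex.I * δ) (by rwa [e])
  · simpa [e'] using Complex.norm_exp_sub_one_le (x := -(Complex.I * δ)) (by rwa [e'])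

theorem Complex.norm_exp_I_mul_le {δ : ℂ} (h : ‖δ‖ ≤ 1) :
    ‖Complex.exp (Complex.I * δ)‖ ≤ 3 ∧ ‖Complex.exp (-(Complex.I * δ))‖ ≤ 3 := by
  obtain ⟨h1, h2⟩ := Complex.norm_exp_I_mul_sub_one_le h
  constructor
  · have := norm_add_le (Complex.exp (Complex.I * δ) - 1) 1
    rw [sub_add_cancel, norm_one] at this
    linarith
  · have := norm_add_le (Complex.exp (-(Complex.I * δ)) - 1) 1
    rw [sub_add_cancel, norm_one] at this
    linarith

/-- First order solution of the perturbed sine equation. -/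
theorem norm_mul_sub_le_of_sine_equation {z δ m₁ m₂ t₁ t₂ : ℂ} {E : ℝ} (hδ : ‖δ‖ ≤ 1)
    (h : ‖-(z * Complex.sin δ) + (m₁ * Complex.exp (Complex.I * δ) +
      m₂ * Complex.exp (-(Complex.I * δ)) + (t₁ * Complex.exp (Complex.I * δ) +
        t₂ * Complex.exp (-(Complex.I * δ))))‖ ≤ E) :
    ‖z * δ - (m₁ + m₂)‖ ≤
      E + ‖z‖ * ‖δ‖ ^ 2 + 2 * (‖m₁‖ + ‖m₂‖) * ‖δ‖ + 3 * (‖t₁‖ + ‖t₂‖) := by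
  obtain ⟨h1, h2⟩ := Complex.norm_exp_I_mul_sub_one_le hδ
  obtain ⟨h3, h4⟩ := Complex.norm_exp_I_mul_le hδ
  have h5 := Complex.norm_sin_sub_self_le hδ
  set X := Complex.exp (Complex.I * δ)
  set Y := Complex.exp (-(Complex.I * δ))
  have e : z * δ - (m₁ + m₂) = -(-(z * Complex.sin δ) + (m₁ * X + m₂ * Y + (t₁ * X + t₂ * Y))) +
      (-(z * (Complex.sin δ - δ))) + m₁ * (X - 1) + m₂ * (Y - 1) + t₁ * X + t₂ * Y := by ring
  rw [e]
  refine (norm_add_le _ _).trans ((add_le_add ((norm_add_le _ _).trans (add_le_add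
    ((norm_add_le _ _).trans (add_le_add ((norm_add_le _ _).trans (add_le_add
      (norm_add_le _ _) le_rfl)) le_rfl)) le_rfl)) le_rfl).trans ?_)
  rw [norm_neg, norm_neg, norm_mul, norm_mul, norm_mul, norm_mul, norm_mul]
  have a1 := mul_le_mul_of_nonneg_left h1 (norm_nonneg m₁)
  have a2 := mul_le_mul_of_nonneg_left h2 (norm_nonneg m₂)
  have a3 := mul_le_mul_of_nonneg_left h3 (norm_nonneg t₁)
  have a4 := mul_le_mul_of_nonneg_left h4 (norm_nonneg t₂)
  have a5 := mul_le_mul_of_nonneg_left h5 (norm_nonneg z)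
  linarith

/-- `nodeIndex` is a translation on each half of ℤ, so two translates of the given series dominate.
-/
theorem summable_sq_nodeIndex {e : ℕ} {g : ℤ → ℝ} (hg : Summable fun n => g n ^ 2) :
    Summable fun k : ℤ => g (nodeIndex e k) ^ 2 := by
  have h1 := (Equiv.subRight (1 : ℤ)).summable_iff.2 hg
  have h2 := (Equiv.addRight (1 - e : ℤ)).summable_iff.2 hg
  refine Summable.of_nonneg_of_le (fun _ => sq_nonneg _) (fun k => ?_) (h1.add h2)
  simp only [Function.comp_apply, Equiv.subRight_apply, Equiv.coe_addRight]
  unfold nodeIndex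
  split_ifs
  · exact le_add_of_nonneg_right (sq_nonneg _)
  · rw [add_sub_assoc]; exact le_add_of_nonneg_left (sq_nonneg _)

theorem abs_sineNode_nodeIndex_sub_le {e : ℕ} (he : e ≤ 1) (k : ℤ) :
    |sineNode e (nodeIndex e k) - k * Real.pi| ≤ 2 * Real.pi := by
  have hpi := Real.pi_pos
  have he' : (e : ℝ) ≤ 1 := by exact_mod_cast he
  have he0 : (0 : ℝ) ≤ e := Nat.cast_nonneg e
  unfold sineNode nodeIndex
  rw [abs_le]
  split_ifs <;> push_cast <;> constructor <;> nlinarith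

/-- Pulling back an entire function along an affine map preserves the orders of the zeros. -/
theorem analyticOrderAt_comp_affine {f : ℂ → ℂ} (hf : Differentiable ℂ f) {κ s c : ℂ}
    (hκ : κ ≠ 0) (hs : s ≠ 0) (w : ℂ) :
    analyticOrderAt (fun w => κ * f (s * w + c)) w = analyticOrderAt f (s * w + c) := by
  have h1 : analyticOrderAt (f ∘ fun w => s * w + c) w = analyticOrderAt f (s * w + c) := by
    have hd : HasDerivAt (fun w => s * w + c) s w := by
      simpa using ((hasDerivAt_id w).const_mul s).add_const c
    refine analyticOrderAt_comp_of_deriv_ne_zero (g := fun w => s * w + c) (by fun_prop) ?_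
    rw [hd.deriv]; exact hs
  have hfd : Differentiable ℂ (f ∘ fun w => s * w + c) := hf.comp (by fun_prop)
  have h2 : (fun w => κ * f (s * w + c)) = (fun _ => κ) * (f ∘ fun w => s * w + c) := rfl
  have h3 : AnalyticAt ℂ (fun _ : ℂ => κ) w := analyticAt_const
  rw [h2, analyticOrderAt_mul h3 (hfd.analyticAt w), h1, h3.analyticOrderAt_eq_zero.2 hκ, zero_add]

/-! ### Reduction of the characteristic function to the sine model. -/

namespace ReggeProblem
variable {L : ReggeProblem}

/-- `exp (i θ - c a)` for `θ = e π / 2`. -/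
noncomputable def phase (L : ReggeProblem) (e : ℕ) (c : ℝ) : ℂ :=
  Complex.exp (Complex.I * (e * Real.pi / 2 : ℝ) - c * L.a)

theorem phase_ne_zero (e : ℕ) (c : ℝ) : L.phase e c ≠ 0 := Complex.exp_ne_zero _

/-- The amplitude of the leading part of the characteristic function. -/
noncomputable def amplitude (L : ReggeProblem) (e : ℕ) (c : ℝ) : ℂ :=
  (1 + L.α₀) * (1 + L.α) * L.phase e c

/-- The balance of the two exponentials along the line `Im z = c`. -/
def Balanced (L : ReggeProblem) (e : ℕ) (c : ℝ) : Prop :=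
  (L.α₀ - 1) * (1 - L.α) * Real.exp (2 * c * L.a) = -((1 + L.α₀) * (1 + L.α) * (-1) ^ e)

/-- The phase squares to (-1)^e e^{-2ca}. Once the phases are extracted, the two exponentials have
opposite amplitudes, which produces a sine. -/
theorem Balanced.eq {e : ℕ} {c : ℝ} (h : L.Balanced e c) :
    ((L.α₀ : ℂ) - 1) * (1 - L.α) = -(L.amplitude e c * L.phase e c) := by
  have h1 : L.phase e c * L.phase e c = (-1) ^ e * Complex.exp (-(2 * c * L.a)) := by
    unfold phase
    rw [← Complex.exp_add]
    have : Complex.I * (e * Real.pi / 2 : ℝ) - c * L.a + (Complex.I * (e * Real.pi / 2 : ℝ) - c * L.a)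
        = e * (Real.pi * Complex.I) + -(2 * c * L.a) := by push_cast; ring
    rw [this, Complex.exp_add, Complex.exp_nat_mul, Complex.exp_pi_mul_I]
  have h2 : ((L.α₀ : ℂ) - 1) * (1 - L.α) * Complex.exp (2 * c * L.a) =
      -((1 + L.α₀) * (1 + L.α) * (-1) ^ e) := by
    unfold Balanced at h
    exact_mod_cast congrArg (fun x : ℝ => (x : ℂ)) h
  have h3 : Complex.exp (2 * c * L.a) * Complex.exp (-(2 * c * L.a)) = 1 := by
    rw [← Complex.exp_add]; simp
  unfold amplitude
  linear_combination Complex.exp (-(2 * c * L.a)) * h2 - (L.α₀ - 1) * (1 - L.α) * h3 +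
    (1 + L.α₀) * (1 + L.α) * h1

theorem exp_I_mul_eq (e : ℕ) (c : ℝ) {z δ : ℂ} {n : ℤ}
    (hz : L.a * z - Complex.I * c * L.a = sineNode e n + δ) :
    Complex.exp (Complex.I * z * L.a) =
        L.phase e c * ((-1) ^ n * Complex.exp (Complex.I * δ)) ∧
      Complex.exp (-(Complex.I * z) * L.a) =
        (L.phase e c)⁻¹ * ((-1) ^ n * Complex.exp (-(Complex.I * δ))) := by
  have hn : Complex.exp (n * (Real.pi * Complex.I)) = (-1) ^ n := by
    rw [Complex.exp_int_mul, Complex.exp_pi_mul_I]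
  have hn' : Complex.exp (-(n * (Real.pi * Complex.I))) = (-1) ^ n := by
    rw [Complex.exp_neg, hn, ← inv_zpow, inv_neg_one]
  have e1 : Complex.I * z * L.a = (Complex.I * (e * Real.pi / 2 : ℝ) - c * L.a) +
      (n * (Real.pi * Complex.I) + Complex.I * δ) := by
    unfold sineNode at hz
    push_cast at hz ⊢
    linear_combination Complex.I * hz + c * L.a * Complex.I_sq
  constructor
  · rw [e1, Complex.exp_add, Complex.exp_add, hn]; rfl
  · rw [neg_mul, e1, neg_add, neg_add, Complex.exp_add, Complex.exp_add, hn', Complex.exp_neg]; rfl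

theorem amplitude_ne_zero (e : ℕ) (c : ℝ) (hA : (1 + L.α₀) * (1 + L.α) ≠ 0) :
    L.amplitude e c ≠ 0 := by
  refine mul_ne_zero ?_ (phase_ne_zero e c)
  exact_mod_cast hA

theorem charLeading_eq {e : ℕ} {c : ℝ} (h : L.Balanced e c) {z δ : ℂ} {n : ℤ}
    (hz : L.a * z - Complex.I * c * L.a = sineNode e n + δ) :
    L.charLeading z = -(L.amplitude e c * (-1) ^ n * (z * Complex.sin δ)) := by
  obtain ⟨h1, h2⟩ := exp_I_mul_eq e c hz
  unfold charLeading
  rw [h1, h2, h.eq, Complex.sin]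
  have hp := phase_ne_zero (L := L) e c
  have e1 : -δ * Complex.I = -(Complex.I * δ) := by ring
  have e2 : δ * Complex.I = Complex.I * δ := by ring
  rw [e1, e2]
  have e3 : L.amplitude e c * L.phase e c * (L.phase e c)⁻¹ = L.amplitude e c := by field_simp
  have e4 : (1 + L.α₀) * (1 + L.α) * L.phase e c = L.amplitude e c := rfl
  linear_combination Complex.I * z / 2 * ((-1) ^ n * Complex.exp (Complex.I * δ)) * e4 -
    Complex.I * z / 2 * ((-1) ^ n * Complex.exp (-(Complex.I * δ))) * e3

/-- Has the same nonzero prefactor as `charLeading_eq`, so that it can be divided out of Δ(z) = 0.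
-/
theorem charSecond_eq {e : ℕ} {c : ℝ} (h : L.Balanced e c) (hA : (1 + L.α₀) * (1 + L.α) ≠ 0)
    (hB : (L.α₀ - 1) * (1 - L.α) ≠ 0) {z δ : ℂ} {n : ℤ}
    (hz : L.a * z - Complex.I * c * L.a = sineNode e n + δ) :
    L.charSecond z = L.amplitude e c * (-1) ^ n *
      (L.charCoeffPos / ((1 + L.α₀) * (1 + L.α)) * Complex.exp (Complex.I * δ) +
        -(L.charCoeffNeg / ((L.α₀ - 1) * (1 - L.α))) * Complex.exp (-(Complex.I * δ)) +
        ((1 + L.α) * (1 - L.α₀) / 4 / ((1 + L.α₀) * (1 + L.α)) *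
            L.expTransform (-(2 * (Complex.I * z))) * Complex.exp (Complex.I * δ) +
          -((1 - L.α) * (1 + L.α₀) / 4 / ((L.α₀ - 1) * (1 - L.α))) *
            L.expTransform (2 * (Complex.I * z)) * Complex.exp (-(Complex.I * δ)))) := by
  obtain ⟨h1, h2⟩ := exp_I_mul_eq e c hz
  have hA' : ((1 : ℂ) + L.α₀) * (1 + L.α) ≠ 0 := by exact_mod_cast hA
  have hB' : ((L.α₀ : ℂ) - 1) * (1 - L.α) ≠ 0 := by exact_mod_cast hB
  have hp := phase_ne_zero (L := L) e c
  have e3 : L.phase e c = L.amplitude e c / ((1 + L.α₀) * (1 + L.α)) := by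
    unfold amplitude; rw [mul_div_cancel_left₀ _ hA']
  have e4 : (L.phase e c)⁻¹ = -(L.amplitude e c / ((L.α₀ - 1) * (1 - L.α))) := by
    rw [h.eq]
    have := amplitude_ne_zero e c hA
    field_simp
  unfold charSecond
  rw [h1, h2, e4]
  nth_rewrite 1 2 [e3]
  set A := ((1 : ℂ) + L.α₀) * (1 + L.α)
  set B := ((L.α₀ : ℂ) - 1) * (1 - L.α)
  ring

/-- With n = 0 and δ = w - eπ/2 the leading part is exactly a multiple of z sin δ. Replacing az by w
costs ica sin δ = O(e^{|Im w|}), which is absorbed into C. -/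
theorem isSinePerturbation (ha : 0 < L.a) (hq : IntervalIntegrable L.q volume 0 L.a)
    {Δ : ℂ → ℂ} (hΔ : L.IsCharFun Δ) {e : ℕ} {c : ℝ} (h : L.Balanced e c)
    (hA : (1 + L.α₀) * (1 + L.α) ≠ 0) :
    ∃ C R : ℝ, IsSinePerturbation
      (fun w => -(L.a / L.amplitude e c) * Δ ((L.a : ℂ)⁻¹ * w + Complex.I * c)) e C R := by
  obtain ⟨C, R, hC, hR, hb⟩ := hΔ.norm_sub_charLeading_le ha hq
  have ha' : (L.a : ℂ) ≠ 0 := by exact_mod_cast ha.ne'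
  have hamp := amplitude_ne_zero e c hA
  set κ : ℂ := -(L.a / L.amplitude e c) with hκ
  refine ⟨‖κ‖ * (C * Real.exp (|c| * L.a)) + |c| * L.a + 1, L.a * (R + |c|), by positivity,
    fun w hw => ?_⟩
  set z := (L.a : ℂ)⁻¹ * w + Complex.I * c with hz
  have hnode : L.a * z - Complex.I * c * L.a =
      sineNode e 0 + (w - (e * Real.pi / 2 : ℝ)) := by
    rw [hz]; unfold sineNode; push_cast; field_simp; ring
  have h1 := charLeading_eq h hnode
  rw [zpow_zero, mul_one] at h1
  have hIc : ‖Complex.I * (c : ℂ)‖ = |c| := by simp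
  have hz1 : R ≤ ‖z‖ := by
    have h2 : ‖(L.a : ℂ)⁻¹ * w‖ = ‖w‖ / L.a := by
      rw [norm_mul, norm_inv, Complex.norm_real, Real.norm_of_nonneg ha.le]; ring
    have h3 := norm_sub_le z (Complex.I * c)
    rw [hz, add_sub_cancel_right, ← hz, h2, hIc, div_le_iff₀ ha] at h3
    nlinarith
  have h4 := hb z hz1
  have him : |z.im| * L.a ≤ |w.im| + |c| * L.a := by
    have : z.im * L.a = w.im + c * L.a := by
      rw [hz, ← Complex.ofReal_inv]
      simp only [Complex.add_im, Complex.im_ofReal_mul, Complex.I_mul_im, Complex.ofReal_re]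
      field_simp
    have h5 : |z.im| * L.a = |w.im + c * L.a| := by rw [← this, abs_mul, abs_of_pos ha]
    rw [h5]
    refine (abs_add_le _ _).trans ?_
    rw [abs_mul, abs_of_pos ha]
  have h6 : κ * Δ z - sineModel e w = κ * (Δ z - L.charLeading z) +
      Complex.I * c * L.a * Complex.sin (w - (e * Real.pi / 2 : ℝ)) := by
    have hk : κ * L.amplitude e c = -L.a := by rw [hκ, neg_mul, div_mul_cancel₀ _ hamp]
    have : (L.a : ℂ) * z = w + Complex.I * c * L.a := by rw [hz]; field_simp
    rw [h1, sineModel]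
    linear_combination -(z * Complex.sin (w - (e * Real.pi / 2 : ℝ))) * hk +
      Complex.sin (w - (e * Real.pi / 2 : ℝ)) * this
  have h7 := Complex.norm_sin_le_exp_abs_im (w - (e * Real.pi / 2 : ℝ))
  have e2 : (w - ((e * Real.pi / 2 : ℝ) : ℂ)).im = w.im := by
    rw [Complex.sub_im, Complex.ofReal_im, sub_zero]
  rw [e2] at h7
  change ‖κ * Δ z - sineModel e w‖ ≤ _
  rw [h6]
  refine (norm_add_le _ _).trans ?_
  rw [norm_mul, norm_mul, norm_mul, hIc, Complex.norm_real, Real.norm_of_nonneg ha.le]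
  have h8 : Real.exp (|z.im| * L.a) ≤ Real.exp (|c| * L.a) * Real.exp |w.im| := by
    rw [← Real.exp_add, Real.exp_le_exp]; linarith
  have h9 := mul_le_mul_of_nonneg_left (h4.trans (mul_le_mul_of_nonneg_left h8 hC.le))
    (norm_nonneg κ)
  have h10 := mul_le_mul_of_nonneg_left h7 (by positivity : 0 ≤ |c| * L.a)
  have := Real.exp_pos |w.im|
  linarith

/-- Partial fractions: 1/(2(1+α₀)) + 1/(2(1-α₀)) = 1/(1-α₀²), likewise for α, and two quarters of ∫
q. -/
theorem charCoeff_eq (hA : (1 + L.α₀) * (1 + L.α) ≠ 0) (hB : (L.α₀ - 1) * (1 - L.α) ≠ 0) :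
    L.charCoeffPos / ((1 + L.α₀) * (1 + L.α)) + -(L.charCoeffNeg / ((L.α₀ - 1) * (1 - L.α))) =
      Real.pi * L.P := by
  obtain ⟨hA1, hA2⟩ := mul_ne_zero_iff.1 hA
  obtain ⟨hB1, hB2⟩ := mul_ne_zero_iff.1 hB
  have a1 : (1 : ℂ) + L.α₀ ≠ 0 := by exact_mod_cast hA1
  have a2 : (1 : ℂ) + L.α ≠ 0 := by exact_mod_cast hA2
  have b1 : (L.α₀ : ℂ) - 1 ≠ 0 := by exact_mod_cast hB1
  have b2 : (1 : ℂ) - L.α ≠ 0 := by exact_mod_cast hB2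
  have hpi : (Real.pi : ℂ) ≠ 0 := by exact_mod_cast Real.pi_ne_zero
  have c1 : (1 : ℂ) - L.α₀ ^ 2 = -((1 + L.α₀) * (L.α₀ - 1)) := by ring
  have c2 : (1 : ℂ) - L.α ^ 2 = (1 + L.α) * (1 - L.α) := by ring
  unfold charCoeffPos charCoeffNeg P
  rw [c1, c2]
  field_simp
  ring

end ReggeProblem

/-! ### The second coefficient of the eigenvalues. -/

namespace ReggeProblem
variable {L : ReggeProblem}

theorem norm_expTransform_le (ha : 0 < L.a) (hq : IntervalIntegrable L.q volume 0 L.a)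
    (n : ℤ) (μ : ℂ) {η : ℂ} (hη : ‖η‖ * L.a ≤ 1) :
    ‖L.expTransform (2 * Real.pi * Complex.I * n / L.a + μ + η)‖ ≤
      ‖L.expTransform (2 * Real.pi * Complex.I * n / L.a + μ)‖ +
      (∫ t in (0 : ℝ)..L.a, ‖L.q t‖) * (Real.exp (|μ.re| * L.a) * (2 * (‖η‖ * L.a))) := by
  have h := norm_expTransform_add_sub_le ha hq (2 * Real.pi * Complex.I * n / L.a + μ) hη
  have hre : (2 * Real.pi * Complex.I * n / L.a + μ : ℂ).re = μ.re := by
    have : (2 * Real.pi * Complex.I * n / L.a : ℂ) = ((2 * Real.pi * n / L.a : ℝ) : ℂ) * Complex.I := by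
      push_cast; ring
    rw [this]; simp
  rw [hre] at h
  have := norm_add_le (L.expTransform (2 * Real.pi * Complex.I * n / L.a + μ + η) -
    L.expTransform (2 * Real.pi * Complex.I * n / L.a + μ))
    (L.expTransform (2 * Real.pi * Complex.I * n / L.a + μ))
  rw [sub_add_cancel] at this
  linarith

/-- The estimate of the second coefficient of an eigenvalue near a node. -/
theorem exists_remainder_bound (ha : 0 < L.a) (hq : IntervalIntegrable L.q volume 0 L.a)
    {Δ : ℂ → ℂ} (hΔ : L.IsCharFun Δ) {e : ℕ} (he : e ≤ 1) {c : ℝ} (h : L.Balanced e c)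
    (hA : (1 + L.α₀) * (1 + L.α) ≠ 0) (hB : (L.α₀ - 1) * (1 - L.α) ≠ 0) (D : ℝ) :
    ∃ (μ : ℂ) (G₁ G₂ G₃ K : ℝ), ∀ (k : ℤ) (z δ : ℂ), K ≤ |(k : ℝ)| → ‖δ‖ ≤ D / |(k : ℝ)| →
      L.a * z - Complex.I * c * L.a = sineNode e (nodeIndex e k) + δ → Δ z = 0 →
      ‖k * (δ / L.a) - L.P‖ ≤ G₁ / |(k : ℝ)| +
        G₂ * ‖L.expTransform (2 * Real.pi * Complex.I * (-nodeIndex e k : ℤ) / L.a + -μ)‖ +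
        G₃ * ‖L.expTransform (2 * Real.pi * Complex.I * (nodeIndex e k : ℤ) / L.a + μ)‖ := by
  obtain ⟨C, R, hC, hR, hasymp⟩ := hΔ.asymptotics ha hq
  have hpi := Real.pi_gt_three
  have ha' : (L.a : ℂ) ≠ 0 := by exact_mod_cast ha.ne'
  -- Chosen so that 2iz = 2πin/a + μ + 2iδ/a for z at displacement δ from node n.
  set μ : ℂ := 2 * Complex.I * (e * Real.pi / 2 : ℝ) / L.a - 2 * c with hμ
  set Q := ∫ t in (0 : ℝ)..L.a, ‖L.q t‖ with hQ
  have hQ0 : 0 ≤ Q := intervalIntegral.integral_nonneg ha.le fun _ _ => norm_nonneg _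
  set c₁ := 2 * Real.pi + 1 + |c| * L.a with hc₁
  have hc₁0 : 0 < c₁ := by positivity
  set m₁ := L.charCoeffPos / ((1 + L.α₀) * (1 + L.α)) with hm₁
  set m₂ := -(L.charCoeffNeg / ((L.α₀ - 1) * (1 - L.α))) with hm₂
  set u₁ : ℂ := (1 + L.α) * (1 - L.α₀) / 4 / ((1 + L.α₀) * (1 + L.α)) with hu₁
  set u₂ : ℂ := -((1 - L.α) * (1 + L.α₀) / 4 / ((L.α₀ - 1) * (1 - L.α))) with hu₂
  have hamp : 0 < ‖L.amplitude e c‖ := norm_pos_iff.2 (amplitude_ne_zero e c hA)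
  set M := Q * (Real.exp (|μ.re| * L.a) * (4 * D)) with hM
  -- In the threshold, |k| ≥ 2D gives ‖δ‖ ≤ 1/2, |k| ≥ c₁ gives |z| ≥ |k|/a, and |k| ≥ aR then gives
  -- |z| ≥ R.
  refine ⟨μ, C * Real.exp (1 + |c| * L.a) / ‖L.amplitude e c‖ * L.a + (Real.pi + c₁) * D ^ 2 / L.a +
    2 * (‖m₁‖ + ‖m₂‖) * D + 3 * (‖u₁‖ * M + ‖u₂‖ * M) + c₁ * D / L.a, 3 * ‖u₁‖, 3 * ‖u₂‖,
    max (max 1 (2 * D)) (max c₁ (L.a * R)), fun k z δ hK hδ hz h0 => ?_⟩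
  obtain ⟨⟨hK1, hKD⟩, hKc, hKR⟩ := (by simpa only [max_le_iff] using hK :
    (1 ≤ |(k : ℝ)| ∧ 2 * D ≤ |(k : ℝ)|) ∧ c₁ ≤ |(k : ℝ)| ∧ L.a * R ≤ |(k : ℝ)|)
  set κ := |(k : ℝ)| with hκ
  have hκ0 : 0 < κ := by linarith
  set n := nodeIndex e k with hn
  have hδ2 : ‖δ‖ ≤ 1 / 2 := hδ.trans (by rw [div_le_iff₀ hκ0]; linarith)
  have hδ1 : ‖δ‖ ≤ 1 := by linarith
  have hIca : ‖Complex.I * c * L.a‖ = |c| * L.a := by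
    simp [abs_of_pos ha]
  -- the distance of `a z` from `k π`
  have hdist : ‖L.a * z - k * Real.pi‖ ≤ c₁ := by
    have e1 : L.a * z - k * Real.pi = ((sineNode e n - k * Real.pi : ℝ) : ℂ) + δ +
        Complex.I * c * L.a := by push_cast; linear_combination hz
    rw [e1]
    refine (norm_add_le _ _).trans ((add_le_add (norm_add_le _ _) le_rfl).trans ?_)
    rw [hIca, Complex.norm_real, Real.norm_eq_abs]
    have := abs_sineNode_nodeIndex_sub_le he k
    linarith
  have hkpi : ‖(k : ℂ) * Real.pi‖ = κ * Real.pi := by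
    rw [norm_mul, Complex.norm_real, Real.norm_of_nonneg Real.pi_pos.le, Complex.norm_intCast]
  have hnaz : ‖(L.a : ℂ) * z‖ = L.a * ‖z‖ := by
    rw [norm_mul, Complex.norm_real, Real.norm_of_nonneg ha.le]
  have hzle : ‖z‖ ≤ (Real.pi + c₁) * κ / L.a := by
    have := norm_add_le (L.a * z - k * Real.pi) (k * Real.pi)
    rw [sub_add_cancel, hnaz, hkpi] at this
    rw [le_div_iff₀ ha]
    nlinarith
  have hzge : κ / L.a ≤ ‖z‖ := by
    have := norm_sub_norm_le (k * Real.pi : ℂ) (L.a * z)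
    rw [hnaz, hkpi, norm_sub_rev] at this
    rw [div_le_iff₀ ha]
    nlinarith
  have hz0 : 0 < ‖z‖ := (div_pos hκ0 ha).trans_le hzge
  have him : |z.im| * L.a ≤ 1 + |c| * L.a := by
    have e1 : z.im * L.a = δ.im + c * L.a := by
      have := congrArg Complex.im hz
      simp only [Complex.sub_im, Complex.im_ofReal_mul, Complex.add_im, Complex.ofReal_im,
        Complex.im_mul_ofReal, Complex.I_im, one_mul] at this
      linarith
    rw [← abs_of_pos ha, ← abs_mul, abs_of_pos ha, e1]
    refine (abs_add_le _ _).trans ?_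
    rw [abs_mul, abs_of_pos ha]
    linarith [Complex.abs_im_le_norm δ]
  -- the equation for `δ`
  have hR' : R ≤ ‖z‖ := le_trans (by rw [le_div_iff₀ ha]; linarith) hzge
  have h1 := hasymp z hR'
  rw [h0, zero_sub, norm_neg, charLeading_eq h hz, charSecond_eq h hA hB hz] at h1
  set t₁ := u₁ * L.expTransform (-(2 * (Complex.I * z))) with ht₁
  set t₂ := u₂ * L.expTransform (2 * (Complex.I * z)) with ht₂
  have h2 : ‖-(z * Complex.sin δ) + (m₁ * Complex.exp (Complex.I * δ) +
      m₂ * Complex.exp (-(Complex.I * δ)) + (t₁ * Complex.exp (Complex.I * δ) +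
        t₂ * Complex.exp (-(Complex.I * δ))))‖ ≤
      C * Real.exp (1 + |c| * L.a) / ‖L.amplitude e c‖ * L.a / κ := by
    have e1 : ∀ x y : ℂ, -(L.amplitude e c * (-1) ^ n * x) + L.amplitude e c * (-1) ^ n * y =
        L.amplitude e c * (-1) ^ n * (-x + y) := fun x y => by ring
    rw [e1, norm_mul, norm_mul, norm_zpow, norm_neg, norm_one, one_zpow, mul_one, mul_comm,
      ← le_div_iff₀ hamp] at h1
    refine h1.trans ?_
    have h3 : C / ‖z‖ ≤ C / (κ / L.a) := div_le_div_of_nonneg_left hC.le (by positivity) hzge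
    have h4 := mul_le_mul h3 (Real.exp_le_exp.2 him) (Real.exp_pos _).le (by positivity)
    refine (div_le_div_of_nonneg_right h4 hamp.le).trans (le_of_eq ?_)
    field_simp
  have h3 := norm_mul_sub_le_of_sine_equation hδ1 h2
  rw [charCoeff_eq hA hB] at h3
  have hη : ‖2 * Complex.I * δ / L.a‖ * L.a = 2 * ‖δ‖ := by
    rw [norm_div, Complex.norm_real, Real.norm_of_nonneg ha.le, div_mul_cancel₀ _ ha.ne']
    simp
  have hzn : z = (n * Real.pi + e * Real.pi / 2 + δ) / L.a + Complex.I * c := by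
    unfold sineNode at hz
    push_cast at hz
    apply mul_left_cancel₀ ha'
    rw [mul_add, mul_div_cancel₀ _ ha']
    linear_combination hz
  have hT₂ : ‖L.expTransform (2 * (Complex.I * z))‖ ≤
      ‖L.expTransform (2 * Real.pi * Complex.I * n / L.a + μ)‖ + M / κ := by
    have e1 : 2 * (Complex.I * z) = 2 * Real.pi * Complex.I * n / L.a + μ +
        2 * Complex.I * δ / L.a := by
      rw [hzn, hμ]; push_cast; field_simp
      linear_combination 2 * c * L.a * Complex.I_sq
    rw [e1]
    refine (norm_expTransform_le ha hq n μ (by rw [hη]; linarith)).trans ?_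
    rw [hη]
    refine add_le_add_right ?_ _
    rw [hM, mul_div_assoc, mul_div_assoc, mul_div_assoc]
    refine mul_le_mul_of_nonneg_left (mul_le_mul_of_nonneg_left ?_ (Real.exp_pos _).le) hQ0
    linarith
  have hT₁ : ‖L.expTransform (-(2 * (Complex.I * z)))‖ ≤
      ‖L.expTransform (2 * Real.pi * Complex.I * (-n : ℤ) / L.a + -μ)‖ + M / κ := by
    have e1 : -(2 * (Complex.I * z)) = 2 * Real.pi * Complex.I * (-n : ℤ) / L.a + -μ +
        -(2 * Complex.I * δ / L.a) := by
      rw [hzn, hμ]; push_cast; field_simp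
      linear_combination -2 * c * L.a * Complex.I_sq
    rw [e1]
    refine (norm_expTransform_le ha hq (-n) (-μ) (by rw [norm_neg, hη]; linarith)).trans ?_
    rw [norm_neg, hη, Complex.neg_re, abs_neg]
    refine add_le_add_right ?_ _
    rw [hM, mul_div_assoc, mul_div_assoc, mul_div_assoc]
    refine mul_le_mul_of_nonneg_left (mul_le_mul_of_nonneg_left ?_ (Real.exp_pos _).le) hQ0
    linarith
  -- az is within c₁ of kπ, so the estimate for zδ passes to πkδ/a with an error O(‖δ‖).
  have hfin : Real.pi * (k * (δ / L.a) - L.P) =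
      -((L.a * z - k * Real.pi) * δ / L.a) + (z * δ - Real.pi * L.P) := by
    field_simp; ring
  have hnorm : Real.pi * ‖k * (δ / L.a) - L.P‖ ≤ c₁ * ‖δ‖ / L.a + ‖z * δ - Real.pi * L.P‖ := by
    have e1 : Real.pi * ‖k * (δ / L.a) - L.P‖ = ‖(Real.pi : ℂ) * (k * (δ / L.a) - L.P)‖ := by
      rw [norm_mul, Complex.norm_real, Real.norm_of_nonneg Real.pi_pos.le]
    rw [e1, hfin]
    refine (norm_add_le _ _).trans (add_le_add_left ?_ _)
    rw [norm_neg, norm_div, norm_mul, Complex.norm_real, Real.norm_of_nonneg ha.le]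
    gcongr
  have hle : ‖k * (δ / L.a) - L.P‖ ≤ Real.pi * ‖k * (δ / L.a) - L.P‖ :=
    le_mul_of_one_le_left (norm_nonneg _) (by linarith)
  have b1 : ‖z‖ * ‖δ‖ ^ 2 ≤ (Real.pi + c₁) * D ^ 2 / L.a / κ := by
    calc ‖z‖ * ‖δ‖ ^ 2 ≤ (Real.pi + c₁) * κ / L.a * (D / κ) ^ 2 := by gcongr
      _ = _ := by field_simp
  have b2 : 2 * (‖m₁‖ + ‖m₂‖) * ‖δ‖ ≤ 2 * (‖m₁‖ + ‖m₂‖) * D / κ := by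
    rw [mul_div_assoc]; gcongr
  have b3 : c₁ * ‖δ‖ / L.a ≤ c₁ * D / L.a / κ := by
    calc c₁ * ‖δ‖ / L.a ≤ c₁ * (D / κ) / L.a := by gcongr
      _ = _ := by ring
  have b4 : ‖t₁‖ ≤ ‖u₁‖ * ‖L.expTransform (2 * Real.pi * Complex.I * (-n : ℤ) / L.a + -μ)‖ +
      ‖u₁‖ * M / κ := by
    rw [ht₁, norm_mul]
    refine (mul_le_mul_of_nonneg_left hT₁ (norm_nonneg _)).trans (le_of_eq (by ring))
  have b5 : ‖t₂‖ ≤ ‖u₂‖ * ‖L.expTransform (2 * Real.pi * Complex.I * n / L.a + μ)‖ +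
      ‖u₂‖ * M / κ := by
    rw [ht₂, norm_mul]
    refine (mul_le_mul_of_nonneg_left hT₂ (norm_nonneg _)).trans (le_of_eq (by ring))
  have split : (C * Real.exp (1 + |c| * L.a) / ‖L.amplitude e c‖ * L.a +
      (Real.pi + c₁) * D ^ 2 / L.a + 2 * (‖m₁‖ + ‖m₂‖) * D + 3 * (‖u₁‖ * M + ‖u₂‖ * M) +
      c₁ * D / L.a) / κ = C * Real.exp (1 + |c| * L.a) / ‖L.amplitude e c‖ * L.a / κ +
      (Real.pi + c₁) * D ^ 2 / L.a / κ + 2 * (‖m₁‖ + ‖m₂‖) * D / κ +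
      3 * (‖u₁‖ * M / κ + ‖u₂‖ * M / κ) + c₁ * D / L.a / κ := by ring
  rw [split]
  linarith

/-- Numbering and asymptotics of the eigenvalues in the case of two balanced exponentials. -/
theorem exists_enumeration_asymptotics (ha : 0 < L.a)
    (hq2 : MemLp L.q 2 (volume.restrict (Ioo 0 L.a))) {e : ℕ} (he : e ≤ 1) {c : ℝ}
    (h : L.Balanced e c) (hA : (1 + L.α₀) * (1 + L.α) ≠ 0) (hB : (L.α₀ - 1) * (1 - L.α) ≠ 0) :
    ∃ ev : {k : ℤ // e = 1 ∨ k ≠ 0} → ℂ, L.IsEigenvalueEnumeration ev ∧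
      Summable fun k : {k : ℤ // e = 1 ∨ k ≠ 0} =>
        ‖((k : ℤ) : ℂ) * (ev k - (sineNode e (nodeIndex e k) / L.a + Complex.I * c)) - L.P‖ ^ 2 := by
  have hq := intervalIntegrable_of_memLp ha hq2
  have ha' : (L.a : ℂ) ≠ 0 := by exact_mod_cast ha.ne'
  obtain ⟨Δ, hΔ, hd⟩ := exists_charFun ha hq
  obtain ⟨C, R, hpert⟩ := isSinePerturbation ha hq hΔ h hA
  have hκ : -(L.a / L.amplitude e c) ≠ 0 :=
    neg_ne_zero.2 (div_ne_zero ha' (amplitude_ne_zero e c hA))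
  have hFd : Differentiable ℂ fun w =>
      -(L.a / L.amplitude e c) * Δ ((L.a : ℂ)⁻¹ * w + Complex.I * c) :=
    (differentiable_const _).mul (hd.comp (by fun_prop))
  obtain ⟨ev, hev, D, N, hD⟩ := hpert.exists_enumeration hFd he
  have hfib : ∀ z, {k | (L.a : ℂ)⁻¹ * ev k + Complex.I * c = z}.encard = analyticOrderAt Δ z := by
    intro z
    have e1 : {k | (L.a : ℂ)⁻¹ * ev k + Complex.I * c = z} =
        {k | ev k = L.a * (z - Complex.I * c)} := by
      ext k
      simp only [mem_ofPred_eq]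
      constructor
      · rintro rfl; field_simp; ring
      · intro hk; rw [hk]; field_simp; ring
    rw [e1, hev, analyticOrderAt_comp_affine hd hκ (inv_ne_zero ha')]
    congr 1
    field_simp; ring
  have henum := hΔ.isEigenvalueEnumeration hd ha hq hfib
  refine ⟨_, henum, ?_⟩
  have hzero : ∀ k, Δ ((L.a : ℂ)⁻¹ * ev k + Complex.I * c) = 0 := fun k => by
    have : (L.a : ℂ)⁻¹ * ev k + Complex.I * c ∈ L.spectrum := henum.1 ▸ mem_range_self k
    rwa [hΔ.spectrum_eq ha hq] at this
  obtain ⟨μ, G₁, G₂, G₃, K, hG⟩ := exists_remainder_bound ha hq hΔ he h hA hB |D|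
  set g₁ : ℤ → ℝ := fun n =>
    ‖L.expTransform (2 * Real.pi * Complex.I * (-n : ℤ) / L.a + -μ)‖ with hg₁
  set g₂ : ℤ → ℝ := fun n => ‖L.expTransform (2 * Real.pi * Complex.I * n / L.a + μ)‖ with hg₂
  have s₁ : Summable fun n => g₁ n ^ 2 :=
    (Equiv.neg ℤ).summable_iff.2 (summable_expTransform_sq ha hq2 (-μ))
  have s₂ : Summable fun n => g₂ n ^ 2 := summable_expTransform_sq ha hq2 μ
  have s₀ : Summable fun k : ℤ => 1 / (k : ℝ) ^ 2 := Real.summable_one_div_int_pow.2 one_lt_two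
  have stot : Summable fun k : ℤ => 3 * (G₁ ^ 2 * (1 / (k : ℝ) ^ 2) +
      G₂ ^ 2 * g₁ (nodeIndex e k) ^ 2 + G₃ ^ 2 * g₂ (nodeIndex e k) ^ 2) :=
    (((s₀.mul_left _).add ((summable_sq_nodeIndex s₁).mul_left _)).add
      ((summable_sq_nodeIndex s₂).mul_left _)).mul_left _
  -- Finitely many k do not matter. For the others (x+y+z)² ≤ 3(x²+y²+z²) leaves 1/k² and the two
  -- Bessel sequences.
  refine Summable.of_norm_bounded_eventually
    (stot.comp_injective (Subtype.val_injective (p := fun k : ℤ => e = 1 ∨ k ≠ 0))) ?_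
  obtain ⟨N', hN'⟩ := exists_nat_ge (max K N)
  have hfinite : {k : {k : ℤ // e = 1 ∨ k ≠ 0} | |(k : ℤ)| ≤ N'}.Finite := by
    refine Set.Finite.preimage (Subtype.val_injective.injOn) (s := {k : ℤ | |k| ≤ N'}) ?_
    exact (finite_Icc (-(N' : ℤ)) N').subset fun k hk => abs_le.1 hk
  refine eventually_cofinite.2 (hfinite.subset fun k hk => ?_)
  by_contra hlt
  refine hk ?_
  rw [mem_ofPred_eq, not_le] at hlt
  have hltR : (N' : ℝ) < |((k : ℤ) : ℝ)| := by
    rw [← Int.cast_abs]; exact_mod_cast hlt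
  have hNk : (N : ℤ) < |(k : ℤ)| := by
    have : (N : ℝ) < |((k : ℤ) : ℝ)| := ((le_max_right _ _).trans hN').trans_lt hltR
    rw [← Int.cast_abs] at this; exact_mod_cast this
  set n := nodeIndex e k with hn
  have hδ : ‖ev k - sineNode e n‖ ≤ |D| / |((k : ℤ) : ℝ)| :=
    (hD k hNk).trans (div_le_div_of_nonneg_right (le_abs_self D) (abs_nonneg _))
  have hb := hG k ((L.a : ℂ)⁻¹ * ev k + Complex.I * c) (ev k - sineNode e n)
    (((le_max_left _ _).trans hN').trans hltR.le) hδ (by field_simp; ring) (hzero k)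
  have e2 : ((k : ℤ) : ℂ) * ((L.a : ℂ)⁻¹ * ev k + Complex.I * c -
      (sineNode e n / L.a + Complex.I * c)) - L.P = (k : ℤ) * ((ev k - sineNode e n) / L.a) - L.P := by
    ring
  rw [e2, Real.norm_of_nonneg (sq_nonneg _)]
  refine (pow_le_pow_left₀ (norm_nonneg _) hb 2).trans ?_
  have e3 : G₁ ^ 2 * (1 / ((k : ℤ) : ℝ) ^ 2) = (G₁ / |((k : ℤ) : ℝ)|) ^ 2 := by
    rw [div_pow, sq_abs]; ring
  simp only [Function.comp_apply]
  rw [e3, ← mul_pow, ← mul_pow]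
  change (_ + G₂ * g₁ n + G₃ * g₂ n) ^ 2 ≤ _
  nlinarith [sq_nonneg (G₁ / |((k : ℤ) : ℝ)| - G₂ * g₁ n), sq_nonneg (G₂ * g₁ n - G₃ * g₂ n),
    sq_nonneg (G₁ / |((k : ℤ) : ℝ)| - G₃ * g₂ n)]

end ReggeProblem

/-! ### The two signs, explicit nodes, and the theorem. -/

namespace ReggeProblem
variable {L : ReggeProblem}

theorem IsEigenvalueEnumeration.comp_equiv {ι κ : Type} {ev : ι → ℂ}
    (h : L.IsEigenvalueEnumeration ev) (f : κ ≃ ι) : L.IsEigenvalueEnumeration (ev ∘ f) := by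
  obtain ⟨h1, Δ, h2, h3, h4⟩ := h
  refine ⟨by rw [f.surjective.range_comp, h1], Δ, h2, h3, fun z => ?_⟩
  rw [← h4 z]
  exact encard_preimage_of_bijective f.bijective {k | ev k = z}

theorem sineNode_one_nodeIndex {k : ℤ} (hk : k ≠ 0) :
    sineNode 1 (nodeIndex 1 k) = Real.pi * (|(k : ℝ)| - 1 / 2) * k.sign := by
  unfold sineNode nodeIndex
  rcases hk.lt_or_gt with h | h
  · have h' : (k : ℝ) < 0 := by exact_mod_cast h
    rw [if_neg h.not_gt, Int.sign_eq_neg_one_of_neg h, abs_of_neg h']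
    push_cast; ring
  · have h' : 0 < (k : ℝ) := by exact_mod_cast h
    rw [if_pos h, Int.sign_eq_one_of_pos h, abs_of_pos h']
    push_cast; ring

theorem sineNode_zero_nodeIndex {k : ℤ} (hk : k ≠ 0) :
    sineNode 0 (nodeIndex 0 k) = Real.pi * (|(k : ℝ)| - 1) * k.sign := by
  unfold sineNode nodeIndex
  rcases hk.lt_or_gt with h | h
  · have h' : (k : ℝ) < 0 := by exact_mod_cast h
    rw [if_neg h.not_gt, Int.sign_eq_neg_one_of_neg h, abs_of_neg h']
    push_cast; ring
  · have h' : 0 < (k : ℝ) := by exact_mod_cast h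
    rw [if_pos h, Int.sign_eq_one_of_pos h, abs_of_pos h']
    push_cast; ring

theorem one_sub_mul_one_add_eq {ε : ℝ} (hε : ε = 1 ∨ ε = -1) (α : ℝ) :
    (1 - ε * α) * (1 + ε * α) = (1 - α) * (1 + α) := by
  rcases hε with rfl | rfl <;> ring

/-- α enters only through α², so one P serves both signs. -/
theorem P_mk_sign (a : ℝ) (q : ℝ → ℂ) (α₀ : ℝ) (β₀ : ℂ) {ε : ℝ} (hε : ε = 1 ∨ ε = -1) (α : ℝ)
    (β : ℂ) : (mk a q α₀ β₀ (ε * α) β).P = (mk a q α₀ β₀ α β).P := by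
  unfold P
  rcases hε with rfl | rfl <;> simp

theorem abs_mul_exp_P₀ {α₀ α : ℝ} (hA : (1 + α₀) * (1 + α) ≠ 0) (hB : (α₀ - 1) * (1 - α) ≠ 0) :
    |(α₀ - 1) * (1 - α)| * Real.exp (P₀ α₀ α) = |(1 + α₀) * (1 + α)| := by
  have e1 : α₀ + α + 1 + α * α₀ = (1 + α₀) * (1 + α) := by ring
  have e2 : α₀ + α - (1 + α * α₀) = (α₀ - 1) * (1 - α) := by ring
  have hB' := abs_pos.2 hB
  rw [P₀, e1, e2, Real.exp_log (div_pos (abs_pos.2 hA) hB'), mul_div_cancel₀ _ hB'.ne']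

/-- The sign of the product of the wave amplitudes decides between the two sine models. -/
theorem balanced_P₀ (ha : 0 < L.a) {e : ℕ}
    (h : 0 < (-1) ^ (e + 1) * (((L.α₀ - 1) * (1 - L.α)) * ((1 + L.α₀) * (1 + L.α)))) :
    L.Balanced e (P₀ L.α₀ L.α / (2 * L.a)) := by
  have hne := h.ne'
  simp only [ne_eq, mul_eq_zero, not_or] at hne
  have hA : (1 + L.α₀) * (1 + L.α) ≠ 0 := mul_ne_zero hne.2.2.1 hne.2.2.2
  have hB : (L.α₀ - 1) * (1 - L.α) ≠ 0 := mul_ne_zero hne.2.1.1 hne.2.1.2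
  have key := abs_mul_exp_P₀ hA hB
  have e1 : 2 * (P₀ L.α₀ L.α / (2 * L.a)) * L.a = P₀ L.α₀ L.α := by field_simp
  unfold Balanced
  rw [e1]
  set A := (1 + L.α₀) * (1 + L.α)
  set B := (L.α₀ - 1) * (1 - L.α)
  -- The hypothesis fixes the relative sign of the amplitudes, which turns the identity of moduli
  -- into the signed identity `Balanced`.
  rcases neg_one_pow_eq_or ℝ e with h1 | h1 <;> rw [pow_succ, h1] at h <;> rw [h1] <;>
    rcases lt_or_gt_of_ne hA with hA' | hA' <;> rcases lt_or_gt_of_ne hB with hB' | hB' <;>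
    simp only [abs_of_pos, abs_of_neg, hA', hB'] at key <;> nlinarith

theorem exists_enumeration_of_sign {a α₀ α : ℝ} (ha : 0 < a) (hα₀ : 0 ≤ α₀) (hα : 0 < α)
    {q : ℝ → ℂ} (β₀ β : ℂ) (hq : MemLp q 2 (volume.restrict (Ioo 0 a))) {ε : ℝ}
    (hε : ε = 1 ∨ ε = -1) {e : ℕ} (he : e ≤ 1)
    (h : 0 < (-1) ^ (e + 1) * ((α₀ - 1) * (1 - α))) :
    ∃ ev : {k : ℤ // e = 1 ∨ k ≠ 0} → ℂ,
      (mk a q α₀ β₀ (ε * α) β).IsEigenvalueEnumeration ev ∧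
      ∃ b : {k : ℤ // e = 1 ∨ k ≠ 0} → ℂ, Summable (fun k => ‖b k‖ ^ 2) ∧
        ∀ k : {k : ℤ // e = 1 ∨ k ≠ 0}, (k : ℤ) ≠ 0 →
          ev k = sineNode e (nodeIndex e k) / a
            + Complex.I * (P₀ α₀ (ε * α) : ℂ) / (2 * a)
            + (mk a q α₀ β₀ α β).P / (k : ℤ) + b k / (k : ℤ) := by
  set L := mk a q α₀ β₀ (ε * α) β with hL
  have hprod : 0 < (-1) ^ (e + 1) * (((L.α₀ - 1) * (1 - L.α)) * ((1 + L.α₀) * (1 + L.α))) := by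
    -- Only (1 - α)(1 + α) enters, which is invariant under α ↦ -α. As (1 + α₀)(1 + α) > 0, both
    -- problems inherit the sign of (α₀ - 1)(1 - α).
    have e1 : ((L.α₀ - 1) * (1 - L.α)) * ((1 + L.α₀) * (1 + L.α)) =
        ((α₀ - 1) * (1 - α)) * ((1 + α₀) * (1 + α)) := by
      simp only [hL]
      linear_combination (α₀ - 1) * (1 + α₀) * one_sub_mul_one_add_eq hε α
    rw [e1, ← mul_assoc]
    exact mul_pos h (by positivity)
  have hne := hprod.ne'
  have hB := left_ne_zero_of_mul (right_ne_zero_of_mul hne)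
  have hA := right_ne_zero_of_mul (right_ne_zero_of_mul hne)
  obtain ⟨ev, hev, hs⟩ := exists_enumeration_asymptotics (L := L) ha hq he
    (balanced_P₀ ha hprod) (by exact_mod_cast hA) (by exact_mod_cast hB)
  -- b k is k times the deviation of `ev k` from the shifted node, minus P. At k = 0, present only
  -- for e = 1, it is -P and plays no role.
  refine ⟨ev, hev, _, hs, fun k hk => ?_⟩
  have hk' : ((k : ℤ) : ℂ) ≠ 0 := by exact_mod_cast hk
  have ha' : (a : ℂ) ≠ 0 := by exact_mod_cast ha.ne'
  rw [hL, P_mk_sign a q α₀ β₀ hε α β]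
  push_cast
  field_simp
  ring

end ReggeProblem

theorem theorem1 (a α₀ α : ℝ) (ha : 0 < a) (hα₀ : 0 ≤ α₀) (hα : 0 < α) :
    -- (1)
    (0 < (α₀ - 1) * (1 - α) →
      ∀ (q : ℝ → ℂ) (β₀ β : ℂ), MemLp q 2 (volume.restrict (Ioo 0 a)) →
      ∀ ε : ℝ, ε = 1 ∨ ε = -1 →
        ∃ ev : ℤ → ℂ, (ReggeProblem.mk a q α₀ β₀ (ε * α) β).IsEigenvalueEnumeration ev ∧
        ∃ b : ℤ → ℂ, Summable (fun k => ‖b k‖ ^ 2) ∧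
          ∀ k : ℤ, k ≠ 0 →
            ev k = (Real.pi / a : ℝ) * ((|(k : ℝ)| - 1 / 2 : ℝ) : ℂ) * (k.sign : ℂ)
              + Complex.I * (ReggeProblem.P₀ α₀ (ε * α) : ℂ) / (2 * a)
              + (ReggeProblem.mk a q α₀ β₀ α β).P / k + b k / k) ∧
    -- (2)
    ((α₀ - 1) * (1 - α) < 0 →
      ∀ (q : ℝ → ℂ) (β₀ β : ℂ), MemLp q 2 (volume.restrict (Ioo 0 a)) →
      ∀ ε : ℝ, ε = 1 ∨ ε = -1 →
        ∃ ev : {k : ℤ // k ≠ 0} → ℂ,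
          (ReggeProblem.mk a q α₀ β₀ (ε * α) β).IsEigenvalueEnumeration ev ∧
        ∃ b : {k : ℤ // k ≠ 0} → ℂ, Summable (fun k => ‖b k‖ ^ 2) ∧
          ∀ k : {k : ℤ // k ≠ 0},
            ev k = (Real.pi / a : ℝ) * ((|((k : ℤ) : ℝ)| - 1 : ℝ) : ℂ) * ((k : ℤ).sign : ℂ)
              + Complex.I * (ReggeProblem.P₀ α₀ (ε * α) : ℂ) / (2 * a)
              + (ReggeProblem.mk a q α₀ β₀ α β).P / (k : ℤ) + b k / (k : ℤ)) ∧
    -- (3)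
    ((α₀ - 1) * (1 - α) = 0 →
      (∃ (q : ℝ → ℂ) (β₀ β : ℂ), MemLp q 2 (volume.restrict (Ioo 0 a)) ∧
        ∀ ε : ℝ, ε = 1 ∨ ε = -1 →
          (ReggeProblem.mk a q α₀ β₀ (ε * α) β).spectrum.Finite) ∧
      ∀ (q : ℝ → ℂ) (β₀ β : ℂ), MemLp q 2 (volume.restrict (Ioo 0 a)) →
        (ReggeProblem.mk a q α₀ β₀ α β).spectrum.Infinite →
        (∃ ev : ℤ → ℂ, (ReggeProblem.mk a q α₀ β₀ α β).IsEigenvalueEnumeration ev) ∧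
        ∀ ev : ℤ → ℂ, (ReggeProblem.mk a q α₀ β₀ α β).IsEigenvalueEnumeration ev →
          Tendsto (fun k => (ev k).im) cofinite atTop) := by 
  refine ⟨fun h q β₀ β hq ε hε => ?_, fun h q β₀ β hq ε hε => ?_, fun h =>
    ⟨ReggeProblem.exists_finite_spectrum a α₀ α ha h, fun q β₀ β hq hinf =>
      ReggeProblem.enumeration_of_no_reflection ha
        (intervalIntegrable_of_memLp ha hq) h
        (mul_pos (by linarith) (by linarith)) hinf⟩⟩
  -- A positive product belongs to e = 1, where every integer is an index; a negative one to e = 0.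
  · obtain ⟨ev, hev, b, hb, hasymp⟩ := ReggeProblem.exists_enumeration_of_sign ha hα₀ hα β₀ β hq hε
      le_rfl (by simpa using h)
    let f : ℤ ≃ {k : ℤ // 1 = 1 ∨ k ≠ 0} := (Equiv.subtypeUnivEquiv fun k => Or.inl rfl).symm
    refine ⟨ev ∘ f, hev.comp_equiv f, b ∘ f, f.summable_iff.2 hb, fun k hk => ?_⟩
    have h1 := hasymp (f k) hk
    have h2 : ((f k : {k : ℤ // 1 = 1 ∨ k ≠ 0}) : ℤ) = k := rfl
    rw [h2, ReggeProblem.sineNode_one_nodeIndex hk] at h1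
    simp only [Function.comp_apply]
    rw [h1]
    push_cast
    ring
  · obtain ⟨ev, hev, b, hb, hasymp⟩ := ReggeProblem.exists_enumeration_of_sign ha hα₀ hα β₀ β hq hε
      zero_le_one (by simpa using h)
    let f : {k : ℤ // k ≠ 0} ≃ {k : ℤ // 0 = 1 ∨ k ≠ 0} :=
      Equiv.subtypeEquivRight fun k => (or_iff_right zero_ne_one).symm
    refine ⟨ev ∘ f, hev.comp_equiv f, b ∘ f, f.summable_iff.2 hb, fun k => ?_⟩
    have h1 := hasymp (f k) k.2
    have h2 : ((f k : {k : ℤ // 0 = 1 ∨ k ≠ 0}) : ℤ) = k := rfl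
    rw [h2, ReggeProblem.sineNode_zero_nodeIndex k.2] at h1
    simp only [Function.comp_apply]
    rw [h1]
    push_cast
    ring
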